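/- Let $g:[0,\infty)\to[0,\infty)$ be continuous and nondecreasing, and suppose that $g(x)=x$ has exactly two solutions in $[0,\infty)$, namely $0$ and $\kappa>0$; that $g$ is Lipschitz on $[0,\kappa]$ and $C^1$ in some $\delta_0$-neighbourhoods (relative to $[0,\infty)$) of $0$ and $\kappa$, with $g'(0)>1$, $g'(\kappa)<1$; and that $|g'(u)-g'(0)|+|g'(\kappa)-g'(\kappa-u)|\le Cu^{\theta}$ for small $u>0$, with some $C>0$, $\theta\in(0,1]$. For $h\ge 0$ consider $$u_t(t,x)=u_{xx}(t,x)-u(t,x)+g(u(t-h,x)),\qquad t,x\in\mathbb R. \tag{1}$$ A wavefront of speed $c>0$ is a solution $u(t,x)=\phi(x+ct)$ of (1) with $\phi\in C^2(\mathbb R)$, $\phi>0$, $\phi(-\infty)=0$, $\phi(+\infty)=\kappa$. Let $c_*=c_*(h)$ denote the smallest $c>0$ for which a wavefront of speed $c$ exists, and let $c_\#=c_\#(h)$ be the unique real $c$ for which $\chi(z,c)=z^2-cz-1+g'(0)e^{-zch}$ has a positive double zero in $z$. For $c>c_\#$ let $\lambda_1(c)<\lambda_2(c)$ be the two positive zeros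 of $\chi(\cdot,c)$. A wavefront is called pushed if its speed is $c_*$ and $c_*>c_\#$. Suppose that, for some $h_0\ge 0$, equation (1) with delay $h=h_0$ has a pushed wavefront. Then there is $\delta>0$ such that, for every $h\ge 0$ with $h\in(h_0-\delta,h_0+\delta)$, equation (1) with delay $h$ has a pushed wavefront. Moreover, for some $h>0$ in $(h_0-\delta,h_0+\delta)$, equation (1) has a pushed wavefront $\phi(x+c_*t)$ whose profile $\phi$ is strictly increasing and satisfies, for some $s_0\in\mathbb R$ and $\varsigma>0$, $$\phi(t+s_0)=e^{\lambda_2 t}+O\big(e^{(\lambda_2+\varsigma)t}\big),\quad t\to-\infty,\qquad \lambda_2=\lambda_2(c_*). \tag{2}$$ In particular, there exist a function $g$ as above and a delay $h>0$ for which equation (1) has a pushed wavefront with strictly increasing profile satisfying (2). -/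

import Mathlib

open Set Filter Topology Asymptotics
open scoped NNReal

namespace DelayedFront

/-- Derivative of `g : ℝ₊ → ℝ₊`: right derivative at `0`, ordinary derivative at positive points.
The birth function is represented by a function on `ℝ` of which only the values on `[0, ∞)` matter. -/
noncomputable def birthDeriv (g : ℝ → ℝ) (u : ℝ) : ℝ := derivWithin g (Ici 0) u

/-- The monostability hypothesis on the birth function `g : ℝ₊ → ℝ₊` with positive equilibrium `κ`. -/
structure Monostable (g : ℝ → ℝ) (κ : ℝ) : Prop where
  kappa_pos : 0 < κ
  mapsTo : MapsTo g (Ici 0) (Ici 0)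
  continuousOn : ContinuousOn g (Ici 0)
  fixed_iff : ∀ u, 0 ≤ u → (g u = u ↔ u = 0 ∨ u = κ)
  lipschitz : ∃ L : ℝ≥0, LipschitzOnWith L g (Icc 0 κ)
  one_lt_deriv_zero : 1 < birthDeriv g 0
  deriv_kappa_lt_one : birthDeriv g κ < 1
  regular : ∃ δ₀ : ℝ, 0 < δ₀ ∧ δ₀ ≤ κ ∧
    ContDiffOn ℝ 1 g (Ico 0 δ₀) ∧ ContDiffOn ℝ 1 g (Ioo (κ - δ₀) (κ + δ₀)) ∧
    ∃ C θ : ℝ, 0 < C ∧ 0 < θ ∧ θ ≤ 1 ∧ ∀ u ∈ Ioo 0 δ₀,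
      |birthDeriv g u - birthDeriv g 0| + |birthDeriv g κ - birthDeriv g (κ - u)| ≤ C * u ^ θ

/-- `u` solves `u_t(t,x) = u_xx(t,x) - u(t,x) + g(u(t-h,x))` at every `(t,x) ∈ ℝ × ℝ`
(the regularity of `u` is imposed separately). -/
def SolvesDelayedEquation (g : ℝ → ℝ) (h : ℝ) (u : ℝ → ℝ → ℝ) : Prop :=
  ∀ t x : ℝ, deriv (fun s => u s x) t
    = iteratedDeriv 2 (fun y => u t y) x - u t x + g (u (t - h) x)

/-- `u(t,x) = φ(x + ct)` is a wavefront: a classical positive solution whose profile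
connects `0` at `-∞` with `κ` at `+∞`. -/
structure IsWavefront (g : ℝ → ℝ) (κ h c : ℝ) (φ : ℝ → ℝ) : Prop where
  smooth : ContDiff ℝ 2 φ
  pos : ∀ s, 0 < φ s
  solves : SolvesDelayedEquation g h (fun t x => φ (x + c * t))
  tendsto_atBot : Tendsto φ atBot (𝓝 0)
  tendsto_atTop : Tendsto φ atTop (𝓝 κ)

/-- The set of admissible (positive) wavefront speeds. -/
def admissibleSpeeds (g : ℝ → ℝ) (κ h : ℝ) : Set ℝ :=
  {c | 0 < c ∧ ∃ φ, IsWavefront g κ h c φ}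

/-- `c` is the minimal speed of propagation `c_*`. -/
def IsMinimalSpeed (g : ℝ → ℝ) (κ h c : ℝ) : Prop := IsLeast (admissibleSpeeds g κ h) c

/-- The characteristic function `χ(z,c) = z² - cz - 1 + p e^{-zch}` (with `p = g'(0)`). -/
noncomputable def charFun (p h c z : ℝ) : ℝ :=
  z ^ 2 - c * z - 1 + p * Real.exp (-(z * c * h))

/-- `c` is the linearly determined speed `c_#`: `χ(·,c)` has a positive double zero. (The second
derivative of `χ(·,c)` is everywhere positive when `p > 0`, so such a zero is exactly double.) -/
def IsLinearSpeed (p h c : ℝ) : Prop :=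
  ∃ z : ℝ, 0 < z ∧ charFun p h c z = 0 ∧ deriv (charFun p h c) z = 0

/-- `u(t,x) = φ(x + ct)` is a pushed front: a wavefront of minimal speed `c = c_*` with `c_* > c_#`. -/
def IsPushedFront (g : ℝ → ℝ) (κ h c : ℝ) (φ : ℝ → ℝ) : Prop :=
  IsWavefront g κ h c φ ∧ IsMinimalSpeed g κ h c ∧
    ∃ cs : ℝ, IsLinearSpeed (birthDeriv g 0) h cs ∧ cs < c

/-- `l₁ < l₂` are all the positive zeros of `χ(·,c)`. -/
def ArePositiveRoots (p h c l₁ l₂ : ℝ) : Prop :=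
  0 < l₁ ∧ l₁ < l₂ ∧ ∀ z : ℝ, 0 < z → (charFun p h c z = 0 ↔ z = l₁ ∨ z = l₂)

/-- `φ(t + s₀) = e^{λ₂ t} + O(e^{(λ₂ + ς) t})` as `t → -∞`, for some `s₀ ∈ ℝ` and `ς > 0`, where
`λ₂` is the larger one of the two positive zeros of `χ(·,c)`. -/
def HasPushedAsymptotics (g : ℝ → ℝ) (h c : ℝ) (φ : ℝ → ℝ) : Prop :=
  ∃ l₁ l₂ : ℝ, ArePositiveRoots (birthDeriv g 0) h c l₁ l₂ ∧
    ∃ s₀ ς : ℝ, 0 < ς ∧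
      (fun t => φ (t + s₀) - Real.exp (l₂ * t)) =O[atBot] (fun t => Real.exp ((l₂ + ς) * t))

end DelayedFront

/-! The profile equation is recast as a fixed-point problem `φ = N φ`, where `N` applies `g` to the
delayed profile and then inverts `-(z'' - cz' - z)` by an explicit positive kernel. As `g` is
nondecreasing, `N` is order preserving, and the argument rests on comparison and compactness rather
than on linearization around the front.

Any wavefront, monotone or not, is a supersolution, and a supersolution yields a monotone front of
the same speed (`Reaction.exists_monoFront_of_supersolution`). So `c_*` is the least speed of
monotone fronts. Monotone fronts are equi-Lipschitz, so after normalization at height `κ/2` they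
subconverge to monotone fronts: the set of pairs `(c, h)` carrying one is closed
(`Reaction.exists_monoFront_of_tendsto`).

Persistence follows. Take `cm` strictly between `c_#(h₀)` and `c_*(h₀)`. Non-existence of fronts at
speed `cm` and negativity of `χ(z, cm)` at some `z > 0` are both open conditions in `h`, so `c_#(h)
< cm < c_*(h)` for all delays close to `h₀`. Continuity of `c_*` is not needed.

For the asymptotics, let `φ` be a monotone front of minimal speed. If it were not `O(e^{zt})` for
some `z` in `(λ₁, λ₂)`, then, since `χ(z) < 0`, the exponential `e^{zt}` could be glued to a
deformation of `φ` to give a supersolution of smaller speed (`MonoFront.exists_slower`),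
contradicting minimality. Hence `φ = O(e^{zt})` for every such `z`. Dividing by `e^{λ₂t}` puts the
equation in divergence form, and a contraction argument gives `φ = A e^{λ₂t}` plus a smaller term
(`MonoFront.improve_decay`). The constant `A` is positive, as otherwise `φ` would decay faster than
every exponential, against the Harnack bound (`MonoFront.not_fast_decay`).

The example is a cubic reaction without delay, where an energy inequality excludes a speed above
`c_#`; persistence then moves it to a positive delay. -/

namespace DelayedFront

open MeasureTheory

/-! ### Exponentially weighted integrals. -/

/-- The exponentially weighted integral `∫₀^∞ e^{-μ s} f(s) ds`. -/
noncomputable def expIntegral (μ : ℝ) (f : ℝ → ℝ) : ℝ :=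
  ∫ s in Ioi (0 : ℝ), Real.exp (-(μ * s)) * f s

lemma integrableOn_exp_neg_mul {μ : ℝ} (hμ : 0 < μ) :
    IntegrableOn (fun s => Real.exp (-(μ * s))) (Ioi (0 : ℝ)) := by
  simpa [neg_mul] using exp_neg_integrableOn_Ioi 0 hμ

lemma integrableOn_exp_mul_of_bounded {μ M : ℝ} (hμ : 0 < μ) {f : ℝ → ℝ} (hf : Measurable f)
    (h0 : ∀ s, 0 ≤ f s) (hM : ∀ s, f s ≤ M) :
    IntegrableOn (fun s => Real.exp (-(μ * s)) * f s) (Ioi (0 : ℝ)) := by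
  refine Integrable.mono' ((integrableOn_exp_neg_mul hμ).mul_const M) ?_ ?_
  · exact ((by fun_prop : Measurable fun s : ℝ => Real.exp (-(μ * s))).mul hf).aestronglyMeasurable
  · refine Eventually.of_forall fun s => ?_
    rw [Real.norm_of_nonneg (mul_nonneg (Real.exp_pos _).le (h0 s))]
    exact mul_le_mul_of_nonneg_left (hM s) (Real.exp_pos _).le

lemma expIntegral_const {μ : ℝ} (hμ : 0 < μ) (M : ℝ) : expIntegral μ (fun _ => M) = M / μ := by
  have := integral_exp_mul_Ioi (neg_lt_zero.2 hμ) 0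
  simp only [neg_mul] at this
  rw [expIntegral, integral_mul_const, this]
  simp
  ring

lemma expIntegral_nonneg {μ : ℝ} {f : ℝ → ℝ} (h0 : ∀ s, 0 ≤ f s) : 0 ≤ expIntegral μ f :=
  integral_nonneg fun s => mul_nonneg (Real.exp_pos _).le (h0 s)

lemma expIntegral_mono {μ M : ℝ} (hμ : 0 < μ) {f₁ f₂ : ℝ → ℝ} (hf₁ : Measurable f₁)
    (hf₂ : Measurable f₂) (h0 : ∀ s, 0 ≤ f₁ s) (hle : ∀ s, f₁ s ≤ f₂ s) (hM : ∀ s, f₂ s ≤ M) :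
    expIntegral μ f₁ ≤ expIntegral μ f₂ := by
  refine integral_mono
    (integrableOn_exp_mul_of_bounded hμ hf₁ h0 fun s => (hle s).trans (hM s))
    (integrableOn_exp_mul_of_bounded hμ hf₂ (fun s => (h0 s).trans (hle s)) hM) fun s => ?_
  exact mul_le_mul_of_nonneg_left (hle s) (Real.exp_pos _).le

lemma expIntegral_le {μ M : ℝ} (hμ : 0 < μ) {f : ℝ → ℝ} (hf : Measurable f)
    (h0 : ∀ s, 0 ≤ f s) (hM : ∀ s, f s ≤ M) : expIntegral μ f ≤ M / μ := by
  rw [← expIntegral_const hμ]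
  exact expIntegral_mono hμ hf measurable_const h0 hM fun _ => le_rfl

lemma expIntegral_sub {μ M : ℝ} (hμ : 0 < μ) {f₁ f₂ : ℝ → ℝ} (hf₁ : Measurable f₁)
    (hf₂ : Measurable f₂) (h₁ : ∀ s, 0 ≤ f₁ s) (h₂ : ∀ s, 0 ≤ f₂ s) (hM₁ : ∀ s, f₁ s ≤ M)
    (hM₂ : ∀ s, f₂ s ≤ M) :
    expIntegral μ (fun s => f₁ s - f₂ s) = expIntegral μ f₁ - expIntegral μ f₂ := by
  rw [expIntegral, expIntegral, expIntegral, ← integral_sub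
    (integrableOn_exp_mul_of_bounded hμ hf₁ h₁ hM₁)
    (integrableOn_exp_mul_of_bounded hμ hf₂ h₂ hM₂)]
  simp only [mul_sub]

lemma tendsto_expIntegral {ι : Type*} {l : Filter ι} [l.IsCountablyGenerated] {μ : ι → ℝ} {μ₀ M : ℝ}
    (hμ₀ : 0 < μ₀) (hμ : Tendsto μ l (𝓝 μ₀)) {f : ι → ℝ → ℝ} {f₀ : ℝ → ℝ}
    (hf : ∀ i, Measurable (f i)) (h0 : ∀ i s, 0 ≤ f i s) (hM : ∀ i s, f i s ≤ M)
    (hlim : ∀ s, Tendsto (fun i => f i s) l (𝓝 (f₀ s))) :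
    Tendsto (fun i => expIntegral (μ i) (f i)) l (𝓝 (expIntegral μ₀ f₀)) := by
  -- The rates `μ i` eventually exceed `μ₀ / 2`, which therefore serves as a common dominating rate.
  refine tendsto_integral_filter_of_dominated_convergence
    (fun s => Real.exp (-(μ₀ / 2 * s)) * M) ?_ ?_ ?_ ?_
  · exact Eventually.of_forall fun i =>
      ((by fun_prop : Measurable fun s : ℝ => Real.exp (-(μ i * s))).mul (hf i)).aestronglyMeasurable
  · filter_upwards [hμ.eventually_const_lt (half_lt_self hμ₀)] with i hi
    refine (ae_restrict_iff' measurableSet_Ioi).2 (Eventually.of_forall fun s hs => ?_)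
    have hs' : (0 : ℝ) < s := hs
    rw [Real.norm_of_nonneg (mul_nonneg (Real.exp_pos _).le (h0 i s))]
    refine mul_le_mul ?_ (hM i s) (h0 i s) (Real.exp_pos _).le
    exact Real.exp_le_exp.2 (by nlinarith)
  · exact (integrableOn_exp_neg_mul (half_pos hμ₀)).mul_const M
  · refine Eventually.of_forall fun s => ?_
    exact ((Real.continuous_exp.tendsto _).comp ((hμ.mul_const s).neg)).mul (hlim s)

/-- The substitution `r = t - s` moves `t` out of the argument of `b` into a prefactor and an
endpoint, so differentiating in `t` requires only continuity of `b`. -/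
lemma expIntegral_comp_sub_left (μ : ℝ) (b : ℝ → ℝ) (t : ℝ) :
    expIntegral μ (fun s => b (t - s))
      = Real.exp (-(μ * t)) * ∫ r in Iio t, Real.exp (μ * r) * b r := by
  have h1 : ∫ s in Ioi (0 : ℝ), Real.exp (-(μ * s)) * b (t - s)
      = ∫ s, (Iio t).indicator (fun r => Real.exp (-(μ * (t - r))) * b r) (t - s) := by
    rw [← integral_indicator measurableSet_Ioi]
    congr 1
    ext s
    by_cases hs : 0 < s
    · rw [indicator_of_mem (by exact hs), indicator_of_mem (by simp [hs])]
      simp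
    · rw [indicator_of_notMem (by exact hs), indicator_of_notMem (by simpa using hs)]
  rw [expIntegral, h1, integral_sub_left_eq_self
    (fun u => (Iio t).indicator (fun r => Real.exp (-(μ * (t - r))) * b r) u) volume t,
    integral_indicator measurableSet_Iio, ← integral_const_mul]
  congr 1
  ext r
  rw [← mul_assoc, ← Real.exp_add]
  ring_nf

lemma hasDerivAt_expIntegral_past {μ M : ℝ} (hμ : 0 < μ) {b : ℝ → ℝ} (hb : Continuous b)
    (h0 : ∀ s, 0 ≤ b s) (hM : ∀ s, b s ≤ M) (t : ℝ) :
    HasDerivAt (fun t => expIntegral μ (fun s => b (t - s)))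
      (b t - μ * expIntegral μ (fun s => b (t - s))) t := by
  have hfin : ∀ x, IntegrableOn (fun r => Real.exp (μ * r) * b r) (Iic x) := by
    intro x
    refine Integrable.mono' ((integrableOn_exp_mul_Iic hμ x).mul_const M) ?_ ?_
    · exact (by fun_prop : Continuous fun r : ℝ => Real.exp (μ * r) * b r).aestronglyMeasurable
    · refine Eventually.of_forall fun s => ?_
      rw [Real.norm_of_nonneg (mul_nonneg (Real.exp_pos _).le (h0 s))]
      exact mul_le_mul_of_nonneg_left (hM s) (Real.exp_pos _).le
  have hI : ∀ x, ∫ r in Iio x, Real.exp (μ * r) * b r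
      = (∫ r in Iic (0 : ℝ), Real.exp (μ * r) * b r) + ∫ r in (0 : ℝ)..x, Real.exp (μ * r) * b r := by
    intro x
    rw [← intervalIntegral.integral_Iic_sub_Iic (hfin 0) (hfin x),
      integral_Iic_eq_integral_Iio (x := x)]
    ring
  have hc : Continuous fun r : ℝ => Real.exp (μ * r) * b r := by fun_prop
  have hd : HasDerivAt (fun x => ∫ r in Iio x, Real.exp (μ * r) * b r) (Real.exp (μ * t) * b t) t := by
    simp_rw [hI]
    exact (intervalIntegral.integral_hasDerivAt_right (hc.intervalIntegrable _ _)
      (hc.stronglyMeasurableAtFilter _ _) hc.continuousAt).const_add _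
  have he : HasDerivAt (fun x => Real.exp (-(μ * x))) (Real.exp (-(μ * t)) * -(μ * 1)) t :=
    (((hasDerivAt_id t).const_mul μ).neg).exp
  have := he.mul hd
  simp_rw [expIntegral_comp_sub_left]
  refine this.congr_deriv ?_
  have h1 : Real.exp (-(μ * t)) * Real.exp (μ * t) = 1 := by rw [← Real.exp_add]; simp
  linear_combination (b t) * h1

lemma hasDerivAt_expIntegral_future {μ M : ℝ} (hμ : 0 < μ) {b : ℝ → ℝ} (hb : Continuous b)
    (h0 : ∀ s, 0 ≤ b s) (hM : ∀ s, b s ≤ M) (t : ℝ) :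
    HasDerivAt (fun t => expIntegral μ (fun s => b (t + s)))
      (μ * expIntegral μ (fun s => b (t + s)) - b t) t := by
  have h := hasDerivAt_expIntegral_past hμ (hb.comp continuous_neg) (fun s => h0 _) (fun s => hM _) (-t)
  have h2 := h.scomp t (hasDerivAt_neg t)
  simp only [Function.comp_def, neg_sub, neg_neg, sub_neg_eq_add, smul_eq_mul] at h2
  simp only [add_comm _ (_ : ℝ)] at h2 ⊢
  exact h2.congr_deriv (by ring)

/-! ### The positive resolvent of `z'' - cz' - z`. -/

/-- `-decayRate c` is the negative root of `z² - cz - 1`. -/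
noncomputable def decayRate (c : ℝ) : ℝ := (√(c ^ 2 + 4) - c) / 2

/-- `growthRate c` is the positive root of `z² - cz - 1`. -/
noncomputable def growthRate (c : ℝ) : ℝ := (√(c ^ 2 + 4) + c) / 2

lemma abs_lt_sqrt_sq_add_four (c : ℝ) : |c| < √(c ^ 2 + 4) := by
  rw [← Real.sqrt_sq_eq_abs]
  exact Real.sqrt_lt_sqrt (sq_nonneg c) (by linarith)

lemma decayRate_pos (c : ℝ) : 0 < decayRate c := by
  have := abs_lt_sqrt_sq_add_four c
  have := le_abs_self c
  unfold decayRate; linarith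

lemma growthRate_pos (c : ℝ) : 0 < growthRate c := by
  have := abs_lt_sqrt_sq_add_four c
  have := neg_le_abs c
  unfold growthRate; linarith

lemma growthRate_sub_decayRate (c : ℝ) : growthRate c - decayRate c = c := by
  unfold growthRate decayRate; ring

lemma decayRate_mul_growthRate (c : ℝ) : decayRate c * growthRate c = 1 := by
  have : √(c ^ 2 + 4) ^ 2 = c ^ 2 + 4 := Real.sq_sqrt (by positivity)
  unfold growthRate decayRate; linear_combination this / 4

/-- AM-GM, since the product of the rates is `1`. It makes the Lipschitz bound for resolvents
independent of `c`. -/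
lemma two_le_rate_add (c : ℝ) : 2 ≤ decayRate c + growthRate c := by
  nlinarith [decayRate_mul_growthRate c, sq_nonneg (decayRate c - growthRate c),
    decayRate_pos c, growthRate_pos c]

lemma continuous_decayRate : Continuous decayRate := by unfold decayRate; fun_prop

lemma continuous_growthRate : Continuous growthRate := by unfold growthRate; fun_prop

/-- The bounded solution `u` of `u'' - cu' - u = -b`. -/
noncomputable def resolvent (c : ℝ) (b : ℝ → ℝ) (t : ℝ) : ℝ :=
  (expIntegral (decayRate c) (fun s => b (t - s)) + expIntegral (growthRate c) (fun s => b (t + s)))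
    / (decayRate c + growthRate c)

/-- The derivative of `resolvent c b`. -/
noncomputable def resolventDeriv (c : ℝ) (b : ℝ → ℝ) (t : ℝ) : ℝ :=
  (growthRate c * expIntegral (growthRate c) (fun s => b (t + s))
    - decayRate c * expIntegral (decayRate c) (fun s => b (t - s))) / (decayRate c + growthRate c)

section Resolvent

variable {c M : ℝ} {b : ℝ → ℝ}

lemma rate_add_pos (c : ℝ) : 0 < decayRate c + growthRate c :=
  add_pos (decayRate_pos c) (growthRate_pos c)

lemma resolvent_const (c M : ℝ) (t : ℝ) : resolvent c (fun _ => M) t = M := by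
  have h1 := decayRate_pos c
  have h2 := growthRate_pos c
  have h3 := decayRate_mul_growthRate c
  rw [resolvent, expIntegral_const h1, expIntegral_const h2, div_add_div _ _ h1.ne' h2.ne', h3]
  field_simp
  ring

lemma resolvent_nonneg (h0 : ∀ s, 0 ≤ b s) (t : ℝ) : 0 ≤ resolvent c b t :=
  div_nonneg (add_nonneg (expIntegral_nonneg fun _ => h0 _) (expIntegral_nonneg fun _ => h0 _))
    (rate_add_pos c).le

lemma measurable_past (hb : Measurable b) (t : ℝ) : Measurable fun s => b (t - s) :=
  hb.comp (by fun_prop)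

lemma measurable_future (hb : Measurable b) (t : ℝ) : Measurable fun s => b (t + s) :=
  hb.comp (by fun_prop)

lemma resolvent_mono {b₁ b₂ : ℝ → ℝ} (hb₁ : Measurable b₁) (hb₂ : Measurable b₂)
    (h0 : ∀ s, 0 ≤ b₁ s) (hle : ∀ s, b₁ s ≤ b₂ s) (hM : ∀ s, b₂ s ≤ M) (t : ℝ) :
    resolvent c b₁ t ≤ resolvent c b₂ t := by
  have h1 := decayRate_pos c
  have h2 := growthRate_pos c
  refine div_le_div_of_nonneg_right (add_le_add ?_ ?_) (rate_add_pos c).le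
  · exact expIntegral_mono h1 (measurable_past hb₁ t)
      (measurable_past hb₂ t) (fun _ => h0 _) (fun _ => hle _) fun _ => hM _
  · exact expIntegral_mono h2 (measurable_future hb₁ t)
      (measurable_future hb₂ t) (fun _ => h0 _) (fun _ => hle _) fun _ => hM _

lemma resolvent_le (hb : Measurable b) (h0 : ∀ s, 0 ≤ b s) (hM : ∀ s, b s ≤ M) (t : ℝ) :
    resolvent c b t ≤ M := by
  rw [← resolvent_const c M t]
  exact resolvent_mono hb measurable_const h0 hM (fun _ => le_rfl) t

lemma resolvent_sub {b₁ b₂ : ℝ → ℝ} (hb₁ : Measurable b₁) (hb₂ : Measurable b₂)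
    (h₁ : ∀ s, 0 ≤ b₁ s) (h₂ : ∀ s, 0 ≤ b₂ s) (hM₁ : ∀ s, b₁ s ≤ M) (hM₂ : ∀ s, b₂ s ≤ M) (t : ℝ) :
    resolvent c (fun s => b₁ s - b₂ s) t = resolvent c b₁ t - resolvent c b₂ t := by
  rw [resolvent, expIntegral_sub (decayRate_pos c)
    (measurable_past hb₁ t) (measurable_past hb₂ t)
    (fun _ => h₁ _) (fun _ => h₂ _) (fun _ => hM₁ _) (fun _ => hM₂ _),
    expIntegral_sub (growthRate_pos c)
    (measurable_future hb₁ t) (measurable_future hb₂ t)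
    (fun _ => h₁ _) (fun _ => h₂ _) (fun _ => hM₁ _) (fun _ => hM₂ _), resolvent, resolvent]
  ring

lemma resolvent_add_right (c : ℝ) (b : ℝ → ℝ) (t τ : ℝ) :
    resolvent c b (t + τ) = resolvent c (fun s => b (s + τ)) t := by
  simp only [resolvent]
  congr 3 <;> · ext s; ring_nf

lemma monotone_resolvent (hb : Monotone b) (h0 : ∀ s, 0 ≤ b s) (hM : ∀ s, b s ≤ M) :
    Monotone (resolvent c b) := by
  intro t t' htt
  obtain ⟨τ, rfl⟩ : ∃ τ, t' = t + τ := ⟨t' - t, by ring⟩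
  rw [resolvent_add_right]
  refine resolvent_mono hb.measurable (hb.measurable.comp (by fun_prop)) h0
    (fun s => hb (show s ≤ s + τ by linarith)) (fun s => hM _) t

lemma tendsto_resolvent {ι : Type*} {l : Filter ι} [l.IsCountablyGenerated] {c : ι → ℝ} {c₀ : ℝ}
    (hc : Tendsto c l (𝓝 c₀)) {b : ι → ℝ → ℝ} {b₀ : ℝ → ℝ} (hb : ∀ i, Measurable (b i))
    (h0 : ∀ i s, 0 ≤ b i s) (hM : ∀ i s, b i s ≤ M)
    (hlim : ∀ s, Tendsto (fun i => b i s) l (𝓝 (b₀ s))) (t : ℝ) :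
    Tendsto (fun i => resolvent (c i) (b i) t) l (𝓝 (resolvent c₀ b₀ t)) := by
  have h1 := (continuous_decayRate.tendsto c₀).comp hc
  have h2 := (continuous_growthRate.tendsto c₀).comp hc
  refine Tendsto.div (Tendsto.add ?_ ?_) (h1.add h2) (rate_add_pos c₀).ne'
  · exact tendsto_expIntegral (decayRate_pos c₀) h1
      (fun i => measurable_past (hb i) t) (fun i _ => h0 i _)
      (fun i _ => hM i _) fun _ => hlim _
  · exact tendsto_expIntegral (growthRate_pos c₀) h2
      (fun i => measurable_future (hb i) t) (fun i _ => h0 i _)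
      (fun i _ => hM i _) fun _ => hlim _

/-- The translates `b(· + τ)` converge pointwise to the constant `r` as `τ → ∞`, and the resolvent
commutes with translations and fixes constants. -/
lemma tendsto_resolvent_atTop (hb : Measurable b) (h0 : ∀ s, 0 ≤ b s) (hM : ∀ s, b s ≤ M) {r : ℝ}
    (hr : Tendsto b atTop (𝓝 r)) : Tendsto (resolvent c b) atTop (𝓝 r) := by
  have := tendsto_resolvent (c := fun _ : ℝ => c) (l := atTop) tendsto_const_nhds
    (b := fun τ s => b (s + τ)) (b₀ := fun _ => r) (fun τ => hb.comp (measurable_id.add_const τ))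
    (fun _ _ => h0 _) (fun _ _ => hM _)
    (fun s => hr.comp (tendsto_atTop_add_const_left _ s tendsto_id)) 0
  rw [resolvent_const] at this
  simpa only [← resolvent_add_right, zero_add] using this

lemma tendsto_resolvent_atBot (hb : Measurable b) (h0 : ∀ s, 0 ≤ b s) (hM : ∀ s, b s ≤ M) {r : ℝ}
    (hr : Tendsto b atBot (𝓝 r)) : Tendsto (resolvent c b) atBot (𝓝 r) := by
  have := tendsto_resolvent (c := fun _ : ℝ => c) (l := atBot) tendsto_const_nhds
    (b := fun τ s => b (s + τ)) (b₀ := fun _ => r) (fun τ => hb.comp (measurable_id.add_const τ))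
    (fun _ _ => h0 _) (fun _ _ => hM _)
    (fun s => hr.comp (tendsto_atBot_add_const_left _ s tendsto_id)) 0
  rw [resolvent_const] at this
  simpa only [← resolvent_add_right, zero_add] using this

lemma hasDerivAt_resolvent (hb : Continuous b) (h0 : ∀ s, 0 ≤ b s) (hM : ∀ s, b s ≤ M) (t : ℝ) :
    HasDerivAt (resolvent c b) (resolventDeriv c b t) t := by
  refine (((hasDerivAt_expIntegral_past (decayRate_pos c) hb h0 hM t).add
    (hasDerivAt_expIntegral_future (growthRate_pos c) hb h0 hM t)).div_const _).congr_deriv ?_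
  rw [resolventDeriv]
  ring

lemma hasDerivAt_resolventDeriv (hb : Continuous b) (h0 : ∀ s, 0 ≤ b s) (hM : ∀ s, b s ≤ M)
    (t : ℝ) : HasDerivAt (resolventDeriv c b)
      (c * resolventDeriv c b t + resolvent c b t - b t) t := by
  refine ((((hasDerivAt_expIntegral_future (growthRate_pos c) hb h0 hM t).const_mul _).sub
    ((hasDerivAt_expIntegral_past (decayRate_pos c) hb h0 hM t).const_mul _)).div_const
      _).congr_deriv ?_
  rw [resolventDeriv, resolvent]
  have h1 := rate_add_pos c
  have h2 := decayRate_mul_growthRate c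
  have h3 := growthRate_sub_decayRate c
  set α := decayRate c
  set β := growthRate c
  generalize expIntegral β (fun s => b (t + s)) = F
  generalize expIntegral α (fun s => b (t - s)) = E
  rw [div_eq_iff h1.ne', ← h3]
  field_simp
  linear_combination (F + E) * h2

/-- The past and future integrals are each nonnegative, so one of them can be dropped. This bound
and its lower counterpart are the source of all the Harnack inequalities below. -/
lemma resolventDeriv_le (h0 : ∀ s, 0 ≤ b s) (t : ℝ) :
    resolventDeriv c b t ≤ growthRate c * resolvent c b t := by
  have h1 : 0 ≤ expIntegral (decayRate c) (fun s => b (t - s)) := expIntegral_nonneg fun _ => h0 _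
  rw [resolventDeriv, resolvent, mul_div_assoc']
  refine div_le_div_of_nonneg_right ?_ (rate_add_pos c).le
  nlinarith [mul_nonneg (rate_add_pos c).le h1]

lemma le_resolventDeriv (h0 : ∀ s, 0 ≤ b s) (t : ℝ) :
    -decayRate c * resolvent c b t ≤ resolventDeriv c b t := by
  have h1 : 0 ≤ expIntegral (growthRate c) (fun s => b (t + s)) := expIntegral_nonneg fun _ => h0 _
  rw [resolventDeriv, resolvent, mul_div_assoc']
  refine div_le_div_of_nonneg_right ?_ (rate_add_pos c).le
  nlinarith [mul_nonneg (rate_add_pos c).le h1]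

lemma abs_resolventDeriv_le (hb : Measurable b) (h0 : ∀ s, 0 ≤ b s) (hM : ∀ s, b s ≤ M) (t : ℝ) :
    |resolventDeriv c b t| ≤ M := by
  have h1 := decayRate_pos c
  have h2 := growthRate_pos c
  have hE0 : 0 ≤ expIntegral (decayRate c) (fun s => b (t - s)) := expIntegral_nonneg fun _ => h0 _
  have hF0 : 0 ≤ expIntegral (growthRate c) (fun s => b (t + s)) := expIntegral_nonneg fun _ => h0 _
  have hE := expIntegral_le h1 (measurable_past hb t)
    (fun s => h0 (t - s)) (fun s => hM _)
  have hF := expIntegral_le h2 (measurable_future hb t)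
    (fun s => h0 (t + s)) (fun s => hM _)
  rw [le_div_iff₀ h1] at hE
  rw [le_div_iff₀ h2] at hF
  have hM0 : 0 ≤ M := (h0 0).trans (hM 0)
  have h4 := two_le_rate_add c
  rw [resolventDeriv, abs_div, abs_of_pos (rate_add_pos c), div_le_iff₀ (rate_add_pos c), abs_le]
  constructor <;> nlinarith [mul_nonneg h1.le hE0, mul_nonneg h2.le hF0]

lemma lipschitz_resolvent (hb : Continuous b) (h0 : ∀ s, 0 ≤ b s) (hM : ∀ s, b s ≤ M) (x y : ℝ) :
    |resolvent c b x - resolvent c b y| ≤ M * |x - y| := by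
  have := Convex.norm_image_sub_le_of_norm_hasDerivWithin_le (s := univ) (f := resolvent c b) (C := M)
    (x := y) (y := x)
    (fun t _ => (hasDerivAt_resolvent hb h0 hM t).hasDerivWithinAt)
    (fun t _ => abs_resolventDeriv_le hb.measurable h0 hM t) convex_univ (mem_univ _) (mem_univ _)
  simpa using this

end Resolvent

/-! ### Monotone fronts: compactness and Harnack inequalities. -/

lemma le_mul_exp_of_deriv_le {u u' : ℝ → ℝ} {ω : ℝ} (hd : ∀ t, HasDerivAt u (u' t) t)
    (hle : ∀ t, u' t ≤ ω * u t) {t s : ℝ} (hs : 0 ≤ s) : u (t + s) ≤ u t * Real.exp (ω * s) := by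
  have he : ∀ x, HasDerivAt (fun x => u x * Real.exp (-(ω * x)))
      (u' x * Real.exp (-(ω * x)) + u x * (Real.exp (-(ω * x)) * -(ω * 1))) x := fun x =>
    (hd x).mul (((hasDerivAt_id x).const_mul ω).neg).exp
  have hanti : Antitone (fun x => u x * Real.exp (-(ω * x))) := by
    refine antitone_of_deriv_nonpos (fun x => (he x).differentiableAt) fun x => ?_
    rw [(he x).deriv]
    nlinarith [hle x, Real.exp_pos (-(ω * x))]
  have h := hanti (by linarith : t ≤ t + s)
  have h2 := mul_le_mul_of_nonneg_right h (Real.exp_pos (ω * (t + s))).le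
  simp only [mul_assoc, ← Real.exp_add] at h2
  ring_nf at h2 ⊢
  simpa using h2

lemma mul_exp_le_of_le_deriv {u u' : ℝ → ℝ} {ω : ℝ} (hd : ∀ t, HasDerivAt u (u' t) t)
    (hle : ∀ t, ω * u t ≤ u' t) {t s : ℝ} (hs : 0 ≤ s) : u t * Real.exp (ω * s) ≤ u (t + s) := by
  have := le_mul_exp_of_deriv_le (u := fun t => -u t) (fun t => (hd t).neg) (ω := ω)
    (fun t => by have := hle t; linarith) (t := t) hs
  linarith

section

/-- A monostable reaction on `[0, κ]`, extended to the real line by clamping. -/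
structure Reaction (G : ℝ → ℝ) (κ L : ℝ) : Prop where
  kappa_pos : 0 < κ
  monotone : Monotone G
  lip_nonneg : 0 ≤ L
  lipschitz : ∀ x y, |G x - G y| ≤ L * |x - y|
  map_zero : G 0 = 0
  map_kappa : G κ = κ
  nonneg : ∀ u, 0 ≤ G u
  le : ∀ u, G u ≤ κ
  lt : ∀ u, 0 < u → u < κ → u < G u

/-- A monotone profile connecting `0` with `κ`, as a fixed point of the integral operator. -/
structure MonoFront (G : ℝ → ℝ) (κ c h : ℝ) (φ : ℝ → ℝ) : Prop where
  continuous : Continuous φ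
  monotone : Monotone φ
  nonneg : ∀ t, 0 ≤ φ t
  le : ∀ t, φ t ≤ κ
  fixed : ∀ t, φ t = resolvent c (fun s => G (φ (s - c * h))) t
  tendsto_atBot : Tendsto φ atBot (𝓝 0)
  tendsto_atTop : Tendsto φ atTop (𝓝 κ)

variable {G : ℝ → ℝ} {κ L : ℝ}

lemma continuous_of_abs_sub_le {f : ℝ → ℝ} {K : ℝ} (hK : 0 ≤ K)
    (hf : ∀ x y, |f x - f y| ≤ K * |x - y|) : Continuous f := by
  have : LipschitzWith K.toNNReal f := LipschitzWith.of_dist_le_mul fun x y => by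
    simpa [Real.dist_eq, Real.coe_toNNReal _ hK] using hf x y
  exact this.continuous

lemma Reaction.continuous (hG : Reaction G κ L) : Continuous G :=
  continuous_of_abs_sub_le hG.lip_nonneg hG.lipschitz

lemma Reaction.eq_zero_of_fixed (hG : Reaction G κ L) {u : ℝ} (h0 : 0 ≤ u) (h1 : u < κ)
    (h : G u ≤ u) : u = 0 := by
  by_contra hne
  exact absurd (hG.lt u (lt_of_le_of_ne h0 (Ne.symm hne)) h1) (not_lt.2 h)

lemma Reaction.eq_kappa_of_fixed (hG : Reaction G κ L) {u : ℝ} (h0 : 0 < u) (h1 : u ≤ κ)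
    (h : G u ≤ u) : u = κ := by
  by_contra hne
  exact absurd (hG.lt u h0 (lt_of_le_of_ne h1 hne)) (not_lt.2 h)

/-- Compactness of the countable product of intervals gives convergence at rational points; the
common Lipschitz constant extends it to all real points. -/
lemma exists_tendsto_subseq_of_lipschitz {φ : ℕ → ℝ → ℝ} {K κ : ℝ} (hK : 0 ≤ K)
    (h0 : ∀ n t, 0 ≤ φ n t) (h1 : ∀ n t, φ n t ≤ κ)
    (hlip : ∀ n x y, |φ n x - φ n y| ≤ K * |x - y|) :
    ∃ (θ : ℕ → ℕ) (φ₀ : ℝ → ℝ), StrictMono θ ∧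
      ∀ t, Tendsto (fun n => φ (θ n) t) atTop (𝓝 (φ₀ t)) := by
  let x : ℕ → (ℚ → Icc (0 : ℝ) κ) := fun n q => ⟨φ n q, h0 n q, h1 n q⟩
  obtain ⟨y, θ, hθ, hy⟩ := CompactSpace.tendsto_subseq x
  have hq : ∀ q : ℚ, Tendsto (fun n => φ (θ n) q) atTop (𝓝 (y q)) := fun q =>
    (continuous_subtype_val.tendsto _).comp ((tendsto_pi_nhds.1 hy) q)
  have hcau : ∀ t, ∃ l, Tendsto (fun n => φ (θ n) t) atTop (𝓝 l) := by
    intro t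
    refine cauchySeq_tendsto_of_complete (Metric.cauchySeq_iff.2 fun ε hε => ?_)
    obtain ⟨q, hq1, hq2⟩ := exists_rat_btwn (show t < t + ε / (4 * (K + 1)) by
      have : 0 < ε / (4 * (K + 1)) := by positivity
      linarith)
    obtain ⟨N, hN⟩ := Metric.cauchySeq_iff.1 (hq q).cauchySeq (ε / 2) (half_pos hε)
    refine ⟨N, fun m hm n hn => ?_⟩
    have hKt : K * |t - q| ≤ ε / 4 := by
      rw [abs_sub_comm, abs_of_pos (sub_pos.2 hq1)]
      calc K * (q - t) ≤ (K + 1) * (ε / (4 * (K + 1))) := by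
            apply mul_le_mul <;> linarith
        _ = ε / 4 := by field_simp
    have e1 := abs_le.1 ((hlip (θ m) t q).trans hKt)
    have e2 := abs_le.1 ((hlip (θ n) t q).trans hKt)
    have e3 := abs_lt.1 (hN m hm n hn)
    rw [Real.dist_eq, abs_lt]
    constructor <;> linarith [e1.1, e1.2, e2.1, e2.2, e3.1, e3.2]
  choose φ₀ hφ₀ using hcau
  exact ⟨θ, φ₀, hθ, hφ₀⟩

lemma Reaction.tendsto_delay_atTop (hG : Reaction G κ L) {φ : ℝ → ℝ} {r : ℝ} (d : ℝ)
    (hr : Tendsto φ atTop (𝓝 r)) : Tendsto (fun s => G (φ (s - d))) atTop (𝓝 (G r)) :=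
  (hG.continuous.tendsto r).comp (hr.comp (tendsto_atTop_add_const_right _ (-d) tendsto_id))

lemma Reaction.tendsto_delay_atBot (hG : Reaction G κ L) {φ : ℝ → ℝ} {r : ℝ} (d : ℝ)
    (hr : Tendsto φ atBot (𝓝 r)) : Tendsto (fun s => G (φ (s - d))) atBot (𝓝 (G r)) :=
  (hG.continuous.tendsto r).comp (hr.comp (tendsto_atBot_add_const_right _ (-d) tendsto_id))

lemma Reaction.monotone_delay (hG : Reaction G κ L) {φ : ℝ → ℝ} (hφ : Monotone φ) (d : ℝ) :
    Monotone fun s => G (φ (s - d)) :=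
  fun _ _ hxy => hG.monotone (hφ (by linarith))

/-- Normalized almost fixed points of the integral operator subconverge to a monotone front. -/
lemma Reaction.exists_monoFront_of_approx (hG : Reaction G κ L) {c h : ℕ → ℝ} {c₀ h₀ : ℝ}
    (hc : Tendsto c atTop (𝓝 c₀)) (hh : Tendsto h atTop (𝓝 h₀)) {φ : ℕ → ℝ → ℝ} {K : ℝ}
    (hK : 0 ≤ K) (hmono : ∀ n, Monotone (φ n)) (h0 : ∀ n t, 0 ≤ φ n t) (h1 : ∀ n t, φ n t ≤ κ)
    (hlip : ∀ n x y, |φ n x - φ n y| ≤ K * |x - y|) (hmid : ∀ n, φ n 0 = κ / 2) {ε : ℕ → ℝ}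
    (hε : Tendsto ε atTop (𝓝 0))
    (happ : ∀ n t, |φ n t - resolvent (c n) (fun s => G (φ n (s - c n * h n))) t| ≤ ε n) :
    ∃ φ₀, MonoFront G κ c₀ h₀ φ₀ := by
  have hκ := hG.kappa_pos
  obtain ⟨θ, φ₀, hθ, hlim⟩ := exists_tendsto_subseq_of_lipschitz hK h0 h1 hlip
  have hθ' := hθ.tendsto_atTop
  have hm : Monotone φ₀ := fun x y hxy =>
    le_of_tendsto_of_tendsto' (hlim x) (hlim y) fun n => hmono _ hxy
  have hn : ∀ t, 0 ≤ φ₀ t := fun t => ge_of_tendsto' (hlim t) fun n => h0 _ _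
  have hl : ∀ t, φ₀ t ≤ κ := fun t => le_of_tendsto' (hlim t) fun n => h1 _ _
  have hlip₀ : ∀ x y, |φ₀ x - φ₀ y| ≤ K * |x - y| := fun x y =>
    le_of_tendsto' ((hlim x).sub (hlim y)).abs fun n => hlip _ _ _
  have hcont : Continuous φ₀ := continuous_of_abs_sub_le hK hlip₀
  have hch : Tendsto (fun n => c (θ n) * h (θ n)) atTop (𝓝 (c₀ * h₀)) :=
    (hc.comp hθ').mul (hh.comp hθ')
  have hdelay : ∀ s, Tendsto (fun n => φ (θ n) (s - c (θ n) * h (θ n))) atTop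
      (𝓝 (φ₀ (s - c₀ * h₀))) := by
    intro s
    -- The delays vary with `n`; the common Lipschitz constant absorbs the difference.
    have hz : Tendsto (fun n => K * |c₀ * h₀ - c (θ n) * h (θ n)|) atTop (𝓝 0) := by
      simpa using ((tendsto_const_nhds (x := c₀ * h₀)).sub hch).abs.const_mul K
    have hd : Tendsto (fun n => φ (θ n) (s - c (θ n) * h (θ n)) - φ (θ n) (s - c₀ * h₀)) atTop
        (𝓝 0) := by
      refine squeeze_zero_norm (fun n => ?_) hz
      refine (hlip _ _ _).trans (le_of_eq ?_)
      congr 2; ring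
    simpa using hd.add (hlim (s - c₀ * h₀))
  have hfix : ∀ t, φ₀ t = resolvent c₀ (fun s => G (φ₀ (s - c₀ * h₀))) t := by
    intro t
    have hr := tendsto_resolvent (hc.comp hθ') (M := κ)
      (b := fun n s => G (φ (θ n) (s - c (θ n) * h (θ n))))
      (fun n => (hG.monotone_delay (hmono _) _).measurable)
      (fun n s => hG.nonneg _) (fun n s => hG.le _)
      (fun s => (hG.continuous.tendsto _).comp (hdelay s)) t
    have hd : Tendsto (fun n => φ (θ n) t -
        resolvent (c (θ n)) (fun s => G (φ (θ n) (s - c (θ n) * h (θ n)))) t) atTop (𝓝 0) :=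
      squeeze_zero_norm (fun n => happ _ _) (hε.comp hθ')
    have h2 := hd.add hr
    simp only [Function.comp_apply, sub_add_cancel, zero_add] at h2
    exact tendsto_nhds_unique (hlim t) h2
  have hmid₀ : φ₀ 0 = κ / 2 := by
    refine tendsto_nhds_unique (hlim 0) ?_
    simp only [hmid]; exact tendsto_const_nhds
  have hmeas := (hG.monotone_delay hm (c₀ * h₀)).measurable
  have hfun : φ₀ = resolvent c₀ (fun s => G (φ₀ (s - c₀ * h₀))) := funext hfix
  have hbot := tendsto_atBot_ciInf hm ⟨0, by rintro _ ⟨t, rfl⟩; exact hn t⟩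
  have htop := tendsto_atTop_ciSup hm ⟨κ, by rintro _ ⟨t, rfl⟩; exact hl t⟩
  set l := ⨅ t, φ₀ t
  set r := ⨆ t, φ₀ t
  have hl0 : 0 ≤ l := ge_of_tendsto' hbot hn
  have hl1 : l ≤ κ / 2 := hmid₀ ▸ hm.le_of_tendsto hbot 0
  have hr0 : κ / 2 ≤ r := hmid₀ ▸ hm.ge_of_tendsto htop 0
  have hr1 : r ≤ κ := le_of_tendsto' htop hl
  -- Both limits of the profile are fixed points of `G`. The normalization `φ₀ 0 = κ / 2` leaves
  -- only `0` on the left and `κ` on the right.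
  have hGl : G l = l := by
    refine tendsto_nhds_unique ?_ hbot
    rw [hfun]
    exact tendsto_resolvent_atBot hmeas (fun _ => hG.nonneg _) (fun _ => hG.le _)
      (hG.tendsto_delay_atBot _ hbot)
  have hGr : G r = r := by
    refine tendsto_nhds_unique ?_ htop
    rw [hfun]
    exact tendsto_resolvent_atTop hmeas (fun _ => hG.nonneg _) (fun _ => hG.le _)
      (hG.tendsto_delay_atTop _ htop)
  rw [hG.eq_zero_of_fixed hl0 (by linarith) hGl.le] at hbot
  rw [hG.eq_kappa_of_fixed (by linarith) hr1 hGr.le] at htop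
  exact ⟨φ₀, hcont, hm, hn, hl, hfix, hbot, htop⟩

namespace MonoFront

variable {c h : ℝ} {φ : ℝ → ℝ}

/-- The derivative of the profile. -/
noncomputable def profileDeriv (G : ℝ → ℝ) (c h : ℝ) (φ : ℝ → ℝ) : ℝ → ℝ :=
  resolventDeriv c (fun s => G (φ (s - c * h)))

lemma continuous_forcing (hG : Reaction G κ L) (hφ : MonoFront G κ c h φ) :
    Continuous fun s => G (φ (s - c * h)) :=
  hG.continuous.comp (hφ.continuous.comp (by fun_prop))

lemma hasDerivAt (hG : Reaction G κ L) (hφ : MonoFront G κ c h φ) (t : ℝ) :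
    HasDerivAt φ (profileDeriv G c h φ t) t := by
  have := hasDerivAt_resolvent (c := c) (hφ.continuous_forcing hG) (fun s => hG.nonneg _)
    (fun s => hG.le _) t
  rwa [← funext hφ.fixed] at this

lemma hasDerivAt_profileDeriv (hG : Reaction G κ L) (hφ : MonoFront G κ c h φ) (t : ℝ) :
    HasDerivAt (profileDeriv G c h φ)
      (c * profileDeriv G c h φ t + φ t - G (φ (t - c * h))) t := by
  have := hasDerivAt_resolventDeriv (c := c) (hφ.continuous_forcing hG) (fun s => hG.nonneg _)
    (fun s => hG.le _) t
  rwa [← hφ.fixed] at this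

lemma profileDeriv_le (hG : Reaction G κ L) (hφ : MonoFront G κ c h φ) (t : ℝ) :
    profileDeriv G c h φ t ≤ growthRate c * φ t := by
  have := resolventDeriv_le (c := c) (b := fun s => G (φ (s - c * h))) (fun s => hG.nonneg _) t
  rwa [← hφ.fixed] at this

lemma profileDeriv_nonneg (hG : Reaction G κ L) (hφ : MonoFront G κ c h φ) (t : ℝ) :
    0 ≤ profileDeriv G c h φ t := by
  rw [← (hφ.hasDerivAt hG t).deriv]
  exact hφ.monotone.deriv_nonneg

lemma profileDeriv_le_kappa (hG : Reaction G κ L) (hφ : MonoFront G κ c h φ) (t : ℝ) :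
    profileDeriv G c h φ t ≤ κ :=
  (le_abs_self _).trans (abs_resolventDeriv_le (hφ.continuous_forcing hG).measurable
    (fun _ => hG.nonneg _) (fun _ => hG.le _) t)

lemma lipschitz (hG : Reaction G κ L) (hφ : MonoFront G κ c h φ) (x y : ℝ) :
    |φ x - φ y| ≤ κ * |x - y| := by
  have := lipschitz_resolvent (c := c) (hφ.continuous_forcing hG) (fun s => hG.nonneg _)
    (fun s => hG.le _) x y
  rwa [← hφ.fixed, ← hφ.fixed] at this

lemma le_mul_exp (hG : Reaction G κ L) (hφ : MonoFront G κ c h φ) (t : ℝ) {s : ℝ} (hs : 0 ≤ s) :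
    φ (t + s) ≤ φ t * Real.exp (growthRate c * s) :=
  le_mul_exp_of_deriv_le (hφ.hasDerivAt hG) (hφ.profileDeriv_le hG) hs

/-- By the exponential growth bound a zero would persist for all later times, contradicting the
limit `κ`. -/
lemma pos (hG : Reaction G κ L) (hφ : MonoFront G κ c h φ) (t : ℝ) : 0 < φ t := by
  refine lt_of_le_of_ne (hφ.nonneg t) fun h0 => ?_
  have hz : ∀ s, t ≤ s → φ s ≤ 0 := fun s hs => by
    have := hφ.le_mul_exp hG t (sub_nonneg.2 hs)
    rwa [← h0, zero_mul, add_sub_cancel] at this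
  exact absurd (le_of_tendsto hφ.tendsto_atTop ((eventually_ge_atTop t).mono hz))
    (not_le.2 hG.kappa_pos)

lemma shift (hφ : MonoFront G κ c h φ) (τ : ℝ) : MonoFront G κ c h (fun t => φ (t + τ)) where
  continuous := hφ.continuous.comp (by fun_prop)
  monotone := fun x y hxy => hφ.monotone (by linarith)
  nonneg := fun t => hφ.nonneg _
  le := fun t => hφ.le _
  fixed := fun t => by
    rw [hφ.fixed, resolvent_add_right]
    congr 1; ext s; ring_nf
  tendsto_atBot := hφ.tendsto_atBot.comp (tendsto_atBot_add_const_right _ τ tendsto_id)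
  tendsto_atTop := hφ.tendsto_atTop.comp (tendsto_atTop_add_const_right _ τ tendsto_id)

lemma exists_eq_half (hG : Reaction G κ L) (hφ : MonoFront G κ c h φ) : ∃ τ, φ τ = κ / 2 := by
  have hκ := hG.kappa_pos
  obtain ⟨x, hx⟩ := (hφ.tendsto_atBot.eventually_lt_const (half_pos hκ)).exists
  obtain ⟨y, hy⟩ := (hφ.tendsto_atTop.eventually_const_lt (half_lt_self hκ)).exists
  exact mem_range_of_exists_le_of_exists_ge hφ.continuous ⟨x, hx.le⟩ ⟨y, hy.le⟩

/-- Harnack inequality for the increments of the profile. -/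
lemma increment_bounds (hG : Reaction G κ L) (hφ : MonoFront G κ c h φ) {r : ℝ} (hr : 0 ≤ r)
    (t : ℝ) {s : ℝ} (hs : 0 ≤ s) :
    φ (t + s + r) - φ (t + s) ≤ (φ (t + r) - φ t) * Real.exp (growthRate c * s) ∧
    (φ (t + r) - φ t) * Real.exp (-decayRate c * s) ≤ φ (t + s + r) - φ (t + s) := by
  set b : ℝ → ℝ := fun s => G (φ (s - c * h)) with hb
  have hbc : Continuous b := hφ.continuous_forcing hG
  have hbc' : Continuous fun s => b (s + r) := hbc.comp (by fun_prop)
  have hb0 : ∀ s, 0 ≤ b s := fun s => hG.nonneg _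
  have hb1 : ∀ s, b s ≤ κ := fun s => hG.le _
  have hd0 : ∀ s, 0 ≤ b (s + r) - b s := fun s =>
    sub_nonneg.2 (hG.monotone (hφ.monotone (by linarith)))
  have hd1 : ∀ s, b (s + r) - b s ≤ κ := fun s => by linarith [hb0 s, hb1 (s + r)]
  -- An increment of the profile is itself the resolvent of a nonnegative forcing, so the bounds for
  -- resolvents apply to it.
  have hfun : ∀ t, φ (t + r) - φ t = resolvent c (fun s => b (s + r) - b s) t := fun t => by
    rw [resolvent_sub hbc'.measurable hbc.measurable (fun s => hb0 _) hb0 (fun s => hb1 _) hb1,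
      ← resolvent_add_right, ← hφ.fixed, ← hφ.fixed]
  have hder := hasDerivAt_resolvent (c := c) (hbc'.sub hbc) hd0 hd1
  rw [hfun, hfun]
  exact ⟨le_mul_exp_of_deriv_le hder (resolventDeriv_le hd0) hs,
    mul_exp_le_of_le_deriv hder (le_resolventDeriv hd0) hs⟩

/-- Harnack inequality for the derivative of the profile. -/
lemma profileDeriv_bounds (hG : Reaction G κ L) (hφ : MonoFront G κ c h φ) (t : ℝ) {s : ℝ}
    (hs : 0 ≤ s) :
    profileDeriv G c h φ (t + s) ≤ profileDeriv G c h φ t * Real.exp (growthRate c * s) ∧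
    profileDeriv G c h φ t * Real.exp (-decayRate c * s) ≤ profileDeriv G c h φ (t + s) := by
  have hlim : ∀ x, Tendsto (fun r => r⁻¹ * (φ (x + r) - φ x)) (𝓝[>] 0)
      (𝓝 (profileDeriv G c h φ x)) := fun x => by
    simpa using (hasDerivAt_iff_tendsto_slope_zero.1 (hφ.hasDerivAt hG x)).mono_left
      (show 𝓝[>] (0 : ℝ) ≤ 𝓝[≠] 0 from nhdsWithin_mono 0 fun y hy => ne_of_gt hy)
  constructor
  · refine le_of_tendsto_of_tendsto (hlim (t + s)) ((hlim t).mul_const _) ?_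
    filter_upwards [self_mem_nhdsWithin] with r (hr : 0 < r)
    rw [mul_assoc]
    exact mul_le_mul_of_nonneg_left (hφ.increment_bounds hG hr.le t hs).1 (inv_pos.2 hr).le
  · refine le_of_tendsto_of_tendsto ((hlim t).mul_const _) (hlim (t + s)) ?_
    filter_upwards [self_mem_nhdsWithin] with r (hr : 0 < r)
    rw [mul_assoc]
    exact mul_le_mul_of_nonneg_left (hφ.increment_bounds hG hr.le t hs).2 (inv_pos.2 hr).le

/-- The two Harnack bounds propagate a zero of the derivative forwards and backwards, which would
make the profile constant. -/
lemma profileDeriv_pos (hG : Reaction G κ L) (hφ : MonoFront G κ c h φ) (t : ℝ) :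
    0 < profileDeriv G c h φ t := by
  refine lt_of_le_of_ne (hφ.profileDeriv_nonneg hG t) fun h0 => ?_
  have hz : ∀ s, deriv φ s = 0 := fun s => by
    rw [(hφ.hasDerivAt hG s).deriv]
    refine le_antisymm ?_ (hφ.profileDeriv_nonneg hG s)
    rcases le_total t s with hs | hs
    · have := (hφ.profileDeriv_bounds hG t (sub_nonneg.2 hs)).1
      rwa [← h0, zero_mul, add_sub_cancel] at this
    · have := (hφ.profileDeriv_bounds hG s (sub_nonneg.2 hs)).2
      rw [add_sub_cancel, ← h0] at this
      exact nonpos_of_mul_nonpos_left this (Real.exp_pos _)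
  have hconst := is_const_of_deriv_eq_zero (fun s => (hφ.hasDerivAt hG s).differentiableAt) hz
  have h1 : φ = fun _ => φ 0 := funext fun s => hconst s 0
  have ha := hφ.tendsto_atBot
  have hb := hφ.tendsto_atTop
  rw [h1] at ha hb
  have e1 := tendsto_nhds_unique ha tendsto_const_nhds
  have e2 := tendsto_nhds_unique hb tendsto_const_nhds
  exact hG.kappa_pos.ne' (e2.trans e1.symm)

lemma strictMono (hG : Reaction G κ L) (hφ : MonoFront G κ c h φ) : StrictMono φ :=
  strictMono_of_deriv_pos fun t => by
    rw [(hφ.hasDerivAt hG t).deriv]; exact hφ.profileDeriv_pos hG t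

/-- The second derivative of the profile is at most `growthRate c` times the first one. -/
lemma second_deriv_le (hG : Reaction G κ L) (hφ : MonoFront G κ c h φ) (t : ℝ) :
    c * profileDeriv G c h φ t + φ t - G (φ (t - c * h))
      ≤ growthRate c * profileDeriv G c h φ t := by
  -- This gap in the Harnack bound vanishes at `s = 0` and is nonnegative for `s > 0`, so its
  -- derivative at `0` is nonnegative.
  have h1 : HasDerivAt (fun s => profileDeriv G c h φ t * Real.exp (growthRate c * s)
      - profileDeriv G c h φ (t + s))
      (profileDeriv G c h φ t * (Real.exp (growthRate c * 0) * (growthRate c * 1)) -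
        (c * profileDeriv G c h φ t + φ t - G (φ (t - c * h)))) 0 := by
    refine HasDerivAt.sub ?_ ?_
    · exact (((hasDerivAt_id (0 : ℝ)).const_mul (growthRate c)).exp).const_mul _
    · have := hφ.hasDerivAt_profileDeriv hG (t + 0)
      simpa using this.comp_const_add t 0
  have h2 := (hasDerivAt_iff_tendsto_slope_zero.1 h1).mono_left
      (show 𝓝[>] (0 : ℝ) ≤ 𝓝[≠] 0 from nhdsWithin_mono 0 fun y hy => ne_of_gt hy)
  have h3 := ge_of_tendsto h2 (b := 0) (by
    filter_upwards [self_mem_nhdsWithin] with s (hs : 0 < s)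
    refine mul_nonneg (inv_pos.2 hs).le ?_
    have := (hφ.profileDeriv_bounds hG t hs.le).1
    simp only [zero_add, mul_zero, Real.exp_zero, add_zero, mul_one, sub_self, sub_zero]
    linarith)
  simp only [mul_zero, Real.exp_zero, one_mul, mul_one] at h3
  linarith

end MonoFront

end

/-! ### Supersolutions, the obstacle problem and existence of monotone fronts. -/

section

variable {G : ℝ → ℝ} {κ L : ℝ}

/-- `ψ` is a supersolution (in the viscosity sense) of the profile equation wherever `ψ < κ`. -/
def IsSupersolution (G : ℝ → ℝ) (κ c h : ℝ) (ψ : ℝ → ℝ) : Prop :=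
  ∀ t, ψ t < κ → ∃ (q q' : ℝ → ℝ) (q₂ : ℝ), q t = ψ t ∧ (∀ᶠ s in 𝓝 t, ψ s ≤ q s) ∧
    (∀ᶠ s in 𝓝 t, HasDerivAt q (q' s) s) ∧ HasDerivAt q' q₂ t ∧
    q₂ - c * q' t - q t + G (ψ (t - c * h)) ≤ 0

/-- A positive second derivative would make the local maximum a local minimum too, so `f` would be
locally constant. -/
lemma deriv_eq_zero_and_second_deriv_nonpos {f f' : ℝ → ℝ} {f₂ t : ℝ}
    (hf : ∀ᶠ s in 𝓝 t, HasDerivAt f (f' s) s) (hf' : HasDerivAt f' f₂ t) (hmax : IsLocalMax f t) :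
    f' t = 0 ∧ f₂ ≤ 0 := by
  have h1 : f' t = 0 := hmax.hasDerivAt_eq_zero hf.self_of_nhds
  refine ⟨h1, not_lt.1 fun hpos => ?_⟩
  have hd : deriv f =ᶠ[𝓝 t] f' := hf.mono fun s hs => hs.deriv
  have hdd : deriv (deriv f) t = f₂ := by rw [hd.deriv_eq, hf'.deriv]
  have hmin : IsLocalMin f t := isLocalMin_of_deriv_deriv_pos (by rw [hdd]; exact hpos)
    (by rw [hd.self_of_nhds, h1]) hf.self_of_nhds.continuousAt
  have hconst : f =ᶠ[𝓝 t] fun _ => f t := by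
    filter_upwards [hmax, hmin] with s h2 h3 using le_antisymm h2 h3
  have : deriv (deriv f) t = 0 := by
    rw [hconst.deriv.deriv_eq]; simp
  exact hpos.ne' (hdd ▸ this)

/-- Comparison of the integral operator with a supersolution. -/
lemma Reaction.resolvent_le_supersolution (hG : Reaction G κ L) {c h : ℝ} {a ψ : ℝ → ℝ}
    (ha : Continuous a) (haψ : ∀ t, a t ≤ ψ t) (ha0 : Tendsto a atBot (𝓝 0))
    (hψc : Continuous ψ) (hψ0 : ∀ t, 0 ≤ ψ t) (hψ1 : ∀ e > 0, ∀ᶠ t in atTop, κ - e < ψ t)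
    (hψ : IsSupersolution G κ c h ψ) (t : ℝ) :
    resolvent c (fun s => G (a (s - c * h))) t ≤ ψ t := by
  set b : ℝ → ℝ := fun s => G (a (s - c * h)) with hb
  have hbc : Continuous b := hG.continuous.comp (ha.comp (by fun_prop))
  have hb0 : ∀ s, 0 ≤ b s := fun s => hG.nonneg _
  have hb1 : ∀ s, b s ≤ κ := fun s => hG.le _
  have hu := hasDerivAt_resolvent (c := c) hbc hb0 hb1
  have hu' := hasDerivAt_resolventDeriv (c := c) hbc hb0 hb1
  by_contra hcon
  push Not at hcon
  have huc : Continuous (resolvent c b) := continuous_iff_continuousAt.2 fun s => (hu s).continuousAt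
  have hubot : Tendsto (resolvent c b) atBot (𝓝 0) := by
    have := hG.tendsto_delay_atBot (c * h) ha0
    rw [hG.map_zero] at this
    exact tendsto_resolvent_atBot hbc.measurable hb0 hb1 this
  have hpos : 0 < resolvent c b t - ψ t := sub_pos.2 hcon
  obtain ⟨x, hx⟩ := (huc.sub hψc).exists_forall_ge' t (by
    rw [cocompact_eq_atBot_atTop, eventually_sup]
    constructor
    · filter_upwards [hubot.eventually_lt_const hpos] with s hs
      simp only [Pi.sub_apply]
      linarith [hψ0 s]
    · filter_upwards [hψ1 _ hpos] with s hs
      simp only [Pi.sub_apply]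
      linarith [resolvent_le (c := c) hbc.measurable hb0 hb1 s])
  have hxt := hx t
  simp only [Pi.sub_apply] at hx hxt
  -- At a positive maximum of the difference, `ψ` lies below the resolvent, which is at most `κ`.
  -- This is why the supersolution inequality is only required where `ψ < κ`.
  have hxκ : ψ x < κ := by linarith [resolvent_le (c := c) hbc.measurable hb0 hb1 x]
  obtain ⟨q, q', q₂, hq0, hqle, hqd, hqd', hineq⟩ := hψ x hxκ
  have hmax : IsLocalMax (fun s => resolvent c b s - q s) x := by
    filter_upwards [hqle] with s hs
    linarith [hx s]
  -- Maximum principle: with `d` the resolvent minus `q`, the two relations give `d'' - c d' - d ≥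
  -- 0` at `x`, whereas `d' = 0`, `d'' ≤ 0` and `d > 0` there.
  obtain ⟨e1, e2⟩ := deriv_eq_zero_and_second_deriv_nonpos
    (f := fun s => resolvent c b s - q s) (f' := fun s => resolventDeriv c b s - q' s)
    (hqd.mono fun s hs => (hu s).sub hs) ((hu' x).sub hqd') hmax
  have hbx : b x ≤ G (ψ (x - c * h)) := hG.monotone (haψ _)
  have e3 : c * (resolventDeriv c b x - q' x) = 0 := by rw [e1, mul_zero]
  linarith

/-- A Lipschitz ramp from `0` to `ε`. -/
noncomputable def ramp (ε T t : ℝ) : ℝ := ε * max 0 (min 1 (t - T))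

lemma ramp_nonneg {ε : ℝ} (hε : 0 ≤ ε) (T t : ℝ) : 0 ≤ ramp ε T t :=
  mul_nonneg hε (le_max_left _ _)

lemma ramp_le {ε : ℝ} (hε : 0 ≤ ε) (T t : ℝ) : ramp ε T t ≤ ε :=
  mul_le_of_le_one_right hε (max_le zero_le_one (min_le_left _ _))

lemma ramp_eq_zero (ε : ℝ) {T t : ℝ} (h : t ≤ T) : ramp ε T t = 0 := by
  rw [ramp, max_eq_left (min_le_of_right_le (by linarith)), mul_zero]

lemma ramp_eq (ε : ℝ) {T t : ℝ} (h : T + 1 ≤ t) : ramp ε T t = ε := by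
  rw [ramp, min_eq_left (by linarith), max_eq_right zero_le_one, mul_one]

lemma monotone_ramp {ε : ℝ} (hε : 0 ≤ ε) (T : ℝ) : Monotone (ramp ε T) := fun x y hxy =>
  mul_le_mul_of_nonneg_left (max_le_max le_rfl (min_le_min le_rfl (by linarith))) hε

lemma ramp_lipschitz {ε : ℝ} (hε : 0 ≤ ε) (T x y : ℝ) : |ramp ε T x - ramp ε T y| ≤ ε * |x - y| := by
  rw [ramp, ramp, ← mul_sub, abs_mul, abs_of_nonneg hε]
  refine mul_le_mul_of_nonneg_left ?_ hε
  refine (abs_max_sub_max_le_max _ _ _ _).trans (max_le (by simp) ?_)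
  refine (abs_min_sub_min_le_max _ _ _ _).trans (max_le (by simp) (le_of_eq ?_))
  congr 1; ring

/-- The iterates `a₀ = 0`, `aₙ₊₁ = max (ramp, N aₙ)` of the obstacle problem. -/
noncomputable def obstacleIterate (G : ℝ → ℝ) (c h ε T : ℝ) : ℕ → ℝ → ℝ
  | 0 => fun _ => 0
  | n + 1 => fun t =>
    max (ramp ε T t) (resolvent c (fun s => G (obstacleIterate G c h ε T n (s - c * h))) t)

/-- The properties are proved in one induction, as comparison with `ψ` at the next stage needs
continuity and decay at `-∞` of the current iterate. The ramp prevents the increasing limit from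
being the trivial solution `0`. -/
lemma Reaction.obstacleIterate_props (hG : Reaction G κ L) {c h ε T : ℝ} (hε : 0 ≤ ε) (hεκ : ε ≤ κ)
    {ψ : ℝ → ℝ} (hψc : Continuous ψ) (hψ0 : ∀ t, 0 ≤ ψ t)
    (hψ1 : ∀ e > 0, ∀ᶠ t in atTop, κ - e < ψ t) (hψ : IsSupersolution G κ c h ψ)
    (hψT : ∀ t, T ≤ t → ε ≤ ψ t) (n : ℕ) :
    Monotone (obstacleIterate G c h ε T n) ∧ (∀ t, 0 ≤ obstacleIterate G c h ε T n t) ∧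
    (∀ t, obstacleIterate G c h ε T n t ≤ κ) ∧
    (∀ x y, |obstacleIterate G c h ε T n x - obstacleIterate G c h ε T n y| ≤ κ * |x - y|) ∧
    Tendsto (obstacleIterate G c h ε T n) atBot (𝓝 0) ∧
    (∀ t, obstacleIterate G c h ε T n t ≤ ψ t) ∧
    ∀ t, obstacleIterate G c h ε T n t ≤ obstacleIterate G c h ε T (n + 1) t := by
  have hκ := hG.kappa_pos
  induction n with
  | zero =>
    refine ⟨monotone_const, fun t => le_rfl, fun t => hκ.le, fun x y => ?_, tendsto_const_nhds,
      hψ0, fun t => le_max_of_le_left (ramp_nonneg hε T t)⟩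
    simp only [obstacleIterate, sub_self, abs_zero]; positivity
  | succ n ih =>
    obtain ⟨hmono, h0, h1, hlip, hbot, hle, hinc⟩ := ih
    have hac : Continuous (obstacleIterate G c h ε T n) := continuous_of_abs_sub_le hκ.le hlip
    have hbc : Continuous fun s => G (obstacleIterate G c h ε T n (s - c * h)) :=
      hG.continuous.comp (hac.comp (by fun_prop))
    have hmono' : Monotone (obstacleIterate G c h ε T (n + 1)) :=
      (monotone_ramp hε T).max (monotone_resolvent (hG.monotone_delay hmono _)
        (fun _ => hG.nonneg _) (fun _ => hG.le _))
    have hrbot : Tendsto (resolvent c fun s => G (obstacleIterate G c h ε T n (s - c * h))) atBot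
        (𝓝 0) := by
      have := hG.tendsto_delay_atBot (c * h) hbot
      rw [hG.map_zero] at this
      exact tendsto_resolvent_atBot hbc.measurable (fun _ => hG.nonneg _) (fun _ => hG.le _) this
    refine ⟨hmono', fun t => le_max_of_le_left (ramp_nonneg hε T t), fun t => ?_, fun x y => ?_,
      ?_, fun t => ?_, fun t => ?_⟩
    · exact max_le ((ramp_le hε T t).trans hεκ)
        (resolvent_le hbc.measurable (fun _ => hG.nonneg _) (fun _ => hG.le _) t)
    · refine (abs_max_sub_max_le_max _ _ _ _).trans (max_le ?_ ?_)
      · exact (ramp_lipschitz hε T x y).trans (mul_le_mul_of_nonneg_right hεκ (abs_nonneg _))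
      · exact lipschitz_resolvent hbc (fun _ => hG.nonneg _) (fun _ => hG.le _) x y
    · have h2 : Tendsto (ramp ε T) atBot (𝓝 0) :=
        tendsto_const_nhds.congr' ((eventually_le_atBot T).mono fun t ht => (ramp_eq_zero ε ht).symm)
      have h3 := h2.max hrbot
      rw [max_self] at h3
      exact h3
    · refine max_le ?_ (hG.resolvent_le_supersolution hac hle hbot hψc hψ0 hψ1 hψ t)
      rcases le_total T t with ht | ht
      · exact (ramp_le hε T t).trans (hψT t ht)
      · rw [ramp_eq_zero ε ht]; exact hψ0 t
    · refine max_le_max le_rfl ?_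
      exact resolvent_mono hbc.measurable (hG.monotone_delay hmono' _).measurable
        (fun _ => hG.nonneg _) (fun s => hG.monotone (hinc _)) (fun _ => hG.le _) t

/-- The obstacle problem `a = max (ramp, N a)` has a monotone solution below a supersolution. -/
lemma Reaction.exists_obstacle_solution (hG : Reaction G κ L) {c h ε T : ℝ} (hε : 0 ≤ ε)
    (hεκ : ε ≤ κ) {ψ : ℝ → ℝ} (hψc : Continuous ψ) (hψ0 : ∀ t, 0 ≤ ψ t)
    (hψ1 : ∀ e > 0, ∀ᶠ t in atTop, κ - e < ψ t) (hψ : IsSupersolution G κ c h ψ)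
    (hψT : ∀ t, T ≤ t → ε ≤ ψ t) :
    ∃ a : ℝ → ℝ, Monotone a ∧ (∀ t, 0 ≤ a t) ∧ (∀ t, a t ≤ κ) ∧
      (∀ x y, |a x - a y| ≤ κ * |x - y|) ∧ (∀ t, a t ≤ ψ t) ∧
      ∀ t, a t = max (ramp ε T t) (resolvent c (fun s => G (a (s - c * h))) t) := by
  have hp := hG.obstacleIterate_props (c := c) (h := h) hε hεκ hψc hψ0 hψ1 hψ hψT
  have hlim : ∀ t, ∃ l, Tendsto (fun n => obstacleIterate G c h ε T n t) atTop (𝓝 l) := fun t =>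
    ⟨_, tendsto_atTop_ciSup (monotone_nat_of_le_succ fun n => (hp n).2.2.2.2.2.2 t)
      ⟨κ, by rintro _ ⟨n, rfl⟩; exact (hp n).2.2.1 t⟩⟩
  choose a ha using hlim
  refine ⟨a, fun x y hxy => le_of_tendsto_of_tendsto' (ha x) (ha y) fun n => (hp n).1 hxy,
    fun t => ge_of_tendsto' (ha t) fun n => (hp n).2.1 t,
    fun t => le_of_tendsto' (ha t) fun n => (hp n).2.2.1 t,
    fun x y => le_of_tendsto' ((ha x).sub (ha y)).abs fun n => (hp n).2.2.2.1 x y,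
    fun t => le_of_tendsto' (ha t) fun n => (hp n).2.2.2.2.2.1 t, fun t => ?_⟩
  refine tendsto_nhds_unique ((tendsto_add_atTop_iff_nat 1).2 (ha t)) ?_
  refine (tendsto_const_nhds (x := ramp ε T t)).max ?_
  exact tendsto_resolvent (c := fun _ : ℕ => c) tendsto_const_nhds
    (b := fun n s => G (obstacleIterate G c h ε T n (s - c * h)))
    (fun n => (hG.monotone_delay (hp n).1 _).measurable) (fun _ _ => hG.nonneg _)
    (fun _ _ => hG.le _) (fun s => (hG.continuous.tendsto _).comp (ha _)) t

/-- A supersolution with the right limits produces a monotone front of the same speed. -/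
theorem Reaction.exists_monoFront_of_supersolution (hG : Reaction G κ L) {c h : ℝ} {ψ : ℝ → ℝ}
    (hψc : Continuous ψ) (hψ0 : ∀ t, 0 ≤ ψ t) (hψ1 : ∀ e > 0, ∀ᶠ t in atTop, κ - e < ψ t)
    {t₁ : ℝ} (hψt : ψ t₁ < κ) (hψ : IsSupersolution G κ c h ψ) : ∃ φ, MonoFront G κ c h φ := by
  have hκ := hG.kappa_pos
  obtain ⟨T, hT⟩ := eventually_atTop.1 (hψ1 (κ / 2) (half_pos hκ))
  -- Obstacles of vanishing height; the cap `κ / 2` keeps each ramp below `ψ`, which exceeds `κ / 2`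
  -- to the right of `T`.
  let ε : ℕ → ℝ := fun n => κ / 2 * (1 / ((n : ℝ) + 1))
  have hε0 : ∀ n, 0 < ε n := fun n => by positivity
  have hε1 : ∀ n, ε n ≤ κ / 2 := fun n => by
    refine mul_le_of_le_one_right (half_pos hκ).le ?_
    rw [div_le_one (by positivity)]
    linarith [(Nat.cast_nonneg n : (0 : ℝ) ≤ n)]
  have hεlim : Tendsto ε atTop (𝓝 0) := by
    have := tendsto_one_div_add_atTop_nhds_zero_nat (𝕜 := ℝ) |>.const_mul (κ / 2)
    rwa [mul_zero] at this
  have key : ∀ n, ∃ φ : ℝ → ℝ, Monotone φ ∧ (∀ t, 0 ≤ φ t) ∧ (∀ t, φ t ≤ κ) ∧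
      (∀ x y, |φ x - φ y| ≤ κ * |x - y|) ∧ φ 0 = κ / 2 ∧
      ∀ t, |φ t - resolvent c (fun s => G (φ (s - c * h))) t| ≤ ε n := by
    intro n
    obtain ⟨a, hmono, h0, h1, hlip, hle, hfix⟩ := hG.exists_obstacle_solution (T := T) (hε0 n).le
      ((hε1 n).trans (by linarith)) hψc hψ0 hψ1 hψ
      (fun t ht => (hε1 n).trans (by linarith [hT t ht]))
    have hac : Continuous a := continuous_of_abs_sub_le hκ.le hlip
    have hmeas := (hG.monotone_delay hmono (c * h)).measurable
    have hbot := tendsto_atBot_ciInf hmono ⟨0, by rintro _ ⟨t, rfl⟩; exact h0 t⟩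
    have htop := tendsto_atTop_ciSup hmono ⟨κ, by rintro _ ⟨t, rfl⟩; exact h1 t⟩
    set l := ⨅ t, a t
    set r := ⨆ t, a t
    have hl0 : 0 ≤ l := ge_of_tendsto' hbot h0
    have hl1 : l < κ := (hmono.le_of_tendsto hbot t₁).trans_lt ((hle t₁).trans_lt hψt)
    have hr1 : r ≤ κ := le_of_tendsto' htop h1
    -- The obstacle solution satisfies only `a ≥ N a`, hence `G l ≤ l`; as `G u > u` inside `(0,
    -- κ)`, this still forces the limits `0` and `κ`.
    have hGl : G l ≤ l := by
      refine le_of_tendsto_of_tendsto' (tendsto_resolvent_atBot (c := c) hmeas (fun _ => hG.nonneg _)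
        (fun _ => hG.le _) (hG.tendsto_delay_atBot _ hbot)) hbot fun t => ?_
      rw [hfix t]; exact le_max_right _ _
    have hGr : G r ≤ r := by
      refine le_of_tendsto_of_tendsto' (tendsto_resolvent_atTop (c := c) hmeas (fun _ => hG.nonneg _)
        (fun _ => hG.le _) (hG.tendsto_delay_atTop _ htop)) htop fun t => ?_
      rw [hfix t]; exact le_max_right _ _
    have hr0 : 0 < r := by
      refine (hε0 n).trans_le (ge_of_tendsto htop ?_)
      filter_upwards [eventually_ge_atTop (T + 1)] with t ht
      rw [hfix t, ramp_eq _ ht]; exact le_max_left _ _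
    rw [hG.eq_zero_of_fixed hl0 hl1 hGl] at hbot
    rw [hG.eq_kappa_of_fixed hr0 hr1 hGr] at htop
    obtain ⟨x, hx⟩ := (hbot.eventually_lt_const (half_pos hκ)).exists
    obtain ⟨y, hy⟩ := (htop.eventually_const_lt (half_lt_self hκ)).exists
    obtain ⟨τ, hτ⟩ := mem_range_of_exists_le_of_exists_ge hac ⟨x, hx.le⟩ ⟨y, hy.le⟩
    refine ⟨fun t => a (t + τ), fun x y hxy => hmono (by linarith), fun t => h0 _, fun t => h1 _,
      fun x y => ?_, by simpa using hτ, fun t => ?_⟩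
    · simpa using hlip (x + τ) (y + τ)
    · have e1 : resolvent c (fun s => G (a (s - c * h + τ))) t
          = resolvent c (fun s => G (a (s - c * h))) (t + τ) := by
        rw [resolvent_add_right]; congr 1; ext s; ring_nf
      have e2 := hfix (t + τ)
      change |a (t + τ) - resolvent c (fun s => G (a (s - c * h + τ))) t| ≤ ε n
      rw [e1, e2]
      have e3 := resolvent_nonneg (c := c) (b := fun s => G (a (s - c * h))) (fun _ => hG.nonneg _)
        (t + τ)
      have e4 := ramp_le (hε0 n).le T (t + τ)
      -- The defect `a - N a` is at most the ramp, because `N a ≥ 0`.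
      rw [abs_of_nonneg (sub_nonneg.2 (le_max_right _ _)), sub_le_iff_le_add]
      exact max_le (by linarith) (by linarith [hε0 n])
  choose φ k1 k2 k3 k4 k5 k6 using key
  exact hG.exists_monoFront_of_approx (c := fun _ => c) (h := fun _ => h) tendsto_const_nhds
    tendsto_const_nhds hκ.le k1 k2 k3 k4 k5 hεlim k6

/-- A monotone front is a supersolution for all larger speeds. -/
lemma MonoFront.exists_of_speed_le {c c' h : ℝ} {φ : ℝ → ℝ} (hG : Reaction G κ L)
    (hφ : MonoFront G κ c h φ) (hh : 0 ≤ h) (hcc : c ≤ c') : ∃ φ', MonoFront G κ c' h φ' := by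
  have hκ := hG.kappa_pos
  obtain ⟨t₁, ht₁⟩ := (hφ.tendsto_atBot.eventually_lt_const hκ).exists
  refine hG.exists_monoFront_of_supersolution hφ.continuous hφ.nonneg
    (fun e he => hφ.tendsto_atTop.eventually_const_lt (by linarith)) ht₁ fun t _ => ?_
  refine ⟨φ, _, _, rfl, Eventually.of_forall fun _ => le_rfl,
    Eventually.of_forall (hφ.hasDerivAt hG), hφ.hasDerivAt_profileDeriv hG t, ?_⟩
  -- Raising the speed strengthens the drift and moves the delayed argument to the left; for an
  -- increasing profile both signs are favourable.
  have h1 := hφ.profileDeriv_nonneg hG t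
  have h2 : G (φ (t - c' * h)) ≤ G (φ (t - c * h)) :=
    hG.monotone (hφ.monotone (by nlinarith))
  nlinarith

/-- Monotone fronts exist for all large speeds. -/
lemma Reaction.exists_monoFront (hG : Reaction G κ L) {c h : ℝ} (hc : 0 ≤ c) (hLc : L ≤ c)
    (hh : 0 ≤ h) : ∃ φ, MonoFront G κ c h φ := by
  have hκ := hG.kappa_pos
  -- For `κ e^t` the linear part equals `-c κ e^t`, and the reaction is at most `L κ e^t`, so `c ≥
  -- L` suffices.
  have hd : ∀ t, HasDerivAt (fun s => κ * Real.exp s) (κ * Real.exp t) t := fun t =>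
    (Real.hasDerivAt_exp t).const_mul κ
  refine hG.exists_monoFront_of_supersolution (ψ := fun s => κ * Real.exp s) (t₁ := -1)
    (by fun_prop) (fun t => by positivity) (fun e he => ?_) ?_ fun t _ => ?_
  · filter_upwards [eventually_ge_atTop 0] with t ht
    nlinarith [Real.add_one_le_exp t]
  · exact mul_lt_of_lt_one_right hκ (by rw [Real.exp_lt_one_iff]; norm_num)
  · refine ⟨_, _, _, rfl, Eventually.of_forall fun _ => le_rfl, Eventually.of_forall hd, hd t, ?_⟩
    have hpos : 0 < κ * Real.exp t := by positivity
    have h1 : κ * Real.exp (t - c * h) ≤ κ * Real.exp t :=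
      mul_le_mul_of_nonneg_left (Real.exp_le_exp.2 (by nlinarith)) hκ.le
    have h2 := hG.lipschitz (κ * Real.exp t) 0
    rw [hG.map_zero, sub_zero, sub_zero, abs_of_nonneg (hG.nonneg _), abs_of_pos hpos] at h2
    have h3 := hG.monotone h1
    nlinarith

/-- Limits of speeds of monotone fronts are speeds of monotone fronts. -/
lemma Reaction.exists_monoFront_of_tendsto (hG : Reaction G κ L) {c h : ℕ → ℝ} {c₀ h₀ : ℝ}
    (hc : Tendsto c atTop (𝓝 c₀)) (hh : Tendsto h atTop (𝓝 h₀))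
    (hφ : ∀ n, ∃ φ, MonoFront G κ (c n) (h n) φ) : ∃ φ, MonoFront G κ c₀ h₀ φ := by
  have key : ∀ n, ∃ φ, MonoFront G κ (c n) (h n) φ ∧ φ 0 = κ / 2 := fun n => by
    obtain ⟨φ, hφ⟩ := hφ n
    obtain ⟨τ, hτ⟩ := hφ.exists_eq_half hG
    exact ⟨_, hφ.shift τ, by simpa using hτ⟩
  choose φ k1 k2 using key
  refine hG.exists_monoFront_of_approx hc hh hG.kappa_pos.le (fun n => (k1 n).monotone)
    (fun n => (k1 n).nonneg) (fun n => (k1 n).le) (fun n => (k1 n).lipschitz hG) k2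
    (ε := fun _ => 0) tendsto_const_nhds fun n t => ?_
  rw [← (k1 n).fixed]; simp

/-- There is a minimal speed of monotone fronts as soon as some speed is not attained. -/
lemma Reaction.exists_minimal_speed (hG : Reaction G κ L) {c₁ h : ℝ} (hh : 0 ≤ h)
    (hnot : ¬ ∃ φ, MonoFront G κ c₁ h φ) :
    ∃ c, c₁ < c ∧ (∃ φ, MonoFront G κ c h φ) ∧ ∀ c', (∃ φ, MonoFront G κ c' h φ) → c ≤ c' := by
  set S : Set ℝ := {c | ∃ φ, MonoFront G κ c h φ} with hS
  have hlow : ∀ c ∈ S, c₁ < c := fun c ⟨φ, hφ⟩ =>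
    not_le.1 fun hle => hnot (hφ.exists_of_speed_le hG hh hle)
  have hne : S.Nonempty := ⟨L, hG.exists_monoFront hG.lip_nonneg le_rfl hh⟩
  have hbdd : BddBelow S := ⟨c₁, fun c hc => (hlow c hc).le⟩
  obtain ⟨u, -, hu, huS⟩ := exists_seq_tendsto_sInf hne hbdd
  -- Closedness under limits of speeds turns the infimum into a minimum.
  have hmem : sInf S ∈ S :=
    hG.exists_monoFront_of_tendsto (h := fun _ => h) hu tendsto_const_nhds huS
  exact ⟨sInf S, hlow _ hmem, hmem, fun c' hc' => csInf_le hbdd hc'⟩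

end

/-! ### Lowering the speed of a slowly decaying front. -/

section

variable {G : ℝ → ℝ} {κ L : ℝ}

namespace MonoFront

variable {c h : ℝ} {φ : ℝ → ℝ}

/-- Mean value inequality, with the derivative on the delay interval compared to its value at `x` by
Harnack. The cost of changing the delay shift is thus measured in units of `φ'(x)`. -/
lemma sub_le_of_speed_le (hG : Reaction G κ L) (hφ : MonoFront G κ c h φ) (hh : 0 ≤ h) {c' : ℝ}
    (hc' : 0 ≤ c') (hcc : c' ≤ c) (x : ℝ) :
    φ (x - c' * h) - φ (x - c * h)
      ≤ (c - c') * (h * Real.exp (decayRate c * (c * h))) * profileDeriv G c h φ x := by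
  have hα := decayRate_pos c
  have hP := hφ.profileDeriv_pos hG x
  have hle : x - c * h ≤ x - c' * h := by nlinarith
  have := (convex_Icc (x - c * h) (x - c' * h)).image_sub_le_mul_sub_of_deriv_le
    (f := φ) (C := Real.exp (decayRate c * (c * h)) * profileDeriv G c h φ x)
    hφ.continuous.continuousOn
    (fun s _ => (hφ.hasDerivAt hG s).differentiableAt.differentiableWithinAt)
    (fun s hs => by
      rw [interior_Icc] at hs
      rw [(hφ.hasDerivAt hG s).deriv]
      have hsx : 0 ≤ x - s := by nlinarith [hs.2, mul_nonneg hc' hh]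
      have h1 := (hφ.profileDeriv_bounds hG s hsx).2
      rw [add_sub_cancel] at h1
      have h2 : profileDeriv G c h φ s
          = profileDeriv G c h φ s * Real.exp (-decayRate c * (x - s))
            * Real.exp (decayRate c * (x - s)) := by
        rw [mul_assoc, ← Real.exp_add]; simp
      rw [h2, mul_comm (Real.exp _)]
      refine mul_le_mul h1 (Real.exp_le_exp.2 ?_) (Real.exp_pos _).le hP.le
      exact mul_le_mul_of_nonneg_left (by linarith [hs.1]) hα.le)
    _ (left_mem_Icc.2 hle) _ (right_mem_Icc.2 hle) hle
  calc _ ≤ _ := this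
    _ = _ := by ring

/-- The profile with an exponentially stretched time and an exponentially growing correction. -/
noncomputable def stretched (φ : ℝ → ℝ) (ε m μ a : ℝ) (t : ℝ) : ℝ :=
  φ (t - ε * Real.exp (-(m * t))) + μ * Real.exp (a * t)

lemma hasDerivAt_stretch (ε m t : ℝ) :
    HasDerivAt (fun t => t - ε * Real.exp (-(m * t))) (1 + m * ε * Real.exp (-(m * t))) t := by
  have := (hasDerivAt_id t).sub ((((hasDerivAt_id t).const_mul m).neg.exp).const_mul ε)
  refine this.congr_deriv ?_
  simp only [id, Pi.neg_apply]; ring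

lemma hasDerivAt_const_mul_exp (μ a t : ℝ) :
    HasDerivAt (fun t => μ * Real.exp (a * t)) (μ * a * Real.exp (a * t)) t := by
  have := (((hasDerivAt_id t).const_mul a).exp).const_mul μ
  refine this.congr_deriv ?_
  simp only [id]; ring

lemma const_mul_exp_le {μ a s t : ℝ} (hμ : 0 ≤ μ) (ha : 0 ≤ a) (hst : s ≤ t) :
    μ * Real.exp (a * s) ≤ μ * Real.exp (a * t) :=
  mul_le_mul_of_nonneg_left (Real.exp_le_exp.2 (mul_le_mul_of_nonneg_left hst ha)) hμ

lemma const_mul_exp_neg_le {μ a s t : ℝ} (hμ : 0 ≤ μ) (ha : 0 ≤ a) (hst : s ≤ t) :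
    μ * Real.exp (-(a * t)) ≤ μ * Real.exp (-(a * s)) :=
  mul_le_mul_of_nonneg_left
    (Real.exp_le_exp.2 (neg_le_neg (mul_le_mul_of_nonneg_left hst ha))) hμ

/-- The first derivative of `stretched φ ε m μ a`. -/
noncomputable def stretchedDeriv (G : ℝ → ℝ) (c h : ℝ) (φ : ℝ → ℝ) (ε m μ a : ℝ) (t : ℝ) : ℝ :=
  profileDeriv G c h φ (t - ε * Real.exp (-(m * t))) * (1 + m * ε * Real.exp (-(m * t)))
    + μ * a * Real.exp (a * t)

lemma hasDerivAt_stretched (hG : Reaction G κ L) (hφ : MonoFront G κ c h φ) (ε m μ a t : ℝ) :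
    HasDerivAt (stretched φ ε m μ a) (stretchedDeriv G c h φ ε m μ a t) t := by
  have h1 := (hφ.hasDerivAt hG (t - ε * Real.exp (-(m * t)))).comp t (hasDerivAt_stretch ε m t)
  exact h1.add (hasDerivAt_const_mul_exp μ a t)

lemma hasDerivAt_stretchedDeriv (hG : Reaction G κ L) (hφ : MonoFront G κ c h φ)
    (ε m μ a t x Q : ℝ) (hx : t - ε * Real.exp (-(m * t)) = x)
    (hQ : m * ε * Real.exp (-(m * t)) = Q) :
    HasDerivAt (stretchedDeriv G c h φ ε m μ a)
      ((c * profileDeriv G c h φ x + φ x - G (φ (x - c * h))) * (1 + Q) ^ 2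
        + profileDeriv G c h φ x * (-m * Q) + μ * a * a * Real.exp (a * t)) t := by
  have h1 := (hφ.hasDerivAt_profileDeriv hG (t - ε * Real.exp (-(m * t)))).comp t
    (hasDerivAt_stretch ε m t)
  have h2 := (hasDerivAt_const_mul_exp (m * ε) (-m) t).const_add 1
  simp only [neg_mul] at h2
  refine ((h1.mul h2).add (hasDerivAt_const_mul_exp (μ * a) a t)).congr_deriv ?_
  simp only [Function.comp_apply, hx, hQ]
  rw [← hQ]; ring

/-- The stretched profile almost satisfies the supersolution inequality for smaller speeds. -/
lemma stretched_inequality (hG : Reaction G κ L) (hφ : MonoFront G κ c h φ) (hh : 0 ≤ h)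
    {c' ε m M μ a t x Q Γ : ℝ} (hm : m = 3 * growthRate c + 1)
    (hM : M = 1 + L * (h * Real.exp (decayRate c * (c * h)))) (hε : 0 ≤ ε) (hμ : 0 ≤ μ)
    (ha : 0 ≤ a) (hac : a ≤ c') (hcc : c' ≤ c)
    (hx : t - ε * Real.exp (-(m * t)) = x)
    (hQ : m * ε * Real.exp (-(m * t)) = Q) (hQ1 : Q ≤ 1)
    (hΓ : ∀ y v, φ (x - c * h) ≤ y → 0 ≤ v → G (y + v) ≤ G y + Γ * v) :
    ((c * profileDeriv G c h φ x + φ x - G (φ (x - c * h))) * (1 + Q) ^ 2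
        + profileDeriv G c h φ x * (-m * Q) + μ * a * a * Real.exp (a * t))
      - c' * stretchedDeriv G c h φ ε m μ a t
      - stretched φ ε m μ a t
      + G (stretched φ ε m μ a (t - c' * h))
    ≤ profileDeriv G c h φ x
        * (-Q + (c - c') * M)
      + (Γ - 1) * (μ * Real.exp (a * t)) := by
  have hβ := growthRate_pos c
  have hm0 : 0 < m := by rw [hm]; positivity
  have hc'0 : 0 ≤ c' := ha.trans hac
  have hP := hφ.profileDeriv_pos hG x
  have hP2 := hφ.second_deriv_le hG x
  have hQ0 : 0 ≤ Q := by rw [← hQ]; positivity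
  have hd := hφ.sub_le_of_speed_le hG hh hc'0 hcc x
  have hc'h : 0 ≤ c' * h := mul_nonneg hc'0 hh
  have hmon : φ (x - c * h) ≤ φ (x - c' * h) := hφ.monotone (by nlinarith)
  have hexp : Real.exp (a * (t - c' * h)) ≤ Real.exp (a * t) :=
    Real.exp_le_exp.2 (by nlinarith)
  have hst : stretched φ ε m μ a (t - c' * h) ≤ φ (x - c' * h) + μ * Real.exp (a * t) := by
    refine add_le_add (hφ.monotone ?_) (mul_le_mul_of_nonneg_left hexp hμ)
    have : ε * Real.exp (-(m * t)) ≤ ε * Real.exp (-(m * (t - c' * h))) :=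
      mul_le_mul_of_nonneg_left (Real.exp_le_exp.2 (by nlinarith)) hε
    linarith
  have hG1 := hG.monotone hst
  have hG2 := hΓ (φ (x - c' * h)) (μ * Real.exp (a * t)) hmon (by positivity)
  have hG3 := (abs_le.1 (hG.lipschitz (φ (x - c' * h)) (φ (x - c * h)))).2
  rw [abs_of_nonneg (sub_nonneg.2 hmon)] at hG3
  have hG4 := mul_le_mul_of_nonneg_left hd hG.lip_nonneg
  have hv : 0 ≤ μ * Real.exp (a * t) := by positivity
  have hstD : stretchedDeriv G c h φ ε m μ a t
      = profileDeriv G c h φ x * (1 + Q) + a * (μ * Real.exp (a * t)) := by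
    rw [stretchedDeriv, hx, hQ]; ring
  have hst0 : stretched φ ε m μ a t = φ x + μ * Real.exp (a * t) := by rw [stretched, hx]
  rw [hstD, hst0, hM]
  -- Since `a ≤ c'`, the second derivative of the exponential correction is absorbed by its drift.
  have hav : μ * a * a * Real.exp (a * t) ≤ c' * a * (μ * Real.exp (a * t)) := by
    calc μ * a * a * Real.exp (a * t) = a * a * (μ * Real.exp (a * t)) := by ring
      _ ≤ _ := mul_le_mul_of_nonneg_right (mul_le_mul_of_nonneg_right hac ha) hv
  generalize μ * Real.exp (a * t) = v at *
  generalize μ * a * a * Real.exp (a * t) = v2 at *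
  generalize h * Real.exp (decayRate c * (c * h)) = D at *
  generalize hPx : profileDeriv G c h φ x = P at *
  generalize G (stretched φ ε m μ a (t - c' * h)) = g1 at *
  generalize G (φ (x - c * h)) = g0 at *
  -- The stretching multiplies `φ''` by `(1 + Q)²`. With `φ'' ≤ growthRate c * φ'` and `Q ≤ 1` the
  -- excess is at most `3 * growthRate c * Q * φ'`; the choice `m = 3 * growthRate c + 1` cancels it
  -- and leaves the gain `-Q φ'`.
  have e1 : (c * P + φ x - g0) * (2 * Q + Q ^ 2) ≤ growthRate c * P * (3 * Q) := by
    have : (c * P + φ x - g0) * (2 * Q + Q ^ 2) ≤ growthRate c * P * (2 * Q + Q ^ 2) :=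
      mul_le_mul_of_nonneg_right hP2 (by positivity)
    refine this.trans (mul_le_mul_of_nonneg_left (by nlinarith) (by positivity))
  have e2 : 0 ≤ c' * P * Q := by positivity
  have e3 : P * (-m * Q) = -(growthRate c * P * (3 * Q)) - P * Q := by rw [hm]; ring
  rw [e3]
  nlinarith

/-- If the profile decays more slowly than `e^{lt}` for some `l` with `χ(l) < 0`, then there are
fronts of smaller speed. -/
theorem exists_slower (hG : Reaction G κ L) (hφ : MonoFront G κ c h φ) (hc : 0 < c) (hh : 0 ≤ h)
    {p l δ δ' γ : ℝ} (hl : 0 < l) (hχ : charFun p h c l < 0) (hδ : 0 < δ)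
    (hzero : ∀ u, 0 ≤ u → u ≤ δ → G u ≤ p * u) (hδ' : 0 < δ') (hγ : γ < 1)
    (hkappa : ∀ u v, κ - δ' ≤ u → 0 ≤ v → G (u + v) ≤ G u + γ * v)
    (hslow : ∀ X, ∃ᶠ t in atBot, X * Real.exp (l * t) < φ t) :
    ∃ c' < c, ∃ φ', MonoFront G κ c' h φ' := by
  have hκ := hG.kappa_pos
  have hL := hG.lip_nonneg
  have hα := decayRate_pos c
  have hβ := growthRate_pos c
  obtain ⟨β, hβd⟩ : ∃ β, β = growthRate c := ⟨_, rfl⟩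
  rw [← hβd] at hβ
  have hexp_le : ∀ t {s : ℝ}, 0 ≤ s → φ (t + s) ≤ φ t * Real.exp (β * s) := fun t s hs =>
    hβd ▸ hφ.le_mul_exp hG t hs
  obtain ⟨m, hm⟩ : ∃ m, m = 3 * β + 1 := ⟨_, rfl⟩
  have hm1 : 1 ≤ m := by linarith
  have hm0 : 0 < m := by linarith
  -- The matching window is longer than the delay shift, so for `t > t₁` the delayed point still
  -- lies where `Φ` dominates `ψ`.
  obtain ⟨w, hw⟩ : ∃ w, w = c * h + 1 := ⟨_, rfl⟩
  have hch : 0 ≤ c * h := by positivity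
  -- the left piece
  obtain ⟨t₀, ht₀⟩ := (hφ.tendsto_atBot.eventually_lt_const (half_pos hδ)).exists
  have hφt₀ := hφ.pos hG t₀
  -- Normalized so that the exponential equals `2 φ(t₀) < δ` at `t₀`: it lies above the deformed
  -- front there, and in the range where `G u ≤ p u` to the left.
  set B := 2 * φ t₀ * Real.exp (-(l * t₀)) with hB
  have hB0 : 0 < B := by positivity
  have hBt₀ : B * Real.exp (l * t₀) = 2 * φ t₀ := by
    rw [hB, mul_assoc, ← Real.exp_add]; simp
  have hBle : ∀ t, t ≤ t₀ → B * Real.exp (l * t) ≤ δ := fun t ht => by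
    have := const_mul_exp_le hB0.le hl.le ht
    linarith
  clear_value B
  -- the matching window
  obtain ⟨t₁, ht₁, ht₁'⟩ := ((hslow (2 * B * Real.exp (β * w))).and_eventually
    (eventually_lt_atBot t₀)).exists
  -- With this amplitude `m ε e^{-mt}` equals `1` at the left end of the window, hence is at most
  -- `1` to its right.
  set ε := Real.exp (m * (t₁ - w)) / m with hε
  have hε0 : 0 < ε := by positivity
  have hstr : ∀ t, t₁ - w ≤ t → m * ε * Real.exp (-(m * t)) ≤ 1 := fun t ht => by
    rw [hε, mul_div_cancel₀ _ hm0.ne', ← Real.exp_add, Real.exp_le_one_iff]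
    linarith [mul_le_mul_of_nonneg_left ht hm0.le]
  have hstr' : ∀ t, t₁ - w ≤ t → ε * Real.exp (-(m * t)) ≤ 1 / m := fun t ht => by
    rw [le_div_iff₀ hm0]; linarith [hstr t ht]
  clear_value ε
  have hinv : 1 / m ≤ 1 := by rw [div_le_one hm0]; exact hm1
  have hhalf : Real.exp (β * (1 / m)) ≤ 2 := by
    have h1 : β * (1 / m) ≤ 1 / 3 := by
      rw [mul_one_div, div_le_div_iff₀ hm0 (by norm_num)]; linarith
    have h2 := Real.add_one_le_exp (-(β * (1 / m)))
    have h3 : Real.exp (-(β * (1 / m))) * Real.exp (β * (1 / m)) = 1 := by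
      rw [← Real.exp_add]; simp
    nlinarith [Real.exp_pos (β * (1 / m))]
  have hwin : ∀ s μ a, 0 ≤ μ → t₁ - w ≤ s → s ≤ t₁ →
      B * Real.exp (l * s) ≤ stretched φ ε m μ a s := fun s μ a hμ hs1 hs2 => by
    have h1 : φ t₁ ≤ φ s * Real.exp (β * w) := by
      have h2 := hexp_le s (sub_nonneg.2 hs2)
      rw [add_sub_cancel] at h2
      refine h2.trans (mul_le_mul_of_nonneg_left (Real.exp_le_exp.2 ?_) (hφ.nonneg s))
      exact mul_le_mul_of_nonneg_left (by linarith) hβ.le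
    have h2 : 2 * (B * Real.exp (l * t₁)) < φ s := by
      have h3 := ht₁.trans_le h1
      have h4 : 2 * B * Real.exp (β * w) * Real.exp (l * t₁)
        = 2 * (B * Real.exp (l * t₁)) * Real.exp (β * w) := by ring
      rw [h4] at h3
      exact lt_of_mul_lt_mul_right h3 (Real.exp_pos _).le
    have h3 := const_mul_exp_le hB0.le hl.le hs2
    have h5 := hexp_le (s - ε * Real.exp (-(m * s)))
      (s := ε * Real.exp (-(m * s))) (by positivity)
    rw [sub_add_cancel] at h5
    have h6 : φ s ≤ φ (s - ε * Real.exp (-(m * s))) * 2 := by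
      refine h5.trans (mul_le_mul_of_nonneg_left (le_trans (Real.exp_le_exp.2 ?_) hhalf)
        (hφ.nonneg _))
      exact mul_le_mul_of_nonneg_left (hstr' s hs1) hβ.le
    have h7 : 0 ≤ μ * Real.exp (a * s) := by positivity
    rw [stretched]
    linarith
  -- the zone near `κ`
  obtain ⟨t₂, ht₂, ht₂'⟩ : ∃ t₂, t₁ ≤ t₂ ∧ ∀ t, t₂ ≤ t → κ - δ' ≤ φ (t - 1 - c * h) := by
    obtain ⟨s, hs⟩ := (hφ.tendsto_atTop.eventually_const_lt
      (show κ - δ' < κ by linarith)).exists_forall_of_atTop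
    exact ⟨max t₁ (s + 1 + c * h), le_max_left _ _,
      fun t ht => (hs _ (by linarith [le_max_right t₁ (s + 1 + c * h)])).le⟩
  -- A Harnack lower bound for `φ'` on `[t₁ - 1, t₂]`; the `1` covers the displacement by
  -- stretching, which is at most `1 / m`.
  set π₀ := profileDeriv G c h φ (t₁ - 1) * Real.exp (-decayRate c * (t₂ - t₁ + 1)) with hπ₀
  have hπpos : 0 < π₀ := mul_pos (hφ.profileDeriv_pos hG _) (Real.exp_pos _)
  have hπ : ∀ x, t₁ - 1 ≤ x → x ≤ t₂ → π₀ ≤ profileDeriv G c h φ x := fun x hx1 hx2 => by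
    have h1 := (hφ.profileDeriv_bounds hG (t₁ - 1) (sub_nonneg.2 hx1)).2
    rw [add_sub_cancel] at h1
    refine le_trans (mul_le_mul_of_nonneg_left (Real.exp_le_exp.2 ?_)
      (hφ.profileDeriv_nonneg hG _)) h1
    exact mul_le_mul_of_nonpos_left (by linarith) (neg_nonpos.2 hα.le)
  clear_value π₀
  set Q₀ := m * ε * Real.exp (-(m * t₂)) with hQ₀
  have hQpos : 0 < Q₀ := by positivity
  clear_value Q₀
  obtain ⟨a, ha⟩ : ∃ a, a = c / 2 := ⟨_, rfl⟩
  have ha0 : 0 < a := ha ▸ half_pos hc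
  -- The correction must stay below the exponential piece at `t₀`, and up to `t₂` cost at most half
  -- of the gain `Q₀ φ'` from stretching.
  obtain ⟨μ, hμ0, hμ1, hμ2⟩ : ∃ μ, 0 < μ ∧ μ * Real.exp (a * t₀) < φ t₀ ∧
      L * (μ * Real.exp (a * t₂)) ≤ π₀ * (Q₀ / 2) := by
    refine ⟨min (φ t₀ / 2 / Real.exp (a * t₀)) (π₀ * (Q₀ / 2) / ((L + 1) * Real.exp (a * t₂))),
      by positivity, ?_, ?_⟩
    · rw [← lt_div_iff₀ (Real.exp_pos _)]
      refine (min_le_left _ _).trans_lt (div_lt_div_of_pos_right (by linarith) (Real.exp_pos _))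
    · have h1 : min (φ t₀ / 2 / Real.exp (a * t₀)) (π₀ * (Q₀ / 2) / ((L + 1) * Real.exp (a * t₂)))
          * ((L + 1) * Real.exp (a * t₂)) ≤ π₀ * (Q₀ / 2) := by
        rw [← le_div_iff₀ (by positivity)]
        exact min_le_right _ _
      refine le_trans ?_ h1
      rw [mul_left_comm]
      refine mul_le_mul_of_nonneg_left ?_ (by positivity)
      exact mul_le_mul_of_nonneg_right (by linarith) (Real.exp_pos _).le
  -- the speed
  set M := 1 + L * (h * Real.exp (decayRate c * (c * h))) with hM
  have hM0 : 0 < M := by positivity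
  clear_value M
  -- The speed is fixed last. The loss `(c - c') M` is paid by the other half of the stretching gain
  -- up to `t₂`, and beyond it by the contraction `γ < 1` acting on the correction.
  obtain ⟨c', hc'c, hac', hc'χ, hc'1, hc'2⟩ : ∃ c', c' < c ∧ a ≤ c' ∧ charFun p h c' l < 0 ∧
      (c - c') * M ≤ Q₀ / 2 ∧ κ * ((c - c') * M) ≤ (1 - γ) * (μ * Real.exp (a * t₂)) := by
    have hlim : Tendsto (fun c' => (c - c') * M) (𝓝 c) (𝓝 0) := by
      have : Continuous fun c' : ℝ => (c - c') * M := by fun_prop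
      simpa using this.tendsto c
    have h1 : ∀ᶠ c' in 𝓝 c, charFun p h c' l < 0 := by
      have : Continuous fun c' : ℝ => charFun p h c' l := by unfold charFun; fun_prop
      exact (this.tendsto c).eventually_lt_const hχ
    have h2 : ∀ᶠ c' in 𝓝 c, a < c' := eventually_gt_nhds (ha ▸ half_lt_self hc)
    have h3 := hlim.eventually_lt_const (half_pos hQpos)
    have h4 : ∀ᶠ c' in 𝓝 c, κ * ((c - c') * M) < (1 - γ) * (μ * Real.exp (a * t₂)) := by
      refine (hlim.const_mul κ).eventually_lt_const ?_
      rw [mul_zero]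
      exact mul_pos (sub_pos.2 hγ) (by positivity)
    have h5 : ∀ᶠ c' in 𝓝[<] c, c' < c := self_mem_nhdsWithin
    obtain ⟨c', k5, k1, k2, k3, k4⟩ := (h5.and (((h1.and (h2.and (h3.and h4)))).filter_mono
      nhdsWithin_le_nhds)).exists
    exact ⟨c', k5, k2.le, k1, k3.le, k4.le⟩
  have hc'0 : 0 ≤ c' := ha0.le.trans hac'
  have hc'h0 : 0 ≤ c' * h := mul_nonneg hc'0 hh
  have hc'h1 : c' * h ≤ c * h := mul_le_mul_of_nonneg_right hc'c.le hh
  set Φ := stretched φ ε m μ a with hΦ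
  have hΦcont : Continuous Φ :=
    continuous_iff_continuousAt.2 fun t => (hφ.hasDerivAt_stretched hG ε m μ a t).continuousAt
  have hΦ0 : ∀ t, 0 ≤ Φ t := fun t =>
    add_nonneg (hφ.nonneg _) (mul_nonneg hμ0.le (Real.exp_pos _).le)
  have hΦt₀ : Φ t₀ < B * Real.exp (l * t₀) := by
    have : φ (t₀ - ε * Real.exp (-(m * t₀))) ≤ φ t₀ :=
      hφ.monotone (sub_le_self _ (by positivity))
    rw [hBt₀, hΦ, stretched]
    linarith
  set ℓ : ℝ → ℝ := fun t => B * Real.exp (l * t) with hℓ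
  have hℓcont : Continuous ℓ := by fun_prop
  have hℓ0 : ∀ t, 0 ≤ ℓ t := fun t => by positivity
  -- A plain minimum is not used: far to the left the stretching is too large for `Φ` to be a
  -- supersolution. The pieces fit because `ℓ ≤ Φ` on the window ending at `t₁` and `Φ < ℓ` at `t₀`.
  set ψ : ℝ → ℝ := fun t => if t ≤ t₁ then ℓ t else if t ≤ t₀ then min (ℓ t) (Φ t) else Φ t with hψ
  have hψcont : Continuous ψ := by
    refine Continuous.if_le hℓcont (Continuous.if_le (hℓcont.min hΦcont) hΦcont continuous_id
      continuous_const fun x hx => ?_) continuous_id continuous_const fun x hx => ?_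
    · rw [show x = t₀ from hx]
      exact min_eq_right hΦt₀.le
    · rw [show x = t₁ from hx, if_pos ht₁'.le, min_eq_left (hwin t₁ μ a hμ0.le (by linarith) le_rfl)]
  have hψ0 : ∀ t, 0 ≤ ψ t := fun t => by
    simp only [hψ]
    split_ifs
    exacts [hℓ0 t, le_min (hℓ0 t) (hΦ0 t), hΦ0 t]
  have hψℓ : ∀ t, t ≤ t₀ → ψ t ≤ ℓ t := fun t ht => by
    simp only [hψ]
    split_ifs
    exacts [le_rfl, min_le_left _ _]
  have hψΦ : ∀ t, t₁ - w ≤ t → ψ t ≤ Φ t := fun t ht => by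
    simp only [hψ]
    split_ifs with h1 h2
    exacts [hwin t μ a hμ0.le ht h1, min_le_right _ _, le_rfl]
  have testℓ : ∀ t, t < t₀ → ψ t = ℓ t → ∃ (q q' : ℝ → ℝ) (q₂ : ℝ), q t = ψ t ∧
      (∀ᶠ s in 𝓝 t, ψ s ≤ q s) ∧ (∀ᶠ s in 𝓝 t, HasDerivAt q (q' s) s) ∧ HasDerivAt q' q₂ t ∧
      q₂ - c' * q' t - q t + G (ψ (t - c' * h)) ≤ 0 := fun t ht heq => by
    refine ⟨ℓ, _, _, heq.symm, ?_, Eventually.of_forall (hasDerivAt_const_mul_exp B l),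
      hasDerivAt_const_mul_exp (B * l) l t, ?_⟩
    · filter_upwards [eventually_lt_nhds ht] with s hs using hψℓ s hs.le
    · have h1 : G (ψ (t - c' * h)) ≤ p * ℓ (t - c' * h) :=
        (hG.monotone (hψℓ _ (by linarith))).trans (hzero _ (hℓ0 _) (hBle _ (by linarith)))
      have h2 : ℓ (t - c' * h) = B * Real.exp (l * t) * Real.exp (-(l * c' * h)) := by
        simp only [hℓ]
        rw [mul_assoc, ← Real.exp_add]; ring_nf
      have h3 : B * Real.exp (l * t) * charFun p h c' l ≤ 0 :=
        mul_nonpos_of_nonneg_of_nonpos (hℓ0 t) hc'χ.le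
      rw [h2] at h1
      rw [charFun] at h3
      simp only [hℓ]
      linarith
  have testΦ : ∀ t, t₁ < t → ψ t = Φ t → ∃ (q q' : ℝ → ℝ) (q₂ : ℝ), q t = ψ t ∧
      (∀ᶠ s in 𝓝 t, ψ s ≤ q s) ∧ (∀ᶠ s in 𝓝 t, HasDerivAt q (q' s) s) ∧ HasDerivAt q' q₂ t ∧
      q₂ - c' * q' t - q t + G (ψ (t - c' * h)) ≤ 0 := fun t ht heq => by
    refine ⟨Φ, _, _, heq.symm, ?_, Eventually.of_forall (hφ.hasDerivAt_stretched hG ε m μ a),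
      hφ.hasDerivAt_stretchedDeriv hG ε m μ a t _ _ rfl rfl, ?_⟩
    · filter_upwards [eventually_gt_nhds ht] with s hs using hψΦ s (by linarith)
    · have h1 : G (ψ (t - c' * h)) ≤ G (Φ (t - c' * h)) := hG.monotone (hψΦ _ (by linarith))
      set x := t - ε * Real.exp (-(m * t)) with hx
      set Q := m * ε * Real.exp (-(m * t)) with hQ
      have hQ1 : Q ≤ 1 := hstr t (by linarith)
      have hQ0 : 0 ≤ Q := by positivity
      have hxt : t - 1 ≤ x := by linarith [hstr' t (by linarith)]
      have hxt' : x ≤ t := sub_le_self _ (by positivity)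
      clear_value Q x
      have hPx := hφ.profileDeriv_pos hG x
      rcases le_total t t₂ with htt | htt
      · have hin := hφ.stretched_inequality hG hh (hβd ▸ hm) hM (Γ := L) hε0.le hμ0.le
          ha0.le hac' hc'c.le hx.symm hQ.symm hQ1 (fun y v _ hv => by
            have := (abs_le.1 (hG.lipschitz (y + v) y)).2
            rw [add_sub_cancel_left, abs_of_nonneg hv] at this
            linarith)
        have hQQ : Q₀ ≤ Q := by
          rw [hQ₀, hQ]
          exact const_mul_exp_neg_le (by positivity) hm0.le htt
        have hv : μ * Real.exp (a * t) ≤ μ * Real.exp (a * t₂) :=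
          const_mul_exp_le hμ0.le ha0.le htt
        have hv0 : 0 ≤ μ * Real.exp (a * t) := by positivity
        have e1 : profileDeriv G c h φ x * (-Q + (c - c') * M)
            ≤ profileDeriv G c h φ x * (-(Q₀ / 2)) :=
          mul_le_mul_of_nonneg_left (by linarith) hPx.le
        have e2 : π₀ * (Q₀ / 2) ≤ profileDeriv G c h φ x * (Q₀ / 2) :=
          mul_le_mul_of_nonneg_right (hπ x (by linarith) (by linarith)) (by positivity)
        have e3 := mul_le_mul_of_nonneg_left hv hL
        linarith
      · have hin := hφ.stretched_inequality hG hh (hβd ▸ hm) hM (Γ := γ) hε0.le hμ0.le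
          ha0.le hac' hc'c.le hx.symm hQ.symm hQ1 (fun y v hy hv => hkappa y v
            ((ht₂' t htt).trans ((hφ.monotone (by linarith)).trans hy)) hv)
        have hv : μ * Real.exp (a * t₂) ≤ μ * Real.exp (a * t) :=
          const_mul_exp_le hμ0.le ha0.le htt
        have e0 : 0 ≤ (c - c') * M := mul_nonneg (by linarith) hM0.le
        have e1 : profileDeriv G c h φ x * (-Q + (c - c') * M)
            ≤ profileDeriv G c h φ x * ((c - c') * M) :=
          mul_le_mul_of_nonneg_left (by linarith) hPx.le
        have e2 : profileDeriv G c h φ x * ((c - c') * M) ≤ κ * ((c - c') * M) :=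
          mul_le_mul_of_nonneg_right (hφ.profileDeriv_le_kappa hG x) e0
        have e3 := mul_le_mul_of_nonneg_left hv (sub_pos.2 hγ).le
        linarith
  have hψtop : ∀ e > 0, ∀ᶠ t in atTop, κ - e < ψ t := fun e he => by
    have h1 : Tendsto (fun t => μ * Real.exp (a * t)) atTop atTop :=
      (Real.tendsto_exp_atTop.comp (tendsto_id.const_mul_atTop ha0)).const_mul_atTop hμ0
    filter_upwards [h1.eventually_gt_atTop κ, eventually_gt_atTop t₀] with t h2 h3
    have h4 : ψ t = Φ t := by
      simp only [hψ]
      rw [if_neg (by linarith), if_neg (by linarith)]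
    have h5 : μ * Real.exp (a * t) ≤ Φ t := le_add_of_nonneg_left (hφ.nonneg _)
    linarith
  obtain ⟨t₃, ht₃⟩ : ∃ t, ψ t < κ := by
    have h1 : Tendsto ℓ atBot (𝓝 0) := by
      have := (Real.tendsto_exp_atBot.comp (tendsto_id.const_mul_atBot hl)).const_mul B
      rwa [mul_zero] at this
    obtain ⟨t, h2, h3⟩ := ((h1.eventually_lt_const hκ).and (eventually_le_atBot t₀)).exists
    exact ⟨t, (hψℓ t h3).trans_lt h2⟩
  refine ⟨c', hc'c, hG.exists_monoFront_of_supersolution hψcont hψ0 hψtop ht₃ fun t _ => ?_⟩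
  rcases le_or_gt t t₁ with h1 | h1
  · exact testℓ t (h1.trans_lt ht₁') (by simp only [hψ]; rw [if_pos h1])
  rcases le_or_gt t t₀ with h2 | h2
  · have hval : ψ t = min (ℓ t) (Φ t) := by
      simp only [hψ]; rw [if_neg (not_le.2 h1), if_pos h2]
    rcases le_or_gt (ℓ t) (Φ t) with h3 | h3
    · refine testℓ t (lt_of_le_of_ne h2 ?_) (by rw [hval, min_eq_left h3])
      rintro rfl
      exact absurd hΦt₀ (not_lt.2 h3)
    · exact testΦ t h1 (by rw [hval, min_eq_right h3.le])
  · exact testΦ t h1 (by simp only [hψ]; rw [if_neg (not_le.2 h1), if_neg (not_le.2 h2)])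

end MonoFront

end

/-! ### The characteristic function and the linear speed. -/

section

variable {G : ℝ → ℝ} {κ L : ℝ}

section CharFun

variable {p h c : ℝ}

lemma hasDerivAt_charFun (p h c z : ℝ) :
    HasDerivAt (charFun p h c) (2 * z - c - p * Real.exp (-(z * c * h)) * (c * h)) z := by
  have h1 : HasDerivAt (fun z : ℝ => -(z * c * h)) (-(1 * c * h)) z :=
    (((hasDerivAt_id z).mul_const c).mul_const h).neg
  have := ((((hasDerivAt_id z).pow 2).sub ((hasDerivAt_id z).const_mul c)).sub_const 1).add
    (h1.exp.const_mul p)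
  refine this.congr_deriv ?_
  simp only [id]; ring

lemma strictConvexOn_charFun (hp : 0 ≤ p) : StrictConvexOn ℝ univ (charFun p h c) := by
  have h1 : StrictConvexOn ℝ univ fun z : ℝ => z ^ 2 := Even.strictConvexOn_pow even_two two_ne_zero
  have h2 : ConvexOn ℝ univ fun z : ℝ => -c * z - 1 :=
    ⟨convex_univ, fun x _ y _ a b _ _ hab => le_of_eq (by
      simp only [smul_eq_mul]; linear_combination hab)⟩
  have h3 : ConvexOn ℝ univ fun z : ℝ => p * Real.exp (-(z * c * h)) := by
    have : ConvexOn ℝ univ fun z : ℝ => Real.exp (-(z * c * h)) :=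
      ⟨convex_univ, fun x _ y _ a b ha hb hab => by
        have := convexOn_exp.2 (mem_univ (-(x * c * h))) (mem_univ (-(y * c * h))) ha hb hab
        simp only [smul_eq_mul] at this ⊢
        convert this using 2; ring⟩
    exact this.smul hp
  have := (h1.add_convexOn h2).add_convexOn h3
  have heq : charFun p h c =
      ((fun z => z ^ 2) + fun z => -c * z - 1) + fun z => p * Real.exp (-(z * c * h)) := by
    funext z
    simp only [charFun, Pi.add_apply]; ring
  rwa [heq]

lemma charFun_zero (p h c : ℝ) : charFun p h c 0 = p - 1 := by simp [charFun]; ring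

lemma continuous_charFun : Continuous (charFun p h c) := by unfold charFun; fun_prop

/-- If `χ` is negative somewhere on the positive half-line, it has exactly two positive roots, is
negative between them, and its derivative at the larger one is positive. -/
lemma exists_arePositiveRoots (hp : 1 < p) (hc : 0 ≤ c) {z₀ : ℝ} (hz₀ : 0 < z₀)
    (hneg : charFun p h c z₀ < 0) :
    ∃ l₁ l₂, ArePositiveRoots p h c l₁ l₂ ∧ (∀ z, l₁ < z → z < l₂ → charFun p h c z < 0) ∧
      p * Real.exp (-(l₂ * c * h)) * (c * h) < 2 * l₂ - c := by
  have hsc := strictConvexOn_charFun (h := h) (c := c) (zero_le_one.trans hp.le)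
  have hcont := continuous_charFun (p := p) (h := h) (c := c)
  obtain ⟨l₁, ⟨hl₁0, hl₁z⟩, hl₁⟩ : ∃ l ∈ Ioo 0 z₀, charFun p h c l = 0 := by
    have := intermediate_value_Ioo' hz₀.le hcont.continuousOn (f := charFun p h c)
    exact this ⟨hneg, by rw [charFun_zero]; linarith⟩
  -- At this point the quadratic part alone, `(c + 2 + z₀)(2 + z₀) - 1`, is positive.
  have hbig : 0 < charFun p h c (c + 2 + z₀) := by
    have := Real.exp_pos (-((c + 2 + z₀) * c * h))
    have : 0 < p * Real.exp (-((c + 2 + z₀) * c * h)) := by positivity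
    unfold charFun; nlinarith
  obtain ⟨l₂, ⟨hl₂z, -⟩, hl₂⟩ : ∃ l ∈ Ioo z₀ (c + 2 + z₀), charFun p h c l = 0 := by
    have := intermediate_value_Ioo (by linarith : z₀ ≤ c + 2 + z₀) hcont.continuousOn
      (f := charFun p h c)
    exact this ⟨hneg, hbig⟩
  have hll : l₁ < l₂ := hl₁z.trans hl₂z
  have key : ∀ x y z, x < y → y < z → charFun p h c x = 0 → charFun p h c z = 0 →
      charFun p h c y < 0 := fun x y z hxy hyz hx hz => by
    have hxz : 0 < z - x := by linarith
    have := hsc.2 (mem_univ x) (mem_univ z) (hxy.trans hyz).ne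
      (show 0 < (z - y) / (z - x) from div_pos (by linarith) hxz)
      (show 0 < (y - x) / (z - x) from div_pos (by linarith) hxz) (by field_simp; ring)
    rw [hx, hz] at this
    simp only [smul_eq_mul, mul_zero, add_zero] at this
    have e : (z - y) / (z - x) * x + (y - x) / (z - x) * z = y := by
      rw [div_mul_eq_mul_div, div_mul_eq_mul_div, ← add_div, div_eq_iff hxz.ne']
      ring
    rwa [e] at this
  refine ⟨l₁, l₂, ⟨hl₁0, hll, fun z hz => ⟨fun hz0 => ?_, ?_⟩⟩,
    fun z h1 h2 => key l₁ z l₂ h1 h2 hl₁ hl₂, ?_⟩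
  · rcases lt_trichotomy z l₁ with h1 | h1 | h1
    · exact absurd (key z l₁ l₂ h1 hll hz0 hl₂) (by rw [hl₁]; exact lt_irrefl 0)
    · exact Or.inl h1
    · rcases lt_trichotomy z l₂ with h2 | h2 | h2
      · exact absurd (key l₁ z l₂ h1 h2 hl₁ hl₂) (by rw [hz0]; exact lt_irrefl 0)
      · exact Or.inr h2
      · exact absurd (key l₁ l₂ z hll h2 hl₁ hz0) (by rw [hl₂]; exact lt_irrefl 0)
  · rintro (rfl | rfl) <;> assumption
  -- By convexity the derivative at `l₂` is at least the slope from `z₀`, where `χ` is negative.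
  · have hs := hsc.convexOn.slope_le_of_hasDerivAt (mem_univ z₀) (mem_univ l₂) hl₂z
      (hasDerivAt_charFun p h c l₂)
    have hs0 : 0 < slope (charFun p h c) z₀ l₂ := by
      rw [slope_def_field, hl₂]
      exact div_pos (by linarith) (by linarith)
    linarith

/-- If `χ(·,c)` is negative somewhere on the positive half-line, the linear speed is below `c`. -/
lemma exists_isLinearSpeed_lt (hp : 1 < p) (hc : 0 ≤ c) {z₀ : ℝ} (hz₀ : 0 < z₀)
    (hneg : charFun p h c z₀ < 0) : ∃ cs, IsLinearSpeed p h cs ∧ cs < c := by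
  set Z := c + 2 + z₀ with hZ
  have hcont : Continuous fun x : ℝ × ℝ => charFun p h x.1 x.2 := by unfold charFun; fun_prop
  set K : Set (ℝ × ℝ) := (Icc 0 c ×ˢ Icc 0 Z) ∩ {x | charFun p h x.1 x.2 ≤ 0} with hK
  have hKc : IsCompact K := (isCompact_Icc.prod isCompact_Icc).inter_right
    (isClosed_le hcont continuous_const)
  have hKne : K.Nonempty := ⟨(c, z₀), ⟨⟨hc, le_rfl⟩, ⟨hz₀.le, by simp only [hZ]; linarith⟩⟩, hneg.le⟩
  -- At the least speed for which `χ` reaches a nonpositive value, `χ` is nonnegative on `[0, Z]`,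
  -- since a negative value would survive a smaller speed. Its zero is thus an interior minimum,
  -- hence double.
  obtain ⟨⟨cs, z⟩, ⟨⟨hcs, hz⟩, hle⟩, hmin⟩ := hKc.exists_isMinOn hKne continuous_fst.continuousOn
  simp only [mem_ofPred_eq] at hle
  have hcsc : cs ≤ c := hcs.2
  have hcs0 : 0 < cs := by
    refine lt_of_le_of_ne hcs.1 fun h0 => ?_
    rw [← (show (0 : ℝ) = cs from h0), charFun] at hle
    simp only [zero_mul, mul_zero, neg_zero, Real.exp_zero] at hle
    nlinarith
  have hnonneg : ∀ y ∈ Icc 0 Z, 0 ≤ charFun p h cs y := fun y hy => by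
    by_contra hcon
    push Not at hcon
    have h1 : ∀ᶠ c' in 𝓝 cs, charFun p h c' y < 0 := by
      have : Continuous fun c' : ℝ => charFun p h c' y := by unfold charFun; fun_prop
      exact (this.tendsto cs).eventually_lt_const hcon
    have h5 : ∀ᶠ c' in 𝓝[<] cs, c' < cs := self_mem_nhdsWithin
    obtain ⟨c', k1, k2, k3⟩ := (h5.and ((h1.and (eventually_gt_nhds hcs0)).filter_mono
      nhdsWithin_le_nhds)).exists
    have := hmin (⟨⟨⟨k3.le, (k1.trans_le hcsc).le⟩, hy⟩, k2.le⟩ : (c', y) ∈ K)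
    simp only [mem_ofPred_eq] at this
    linarith
  have hzero : charFun p h cs z = 0 := le_antisymm hle (hnonneg z hz)
  have hz0 : 0 < z := by
    refine lt_of_le_of_ne hz.1 fun h0 => ?_
    rw [← (show (0 : ℝ) = z from h0), charFun_zero] at hzero
    linarith
  have hzZ : z < Z := by
    refine lt_of_le_of_ne hz.2 fun h0 => ?_
    have h1 : 0 < p * Real.exp (-(z * cs * h)) := by positivity
    have h2 : 2 * z ≤ z * (z - cs) := by rw [show z = Z from h0, hZ]; nlinarith
    unfold charFun at hzero
    nlinarith
  refine ⟨cs, ⟨z, hz0, hzero, ?_⟩, lt_of_le_of_ne hcsc ?_⟩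
  · refine IsLocalMin.deriv_eq_zero ?_
    filter_upwards [Ioo_mem_nhds hz0 hzZ] with y hy
    rw [hzero]
    exact hnonneg y ⟨hy.1.le, hy.2.le⟩
  · rintro rfl
    exact absurd hneg (not_lt.2 (hnonneg z₀ ⟨hz₀.le, by simp only [hZ]; linarith⟩))

/-- For `cs ≤ 0` the derivative of `χ` is at least `2z`, hence positive at every `z > 0`. -/
lemma IsLinearSpeed.pos {cs : ℝ} (hp : 0 ≤ p) (hh : 0 ≤ h) (hcs : IsLinearSpeed p h cs) :
    0 < cs := by
  obtain ⟨z, hz, -, hd⟩ := hcs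
  rw [(hasDerivAt_charFun p h cs z).deriv] at hd
  have h1 : 0 ≤ p * Real.exp (-(z * cs * h)) := by positivity
  by_contra hcon
  push Not at hcon
  have : 0 ≤ p * Real.exp (-(z * cs * h)) * (-cs * h) := by
    apply mul_nonneg h1; apply mul_nonneg _ hh; linarith
  have h2 : p * Real.exp (-(z * cs * h)) * (-cs * h) =
    -(p * Real.exp (-(z * cs * h)) * (cs * h)) := by ring
  have h3 : 2 * z - cs + p * Real.exp (-(z * cs * h)) * (-cs * h) = 0 := by linarith
  linarith

/-- For fixed `z > 0`, `χ(z, c)` strictly decreases in `c`, so it becomes negative at the former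
double zero. -/
lemma IsLinearSpeed.exists_charFun_neg {cs : ℝ} (hp : 0 ≤ p) (hh : 0 ≤ h)
    (hcs : IsLinearSpeed p h cs) (hlt : cs < c) : ∃ z, 0 < z ∧ charFun p h c z < 0 := by
  obtain ⟨z, hz, h0, -⟩ := hcs
  refine ⟨z, hz, ?_⟩
  have h1 : Real.exp (-(z * c * h)) ≤ Real.exp (-(z * cs * h)) :=
    Real.exp_le_exp.2 (neg_le_neg (mul_le_mul_of_nonneg_right
      (mul_le_mul_of_nonneg_left hlt.le hz.le) hh))
  have h2 := mul_le_mul_of_nonneg_left h1 hp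
  have h3 := mul_lt_mul_of_pos_left hlt hz
  unfold charFun at h0 ⊢
  linarith

end CharFun

/-! ### Bootstrap for a scalar delay equation near `-∞`. -/

/-- If `y' + ay ≤ 0` on `(-∞, T]` and `e^{at} y(t) → 0` as `t → -∞`, then `y ≤ 0` on `(-∞, T]`. -/
lemma nonpos_of_deriv_add_mul_nonpos {y y' : ℝ → ℝ} {a T : ℝ} (hy : ∀ t, HasDerivAt y (y' t) t)
    (hle : ∀ t ≤ T, y' t + a * y t ≤ 0)
    (hlim : Tendsto (fun t => y t * Real.exp (a * t)) atBot (𝓝 0)) : ∀ t ≤ T, y t ≤ 0 := by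
  have hd : ∀ t, HasDerivAt (fun t => y t * Real.exp (a * t))
      (y' t * Real.exp (a * t) + y t * (Real.exp (a * t) * (a * 1))) t := fun t =>
    (hy t).mul ((hasDerivAt_id t).const_mul a).exp
  have hanti : AntitoneOn (fun t => y t * Real.exp (a * t)) (Iic T) := by
    refine antitoneOn_of_deriv_nonpos (convex_Iic T)
      (fun t _ => (hd t).continuousAt.continuousWithinAt)
      (fun t _ => (hd t).differentiableAt.differentiableWithinAt) fun t ht => ?_
    rw [interior_Iic] at ht
    rw [(hd t).deriv]
    have := mul_nonpos_of_nonpos_of_nonneg (hle t (le_of_lt ht)) (Real.exp_pos (a * t)).le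
    linarith
  intro t ht
  have h1 : y t * Real.exp (a * t) ≤ 0 := by
    refine ge_of_tendsto hlim ?_
    filter_upwards [eventually_le_atBot t] with s hs
    exact hanti (hs.trans ht) ht hs
  exact nonpos_of_mul_nonpos_left h1 (Real.exp_pos _)

lemma tendsto_const_mul_exp_atBot (A : ℝ) {a : ℝ} (ha : 0 < a) :
    Tendsto (fun t => A * Real.exp (a * t)) atBot (𝓝 0) := by
  have := (Real.tendsto_exp_atBot.comp (tendsto_id.const_mul_atBot ha)).const_mul A
  rwa [mul_zero] at this

/-- One step of the bootstrap for `w' + aw - b ∫_{t-d}^t w = O(e^{σt})`. -/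
lemma delay_bound_step {w w' : ℝ → ℝ} {a b d ε σ R D m T : ℝ} (hw : ∀ t, HasDerivAt w (w' t) t)
    (hb : 0 ≤ b) (hd : 0 ≤ d) (hσ : 0 < σ) (hε : 0 < ε) (hεa : ε < a) (hm : 0 ≤ m)
    (hD : 0 ≤ D) (hDR : b * d * D + R = (a + σ) * D)
    (heq : ∀ t ≤ T, |w' t + a * w t - b * ∫ s in (t - d)..t, w s| ≤ R * Real.exp (σ * t))
    (hbd : ∀ t ≤ T, |w t| ≤ m * Real.exp (-ε * t) + D * Real.exp (σ * t)) :
    ∀ t ≤ T, |w t| ≤ (b * d * Real.exp (ε * d) / (a - ε)) * m * Real.exp (-ε * t)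
      + D * Real.exp (σ * t) := by
  set ρ := b * d * Real.exp (ε * d) / (a - ε) with hρ
  have hρm : (a - ε) * ρ = b * d * Real.exp (ε * d) := mul_div_cancel₀ _ (by linarith)
  -- `F' + aF` equals the bound for `w' + aw` given by the hypotheses, so `±w` can be compared with
  -- `F`. The relation `hDR` makes `D` reproduce itself, while `m` picks up the factor `ρ`.
  set F : ℝ → ℝ := fun t => ρ * m * Real.exp (-ε * t) + D * Real.exp (σ * t) with hF
  set F' : ℝ → ℝ := fun t => ρ * m * -ε * Real.exp (-ε * t) + D * σ * Real.exp (σ * t) with hF'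
  have hFd : ∀ t, HasDerivAt F (F' t) t := fun t =>
    (MonoFront.hasDerivAt_const_mul_exp (ρ * m) (-ε) t).add
      (MonoFront.hasDerivAt_const_mul_exp D σ t)
  have hI : ∀ t ≤ T, |b * ∫ s in (t - d)..t, w s|
      ≤ b * d * Real.exp (ε * d) * m * Real.exp (-ε * t) + b * d * D * Real.exp (σ * t) := by
    intro t ht
    have h1 := intervalIntegral.norm_integral_le_of_norm_le_const (a := t - d) (b := t) (f := w)
      (C := m * (Real.exp (ε * d) * Real.exp (-ε * t)) + D * Real.exp (σ * t)) fun s hs => by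
        rw [uIoc_of_le (by linarith)] at hs
        refine (hbd s (hs.2.trans ht)).trans (add_le_add ?_ ?_)
        · refine mul_le_mul_of_nonneg_left ?_ hm
          rw [← Real.exp_add]
          exact Real.exp_le_exp.2 (by nlinarith [hs.1])
        · exact MonoFront.const_mul_exp_le hD hσ.le hs.2
    rw [sub_sub_cancel, abs_of_nonneg hd, Real.norm_eq_abs] at h1
    rw [abs_mul, abs_of_nonneg hb]
    calc _ ≤ _ := mul_le_mul_of_nonneg_left h1 hb
      _ = _ := by ring
  have hsum : ∀ t ≤ T, |w' t + a * w t| ≤ F' t + a * F t := by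
    intro t ht
    have h1 := abs_le.1 (hI t ht)
    have h2 := abs_le.1 (heq t ht)
    have h3 : F' t + a * F t = b * d * Real.exp (ε * d) * m * Real.exp (-ε * t)
        + b * d * D * Real.exp (σ * t) + R * Real.exp (σ * t) := by
      simp only [hF, hF']
      linear_combination (m * Real.exp (-ε * t)) * hρm - Real.exp (σ * t) * hDR
    rw [h3, abs_le]
    constructor <;> linarith [h1.1, h1.2, h2.1, h2.2]
  have hFlim : Tendsto (fun t => F t * Real.exp (a * t)) atBot (𝓝 0) := by
    have := (tendsto_const_mul_exp_atBot (ρ * m) (sub_pos.2 hεa)).add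
      (tendsto_const_mul_exp_atBot D (show 0 < σ + a by linarith))
    rw [add_zero] at this
    refine this.congr fun t => ?_
    simp only [hF]
    rw [sub_mul, add_mul σ, Real.exp_sub, Real.exp_add, neg_mul, Real.exp_neg]
    ring
  have hwlim : Tendsto (fun t => w t * Real.exp (a * t)) atBot (𝓝 0) := by
    have := (tendsto_const_mul_exp_atBot m (sub_pos.2 hεa)).add
      (tendsto_const_mul_exp_atBot D (show 0 < σ + a by linarith))
    rw [add_zero] at this
    refine squeeze_zero_norm' ?_ this
    filter_upwards [eventually_le_atBot T] with t ht
    rw [norm_mul, Real.norm_eq_abs, Real.norm_of_nonneg (Real.exp_pos _).le]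
    refine (mul_le_mul_of_nonneg_right (hbd t ht) (Real.exp_pos _).le).trans (le_of_eq ?_)
    rw [add_mul, mul_assoc m, mul_assoc D, ← Real.exp_add, ← Real.exp_add]
    ring_nf
  intro t ht
  rw [abs_le]
  constructor
  · have := nonpos_of_deriv_add_mul_nonpos (a := a) (T := T) (fun t => ((hw t).add (hFd t)).neg)
      (fun t ht => by
        have := (abs_le.1 (hsum t ht)).1
        simp only [Pi.neg_apply, Pi.add_apply]
        linarith) (by
        have := (hwlim.add hFlim).neg
        rw [add_zero, neg_zero] at this
        refine this.congr fun t => ?_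
        simp only [Pi.neg_apply, Pi.add_apply]
        ring) t ht
    simp only [Pi.neg_apply, Pi.add_apply] at this
    simp only [hF] at this
    linarith
  · have := nonpos_of_deriv_add_mul_nonpos (a := a) (T := T) (fun t => (hw t).sub (hFd t))
      (fun t ht => by
        have := (abs_le.1 (hsum t ht)).2
        simp only [Pi.sub_apply]
        linarith) (by
        have := (hwlim.sub hFlim)
        rw [sub_zero] at this
        refine this.congr fun t => ?_
        simp only [Pi.sub_apply]
        ring) t ht
    simp only [Pi.sub_apply] at this
    simp only [hF] at this
    linarith

/-- Solutions of `w' + aw - b ∫_{t-d}^t w = O(e^{σt})` with slow growth at `-∞` are `O(e^{σt})`. -/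
lemma delay_bound {w w' : ℝ → ℝ} {a b d ε σ R m T : ℝ} (hw : ∀ t, HasDerivAt w (w' t) t)
    (hb : 0 ≤ b) (hd : 0 ≤ d) (hσ : 0 < σ) (hε : 0 < ε) (hR : 0 ≤ R)
    (hm : 0 ≤ m) (hcon : b * d * Real.exp (ε * d) < a - ε)
    (heq : ∀ t ≤ T, |w' t + a * w t - b * ∫ s in (t - d)..t, w s| ≤ R * Real.exp (σ * t))
    (hbd : ∀ t ≤ T, |w t| ≤ m * Real.exp (-ε * t)) :
    ∃ D, ∀ t ≤ T, |w t| ≤ D * Real.exp (σ * t) := by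
  have hbd0 : 0 ≤ b * d := mul_nonneg hb hd
  have hεa : ε < a := by
    have : 0 ≤ b * d * Real.exp (ε * d) := by positivity
    linarith
  have h1 : b * d ≤ b * d * Real.exp (ε * d) :=
    le_mul_of_one_le_right hbd0 (Real.one_le_exp (by positivity))
  have hpos : 0 < a + σ - b * d := by linarith
  set D := R / (a + σ - b * d) with hDdef
  have hD : 0 ≤ D := by positivity
  have hDR : b * d * D + R = (a + σ) * D := by
    have : D * (a + σ - b * d) = R := div_mul_cancel₀ _ hpos.ne'
    linarith
  set ρ := b * d * Real.exp (ε * d) / (a - ε) with hρ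
  have hρ0 : 0 ≤ ρ := div_nonneg (by positivity) (by linarith)
  have hρ1 : ρ < 1 := by rw [hρ, div_lt_one (by linarith)]; exact hcon
  -- As `ρ < 1`, iterating the step wipes out the growing term and leaves the `D` term.
  have key : ∀ n : ℕ, ∀ t ≤ T, |w t| ≤ ρ ^ n * m * Real.exp (-ε * t) + D * Real.exp (σ * t) := by
    intro n
    induction n with
    | zero =>
      intro t ht
      rw [pow_zero, one_mul]
      exact (hbd t ht).trans (le_add_of_nonneg_right (by positivity))
    | succ n ih =>
      have := delay_bound_step hw hb hd hσ hε hεa (mul_nonneg (pow_nonneg hρ0 n) hm) hD hDR heq ih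
      intro t ht
      rw [pow_succ', mul_assoc ρ]
      exact this t ht
  refine ⟨D, fun t ht => ?_⟩
  have hlim : Tendsto (fun n : ℕ => ρ ^ n * m * Real.exp (-ε * t) + D * Real.exp (σ * t)) atTop
      (𝓝 (0 * m * Real.exp (-ε * t) + D * Real.exp (σ * t))) :=
    (((tendsto_pow_atTop_nhds_zero_of_lt_one hρ0 hρ1).mul_const m).mul_const _).add_const _
  rw [zero_mul, zero_mul, zero_add] at hlim
  exact ge_of_tendsto' hlim fun n => key n t ht

/-- A function with `|J'| ≤ R e^{σt}` near `-∞` converges exponentially fast there. -/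
lemma exists_limit_of_deriv_bound {J J' : ℝ → ℝ} {σ R T : ℝ} (hJ : ∀ t, HasDerivAt J (J' t) t)
    (hσ : 0 < σ) (hR : 0 ≤ R) (hle : ∀ t ≤ T, |J' t| ≤ R * Real.exp (σ * t)) :
    ∃ C, ∀ t ≤ T, |J t - C| ≤ R / σ * Real.exp (σ * t) := by
  have he := fun t => MonoFront.hasDerivAt_const_mul_exp (R / σ) σ t
  have hcan : R / σ * σ = R := div_mul_cancel₀ _ hσ.ne'
  have hmono : MonotoneOn (fun t => J t + R / σ * Real.exp (σ * t)) (Iic T) := by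
    have hd : ∀ t, HasDerivAt (fun t => J t + R / σ * Real.exp (σ * t)) _ t :=
      fun t => (hJ t).add (he t)
    refine monotoneOn_of_deriv_nonneg (convex_Iic T)
      (fun t _ => (hd t).continuousAt.continuousWithinAt)
      (fun t _ => (hd t).differentiableAt.differentiableWithinAt) fun t ht => ?_
    rw [interior_Iic] at ht
    rw [(hd t).deriv, hcan]
    linarith [(abs_le.1 (hle t (le_of_lt ht))).1]
  have hanti : AntitoneOn (fun t => J t - R / σ * Real.exp (σ * t)) (Iic T) := by
    have hd : ∀ t, HasDerivAt (fun t => J t - R / σ * Real.exp (σ * t)) _ t :=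
      fun t => (hJ t).sub (he t)
    refine antitoneOn_of_deriv_nonpos (convex_Iic T)
      (fun t _ => (hd t).continuousAt.continuousWithinAt)
      (fun t _ => (hd t).differentiableAt.differentiableWithinAt) fun t ht => ?_
    rw [interior_Iic] at ht
    rw [(hd t).deriv, hcan]
    linarith [(abs_le.1 (hle t (le_of_lt ht))).2]
  have hpos : ∀ t, 0 ≤ R / σ * Real.exp (σ * t) := fun t => by positivity
  have hcross : ∀ t ≤ T, ∀ s ≤ T,
      J t - R / σ * Real.exp (σ * t) ≤ J s + R / σ * Real.exp (σ * s) := fun t ht s hs => by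
    rcases le_total s t with h1 | h1
    · have := hanti hs ht h1
      simp only at this
      linarith [hpos s]
    · have := hmono ht hs h1
      simp only at this
      linarith [hpos t]
  -- The upper envelopes increase in `t` and the lower ones decrease, and every lower one lies below
  -- every upper one; the infimum of the upper ones is the limit.
  set S := (fun t => J t + R / σ * Real.exp (σ * t)) '' Iic T with hS
  refine ⟨sInf S, fun t ht => ?_⟩
  have h1 : sInf S ≤ J t + R / σ * Real.exp (σ * t) :=
    csInf_le ⟨J T - R / σ * Real.exp (σ * T), by
      rintro _ ⟨s, hs, rfl⟩; exact hcross T le_rfl s hs⟩ ⟨t, ht, rfl⟩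
  have h2 : J t - R / σ * Real.exp (σ * t) ≤ sInf S :=
    le_csInf ⟨_, ⟨T, mem_Iic.2 le_rfl, rfl⟩⟩ (by rintro _ ⟨s, hs, rfl⟩; exact hcross t ht s hs)
  rw [abs_le]
  constructor <;> linarith

end

/-! ### Asymptotics of the profile at `-∞`. -/

section

variable {G : ℝ → ℝ} {κ L : ℝ}

namespace MonoFront

variable {c h : ℝ} {φ : ℝ → ℝ}

/-- Rescaling by the eigenfunction `e^{lt}` brings the profile equation into divergence form. -/
lemma exists_divergence_form (hG : Reaction G κ L) (hφ : MonoFront G κ c h φ) {p l : ℝ}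
    (hχ : charFun p h c l = 0) :
    ∃ v' : ℝ → ℝ, (∀ t, HasDerivAt (fun t => φ t * Real.exp (-l * t)) (v' t) t) ∧
      ∀ t, HasDerivAt (fun t => v' t + (2 * l - c) * (φ t * Real.exp (-l * t))
          - p * Real.exp (-(l * c * h)) * ∫ s in (t - c * h)..t, φ s * Real.exp (-l * s))
        (Real.exp (-l * t) * (p * φ (t - c * h) - G (φ (t - c * h)))) t := by
  set v : ℝ → ℝ := fun t => φ t * Real.exp (-l * t) with hv
  have he : ∀ t, HasDerivAt (fun t => Real.exp (-l * t)) (-l * Real.exp (-l * t)) t := fun t => by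
    simpa using hasDerivAt_const_mul_exp 1 (-l) t
  have hvc : Continuous v := by
    have := hφ.continuous
    fun_prop
  have hvi : ∀ x y, IntervalIntegrable v volume x y := fun x y => hvc.intervalIntegrable x y
  set b := p * Real.exp (-(l * c * h)) with hb
  refine ⟨fun t => profileDeriv G c h φ t * Real.exp (-l * t) + φ t * (-l * Real.exp (-l * t)),
    fun t => (hφ.hasDerivAt hG t).mul (he t), fun t => ?_⟩
  have h1 := ((hφ.hasDerivAt_profileDeriv hG t).mul (he t)).add
    ((hφ.hasDerivAt hG t).mul ((he t).const_mul (-l)))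
  have h2 := ((hφ.hasDerivAt hG t).mul (he t)).const_mul (2 * l - c)
  have hV : ∀ x, HasDerivAt (fun x => ∫ s in (0 : ℝ)..x, v s) (v x) x := fun x =>
    intervalIntegral.integral_hasDerivAt_right (hvi _ _) (hvc.stronglyMeasurableAtFilter _ _)
      hvc.continuousAt
  have h3 : HasDerivAt (fun t => ∫ s in (t - c * h)..t, v s) (v t - v (t - c * h)) t := by
    have h4 := (hV t).sub ((hV (t - c * h)).comp_sub_const t (c * h))
    refine h4.congr_of_eventuallyEq (Eventually.of_forall fun x => ?_)
    exact (intervalIntegral.integral_interval_sub_left (hvi _ _) (hvi _ _)).symm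
  refine ((h1.add h2).sub (h3.const_mul b)).congr_deriv ?_
  have h5 : b * v (t - c * h) = p * Real.exp (-l * t) * φ (t - c * h) := by
    simp only [hb, hv]
    have : Real.exp (-(l * c * h)) * Real.exp (-l * (t - c * h)) = Real.exp (-l * t) := by
      rw [← Real.exp_add]; ring_nf
    linear_combination p * φ (t - c * h) * this
  -- Because `l` is a root, the zeroth-order terms combine to `-b (v(t) - v(t - ch))`, which is the
  -- derivative of an integral.
  have h6 : l ^ 2 - c * l - 1 + b = 0 := hχ
  rw [mul_sub, h5]
  simp only [hv]
  linear_combination (-φ t * Real.exp (-l * t)) * h6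

/-- Improvement of a decay rate: subtracting a multiple of the eigenfunction `e^{lt}`, a bound
`φ = O(e^{ρt})` turns into the bound `O(e^{(1+θ)ρt})`. -/
lemma improve_decay (hG : Reaction G κ L) (hφ : MonoFront G κ c h φ) (hch : 0 ≤ c * h)
    {p l δ C θ ε ρ M T : ℝ} (hp : 0 ≤ p) (hχ : charFun p h c l = 0)
    (hε : 0 < ε) (hcon : p * Real.exp (-(l * c * h)) * (c * h) * Real.exp (ε * (c * h))
      < 2 * l - c - ε)
    (hδ : 0 < δ) (hC : 0 ≤ C) (hθ : 0 < θ)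
    (hzero : ∀ u, 0 ≤ u → u ≤ δ → |G u - p * u| ≤ C * u ^ (1 + θ))
    (hρ : 0 ≤ ρ) (hρl : l - ε ≤ ρ) (hσ : l < (1 + θ) * ρ)
    (hbd : ∀ t ≤ T, φ t ≤ M * Real.exp (ρ * t)) :
    ∃ A D T', ∀ t ≤ T', |φ t - A * Real.exp (l * t)| ≤ D * Real.exp ((1 + θ) * ρ * t) := by
  obtain ⟨v', hv, hJ⟩ := hφ.exists_divergence_form hG hχ
  set b := p * Real.exp (-(l * c * h)) with hb
  set a := 2 * l - c with ha
  set d := c * h with hd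
  set σ := (1 + θ) * ρ - l with hσd
  have hσ0 : 0 < σ := sub_pos.2 hσ
  have hb0 : 0 ≤ b := by positivity
  have hM : 0 ≤ M := by
    have := (hφ.nonneg T).trans (hbd T le_rfl)
    exact nonneg_of_mul_nonneg_left this (Real.exp_pos _)
  obtain ⟨T₁, hT₁⟩ := (hφ.tendsto_atBot.eventually_lt_const hδ).exists
  -- Nonpositive times are needed to pass from `e^{(ρ - l)t}` and from constants to `e^{-εt}`.
  set T' := min (min T T₁) 0 with hT'
  have hT'T : T' ≤ T := (min_le_left _ _).trans (min_le_left _ _)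
  have hT'1 : T' ≤ T₁ := (min_le_left _ _).trans (min_le_right _ _)
  have hT'0 : T' ≤ 0 := min_le_right _ _
  have hR : ∀ t ≤ T', |Real.exp (-l * t) * (p * φ (t - d) - G (φ (t - d)))|
      ≤ C * M ^ (1 + θ) * Real.exp (σ * t) := by
    intro t ht
    have h1 := hzero (φ (t - d)) (hφ.nonneg _)
      ((hφ.monotone (by linarith : t - d ≤ T₁)).trans hT₁.le)
    have h2 : φ (t - d) ≤ M * Real.exp (ρ * t) :=
      (hbd (t - d) (by linarith)).trans (const_mul_exp_le hM hρ (by linarith))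
    have h3 : φ (t - d) ^ (1 + θ) ≤ M ^ (1 + θ) * Real.exp ((1 + θ) * ρ * t) := by
      refine (Real.rpow_le_rpow (hφ.nonneg _) h2 (by linarith)).trans (le_of_eq ?_)
      rw [Real.mul_rpow hM (Real.exp_pos _).le, ← Real.exp_mul]
      ring_nf
    have h4 : Real.exp (σ * t) = Real.exp (-l * t) * Real.exp ((1 + θ) * ρ * t) := by
      rw [← Real.exp_add, hσd]; ring_nf
    rw [abs_mul, abs_of_pos (Real.exp_pos _), abs_sub_comm, h4]
    calc _ ≤ Real.exp (-l * t) * (C * (M ^ (1 + θ) * Real.exp ((1 + θ) * ρ * t))) :=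
          mul_le_mul_of_nonneg_left (h1.trans (mul_le_mul_of_nonneg_left h3 hC)) (Real.exp_pos _).le
      _ = _ := by ring
  obtain ⟨C₀, hC₀⟩ := exists_limit_of_deriv_bound hJ hσ0
    (mul_nonneg hC (Real.rpow_nonneg hM _)) hR
  have had : 0 < a - b * d := by
    have h1 : b * d ≤ b * d * Real.exp (ε * d) :=
      le_mul_of_one_le_right (mul_nonneg hb0 hch) (Real.one_le_exp (by positivity))
    linarith
  -- The constant solution of the limiting equation; the denominator is `χ'(l) > 0`. Subtracting it
  -- leaves a remainder of order `e^{σt}`.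
  set A := C₀ / (a - b * d) with hA
  have hAC : A * (a - b * d) = C₀ := div_mul_cancel₀ _ had.ne'
  have hvc : Continuous fun t => φ t * Real.exp (-l * t) :=
    continuous_iff_continuousAt.2 fun t => (hv t).continuousAt
  obtain ⟨D, hD⟩ := delay_bound (w := fun t => φ t * Real.exp (-l * t) - A) (w' := v') (a := a)
    (b := b) (d := d) (ε := ε) (σ := σ) (R := C * M ^ (1 + θ) / σ) (m := M + |A|) (T := T')
    (fun t => (hv t).sub_const A) hb0 hch hσ0 hε
    (div_nonneg (mul_nonneg hC (Real.rpow_nonneg hM _)) hσ0.le) (add_nonneg hM (abs_nonneg A)) hcon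
    (fun t ht => by
      have h1 := hC₀ t ht
      rw [intervalIntegral.integral_sub (hvc.intervalIntegrable _ _) (by simp),
        intervalIntegral.integral_const, smul_eq_mul, sub_sub_cancel]
      convert h1 using 2
      linear_combination -hAC)
    (fun t ht => by
      have ht0 : t ≤ 0 := ht.trans hT'0
      have h1 : φ t * Real.exp (-l * t) ≤ M * Real.exp (-ε * t) := by
        calc _ ≤ M * Real.exp (ρ * t) * Real.exp (-l * t) :=
              mul_le_mul_of_nonneg_right (hbd t (ht.trans hT'T)) (Real.exp_pos _).le
          _ ≤ _ := by
              rw [mul_assoc, ← Real.exp_add]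
              exact mul_le_mul_of_nonneg_left (Real.exp_le_exp.2 (by nlinarith)) hM
      have h2 : |A| ≤ |A| * Real.exp (-ε * t) :=
        le_mul_of_one_le_right (abs_nonneg A) (Real.one_le_exp (by nlinarith))
      have h3 : 0 ≤ φ t * Real.exp (-l * t) := mul_nonneg (hφ.nonneg t) (Real.exp_pos _).le
      refine (abs_sub _ _).trans ?_
      rw [abs_of_nonneg h3, add_mul]
      exact add_le_add h1 h2)
  refine ⟨A, D, T', fun t ht => ?_⟩
  have h1 : φ t - A * Real.exp (l * t) = (φ t * Real.exp (-l * t) - A) * Real.exp (l * t) := by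
    have : Real.exp (-l * t) * Real.exp (l * t) = 1 := by rw [← Real.exp_add]; simp
    linear_combination (-φ t) * this
  rw [h1, abs_mul, abs_of_pos (Real.exp_pos (l * t))]
  calc _ ≤ D * Real.exp (σ * t) * Real.exp (l * t) :=
        mul_le_mul_of_nonneg_right (hD t ht) (Real.exp_pos _).le
    _ = _ := by
        rw [mul_assoc, ← Real.exp_add, hσd]; ring_nf

/-- The profile cannot decay faster than `e^{lt}`. -/
lemma not_fast_decay (hG : Reaction G κ L) (hφ : MonoFront G κ c h φ) (hch : 0 ≤ c * h)
    {p l δ C θ ε : ℝ} (hp : 0 ≤ p) (hl : 0 < l) (hχ : charFun p h c l = 0)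
    (hε : 0 < ε) (hcon : p * Real.exp (-(l * c * h)) * (c * h) * Real.exp (ε * (c * h))
      < 2 * l - c - ε)
    (hδ : 0 < δ) (hC : 0 ≤ C) (hθ : 0 < θ)
    (hzero : ∀ u, 0 ≤ u → u ≤ δ → |G u - p * u| ≤ C * u ^ (1 + θ))
    {ρ M T : ℝ} (hρ : l < ρ) (hbd : ∀ t ≤ T, φ t ≤ M * Real.exp (ρ * t)) : False := by
  have key : ∀ n : ℕ, ∃ M T, ∀ t ≤ T, φ t ≤ M * Real.exp ((1 + θ) ^ n * ρ * t) := by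
    intro n
    induction n with
    | zero => exact ⟨M, T, by simpa using hbd⟩
    | succ n ih =>
      obtain ⟨M, T, hMT⟩ := ih
      set r := (1 + θ) ^ n * ρ with hr
      have hr1 : ρ ≤ r := le_mul_of_one_le_left (by linarith) (one_le_pow₀ (by linarith))
      have hrl : l < (1 + θ) * r := by nlinarith
      obtain ⟨A, D, T', hA⟩ := hφ.improve_decay hG hch hp hχ hε hcon hδ hC hθ hzero
        (ρ := r) (by linarith) (by linarith) hrl hMT
      -- The profile is `o(e^{lt})` since `r > l`, so the leading coefficient cannot be positive,
      -- and the next decay rate is `(1 + θ) r`.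
      have hA0 : A ≤ 0 := by
        have h1 : Tendsto (fun t => M * Real.exp ((r - l) * t)
            + D * Real.exp (((1 + θ) * r - l) * t)) atBot (𝓝 (0 + 0)) :=
          (tendsto_const_mul_exp_atBot M (by linarith)).add
            (tendsto_const_mul_exp_atBot D (by linarith))
        rw [add_zero] at h1
        refine ge_of_tendsto h1 ?_
        filter_upwards [eventually_le_atBot T, eventually_le_atBot T'] with t h2 h3
        have h4 := hMT t h2
        have h5 := (abs_le.1 (hA t h3)).1
        have h6 : A * Real.exp (l * t) ≤ (M * Real.exp ((r - l) * t)
            + D * Real.exp (((1 + θ) * r - l) * t)) * Real.exp (l * t) := by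
          rw [add_mul, mul_assoc M, mul_assoc D, ← Real.exp_add, ← Real.exp_add]
          ring_nf at h4 h5 ⊢
          linarith
        exact le_of_mul_le_mul_right h6 (Real.exp_pos _)
      refine ⟨D, T', fun t ht => ?_⟩
      have h1 := (abs_le.1 (hA t ht)).2
      have h2 : A * Real.exp (l * t) ≤ 0 := mul_nonpos_of_nonpos_of_nonneg hA0 (Real.exp_pos _).le
      rw [pow_succ', mul_assoc (1 + θ), ← hr]
      linarith
  -- Once the decay rate exceeds `growthRate c`, the Harnack bound `φ(0) ≤ φ(t) e^{growthRate c ·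
  -- |t|}` forces `φ(0) ≤ 0`.
  obtain ⟨n, hn⟩ := pow_unbounded_of_one_lt (growthRate c / ρ) (show 1 < 1 + θ by linarith)
  rw [div_lt_iff₀ (by linarith)] at hn
  obtain ⟨M, T, hMT⟩ := key n
  have h1 := tendsto_const_mul_exp_atBot M (sub_pos.2 hn)
  refine absurd (ge_of_tendsto h1 (b := φ 0) ?_) (not_le.2 (hφ.pos hG 0))
  filter_upwards [eventually_le_atBot T, eventually_le_atBot 0] with t h2 h3
  have h4 := hφ.le_mul_exp hG t (s := -t) (by linarith)
  rw [add_neg_cancel] at h4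
  refine h4.trans ((mul_le_mul_of_nonneg_right (hMT t h2) (Real.exp_pos _).le).trans (le_of_eq ?_))
  rw [mul_assoc, ← Real.exp_add]
  ring_nf

/-- A front decaying faster than all `e^{zt}` with `z < l₂` near `l₂` has the pushed asymptotics. -/
theorem exists_asymptotics (hG : Reaction G κ L) (hφ : MonoFront G κ c h φ) (hch : 0 ≤ c * h)
    {p l₁ l δ C θ : ℝ} (hp : 0 ≤ p) (hl₁ : 0 < l₁) (hl₁l : l₁ < l) (hχ : charFun p h c l = 0)
    (hχ' : p * Real.exp (-(l * c * h)) * (c * h) < 2 * l - c)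
    (hδ : 0 < δ) (hC : 0 ≤ C) (hθ : 0 < θ)
    (hzero : ∀ u, 0 ≤ u → u ≤ δ → |G u - p * u| ≤ C * u ^ (1 + θ))
    (hfast : ∀ z, l₁ < z → z < l → ∃ M T, ∀ t ≤ T, φ t ≤ M * Real.exp (z * t)) :
    ∃ s₀ ς : ℝ, 0 < ς ∧
      (fun t => φ (t + s₀) - Real.exp (l * t)) =O[atBot] (fun t => Real.exp ((l + ς) * t)) := by
  have hl : 0 < l := hl₁.trans hl₁l
  -- These conditions hold at `ε = 0` and are open. The third makes the nonlinear remainder decay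
  -- faster than `e^{lt}`; the last is a quantitative form of `χ'(l) > 0`.
  obtain ⟨ε, hε, hε1, hε2, hcon⟩ : ∃ ε > 0, l₁ < l - ε ∧ l < (1 + θ) * (l - ε) ∧
      p * Real.exp (-(l * c * h)) * (c * h) * Real.exp (ε * (c * h)) < 2 * l - c - ε := by
    have k1 : ∀ᶠ ε in 𝓝 (0 : ℝ), l₁ < l - ε :=
      ((by fun_prop : Continuous fun ε : ℝ => l - ε).tendsto 0).eventually_const_lt (by simpa)
    have k2 : ∀ᶠ ε in 𝓝 (0 : ℝ), l < (1 + θ) * (l - ε) :=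
      ((by fun_prop : Continuous fun ε : ℝ => (1 + θ) * (l - ε)).tendsto 0).eventually_const_lt
        (by simp only [sub_zero]; nlinarith)
    have k3 : ∀ᶠ ε in 𝓝 (0 : ℝ), p * Real.exp (-(l * c * h)) * (c * h) * Real.exp (ε * (c * h)) + ε
        < 2 * l - c :=
      ((by fun_prop : Continuous fun ε : ℝ => p * Real.exp (-(l * c * h)) * (c * h)
        * Real.exp (ε * (c * h)) + ε).tendsto 0).eventually_lt_const (by simpa using hχ')
    have k4 : ∀ᶠ ε in 𝓝[>] (0 : ℝ), 0 < ε := self_mem_nhdsWithin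
    obtain ⟨ε, e4, e1, e2, e3⟩ := (k4.and ((k1.and (k2.and k3)).filter_mono
      nhdsWithin_le_nhds)).exists
    exact ⟨ε, e4, e1, e2, by linarith⟩
  obtain ⟨M, T, hMT⟩ := hfast (l - ε) hε1 (by linarith)
  obtain ⟨A, D, T', hA⟩ := hφ.improve_decay hG hch hp hχ hε hcon hδ hC hθ hzero
    (ρ := l - ε) (by linarith) le_rfl hε2 hMT
  have hApos : 0 < A := by
    by_contra hcon'
    push Not at hcon'
    refine hφ.not_fast_decay hG hch hp hl hχ hε hcon hδ hC hθ hzero hε2 (M := D) (T := T')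
      fun t ht => ?_
    have h1 := (abs_le.1 (hA t ht)).2
    have h2 : A * Real.exp (l * t) ≤ 0 := mul_nonpos_of_nonpos_of_nonneg hcon' (Real.exp_pos _).le
    linarith
  -- The shift for which `A e^{l s₀} = 1`.
  set s₀ := -Real.log A / l with hs₀
  refine ⟨s₀, (1 + θ) * (l - ε) - l, sub_pos.2 hε2, ?_⟩
  refine IsBigO.of_bound (D * Real.exp ((1 + θ) * (l - ε) * s₀)) ?_
  filter_upwards [eventually_le_atBot (T' - s₀)] with t ht
  have h1 : A * Real.exp (l * (t + s₀)) = Real.exp (l * t) := by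
    have h2 : l * s₀ = -Real.log A := by rw [hs₀]; field_simp
    rw [mul_add, h2, Real.exp_add, Real.exp_neg, Real.exp_log hApos]
    field_simp
  have h3 := hA (t + s₀) (by linarith)
  rw [h1] at h3
  rw [Real.norm_eq_abs, Real.norm_of_nonneg (Real.exp_pos _).le]
  refine h3.trans (le_of_eq ?_)
  rw [mul_assoc D, ← Real.exp_add]
  ring_nf

end MonoFront

end

/-! ### From the birth function to the clamped reaction and back; persistence. -/

section

/-- The birth function, with its argument clamped to `[0, κ]`. -/
noncomputable def clamped (g : ℝ → ℝ) (κ u : ℝ) : ℝ := g (max 0 (min u κ))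

variable {g : ℝ → ℝ} {κ : ℝ}

lemma clamped_of_mem {u : ℝ} (h0 : 0 ≤ u) (h1 : u ≤ κ) : clamped g κ u = g u := by
  rw [clamped, min_eq_left h1, max_eq_right h0]

lemma clamp_mem (hκ : 0 ≤ κ) (u : ℝ) : max 0 (min u κ) ∈ Icc 0 κ :=
  ⟨le_max_left _ _, max_le hκ (min_le_right _ _)⟩

lemma clamp_mono (κ : ℝ) {u v : ℝ} (huv : u ≤ v) : max 0 (min u κ) ≤ max 0 (min v κ) :=
  max_le_max le_rfl (min_le_min huv le_rfl)

lemma abs_clamp_sub_clamp_le (κ u v : ℝ) : |max 0 (min u κ) - max 0 (min v κ)| ≤ |u - v| := by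
  refine (abs_max_sub_max_le_max _ _ _ _).trans (max_le (by simp) ?_)
  exact (abs_min_sub_min_le_max _ _ _ _).trans (max_le le_rfl (by simp))

namespace Monostable

lemma map_zero (hg : Monostable g κ) : g 0 = 0 := (hg.fixed_iff 0 le_rfl).2 (Or.inl rfl)

lemma map_kappa (hg : Monostable g κ) : g κ = κ :=
  (hg.fixed_iff κ hg.kappa_pos.le).2 (Or.inr rfl)

/-- The slope at `0` puts the graph above the diagonal near `0`, and crossing it before `κ` would
create a third fixed point. -/
lemma lt_apply (hg : Monostable g κ) {u : ℝ} (h0 : 0 < u) (h1 : u < κ) : u < g u := by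
  -- `derivWithin` takes the default value `0` without differentiability, so a value above `1`
  -- yields differentiability.
  have hd : HasDerivWithinAt g (birthDeriv g 0) (Ici 0) 0 := by
    refine DifferentiableWithinAt.hasDerivWithinAt
      (differentiableWithinAt_of_derivWithin_ne_zero ?_)
    exact (zero_lt_one.trans hg.one_lt_deriv_zero).ne'
  have hs : ∀ᶠ x in 𝓝[>] (0 : ℝ), x < g x := by
    have h2 := hasDerivWithinAt_iff_tendsto_slope.1 hd
    rw [Ici_sdiff_left] at h2
    filter_upwards [h2.eventually_const_lt hg.one_lt_deriv_zero, self_mem_nhdsWithin] with x hx hx0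
    rw [slope_def_field, hg.map_zero, sub_zero, sub_zero, lt_div_iff₀ hx0, one_mul] at hx
    exact hx
  obtain ⟨x, hx, hxu, hx0⟩ := (hs.and ((eventually_nhdsWithin_of_eventually_nhds
    (eventually_lt_nhds h0)).and self_mem_nhdsWithin)).exists
  have hx0 : (0 : ℝ) < x := hx0
  by_contra hcon
  push Not at hcon
  have hcont : ContinuousOn (fun y => g y - y) (Icc x u) :=
    (hg.continuousOn.mono fun y hy => hx0.le.trans hy.1).sub continuousOn_id
  obtain ⟨y, hy, hy0⟩ := intermediate_value_Icc' hxu.le hcont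
    (show (0 : ℝ) ∈ _ from ⟨by linarith, by linarith⟩)
  rcases (hg.fixed_iff y (hx0.le.trans hy.1)).1 (by linarith) with rfl | rfl
  · linarith [hy.1]
  · linarith [hy.2]

lemma exists_reaction (hg : Monostable g κ) (hmono : MonotoneOn g (Ici 0)) :
    ∃ L, Reaction (clamped g κ) κ L := by
  obtain ⟨K, hK⟩ := hg.lipschitz
  have hκ := hg.kappa_pos
  have hm : Monotone (clamped g κ) := fun u v huv =>
    hmono (mem_Ici.2 (le_max_left _ _)) (mem_Ici.2 (le_max_left _ _)) (clamp_mono κ huv)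
  refine ⟨K, hκ, hm, K.2, fun x y => ?_, ?_, ?_, fun u => hg.mapsTo (mem_Ici.2 (le_max_left _ _)),
    fun u => ?_, fun u h0 h1 => ?_⟩
  · have := hK.dist_le_mul _ (clamp_mem hκ.le x) _ (clamp_mem hκ.le y)
    rw [Real.dist_eq, Real.dist_eq] at this
    exact this.trans (mul_le_mul_of_nonneg_left (abs_clamp_sub_clamp_le κ x y) K.2)
  · rw [clamped_of_mem le_rfl hκ.le, hg.map_zero]
  · rw [clamped_of_mem hκ.le le_rfl, hg.map_kappa]
  · have := hmono (mem_Ici.2 (le_max_left 0 (min u κ))) hκ.le (clamp_mem hκ.le u).2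
    rwa [hg.map_kappa] at this
  · rw [clamped_of_mem h0.le h1.le]
    exact hg.lt_apply h0 h1

lemma near_zero (hg : Monostable g κ) : ∃ δ C θ : ℝ, 0 < δ ∧ 0 < C ∧ 0 < θ ∧
    ∀ u, 0 ≤ u → u ≤ δ → |clamped g κ u - birthDeriv g 0 * u| ≤ C * u ^ (1 + θ) := by
  obtain ⟨δ₀, hδ₀, hδκ, hC1, -, C, θ, hC, hθ, -, hbd⟩ := hg.regular
  refine ⟨δ₀ / 2, C, θ, half_pos hδ₀, hC, hθ, fun u h0 h1 => ?_⟩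
  rw [clamped_of_mem h0 (by linarith)]
  rcases h0.eq_or_lt with rfl | h0
  · rw [hg.map_zero, Real.zero_rpow (by linarith)]; simp
  obtain ⟨ξ, hξ, hξd⟩ := exists_deriv_eq_slope g h0
    (hg.continuousOn.mono fun y hy => hy.1) (fun y hy =>
      ((hC1.differentiableOn one_ne_zero).differentiableAt
        (Ico_mem_nhds hy.1 (by linarith [hy.2]))).differentiableWithinAt)
  rw [hg.map_zero, sub_zero, sub_zero, eq_div_iff h0.ne'] at hξd
  have h2 := hbd ξ ⟨hξ.1, by linarith [hξ.2]⟩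
  have h3 : birthDeriv g ξ = deriv g ξ := derivWithin_of_mem_nhds (Ici_mem_nhds hξ.1)
  have h4 : |deriv g ξ - birthDeriv g 0| ≤ C * u ^ θ := by
    rw [← h3]
    refine (le_add_of_nonneg_right (abs_nonneg _)).trans (h2.trans ?_)
    exact mul_le_mul_of_nonneg_left (Real.rpow_le_rpow hξ.1.le hξ.2.le hθ.le) hC.le
  rw [← hξd, ← sub_mul, abs_mul, abs_of_pos h0, Real.rpow_add h0, Real.rpow_one]
  calc _ ≤ C * u ^ θ * u := mul_le_mul_of_nonneg_right h4 h0.le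
    _ = _ := by ring

lemma near_kappa (hg : Monostable g κ) : ∃ δ γ : ℝ, 0 < δ ∧ γ < 1 ∧
    ∀ u v, κ - δ ≤ u → 0 ≤ v → clamped g κ (u + v) ≤ clamped g κ u + γ * v := by
  obtain ⟨δ₀, hδ₀, hδκ, -, hC1, C, θ, hC, hθ, -, hbd⟩ := hg.regular
  have hκ := hg.kappa_pos
  have hlt := hg.deriv_kappa_lt_one
  -- Strictly between `g'(κ)` and `1`, and kept nonnegative because clamping may shorten the
  -- increment `v`.
  set γ := max 0 ((birthDeriv g κ + 1) / 2) with hγ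
  have hγ1 : γ < 1 := max_lt one_pos (by linarith)
  have hγ0 : 0 ≤ γ := le_max_left _ _
  have hlim : Tendsto (fun x : ℝ => C * x ^ θ) (𝓝 0) (𝓝 0) := by
    have := ((Real.continuousAt_rpow_const 0 θ (Or.inr hθ.le)).tendsto).const_mul C
    rwa [Real.zero_rpow hθ.ne', mul_zero] at this
  have k0 : ∀ᶠ x in 𝓝[>] (0 : ℝ), 0 < x := self_mem_nhdsWithin
  obtain ⟨δ, hδ, hδ1, hδ2⟩ := (k0.and (((hlim.eventually_lt_const
    (show 0 < (1 - birthDeriv g κ) / 2 by linarith)).and (eventually_lt_nhds hδ₀)).filter_mono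
      nhdsWithin_le_nhds)).exists
  refine ⟨δ, γ, hδ, hγ1, fun u v hu hv => ?_⟩
  have hmem : ∀ x, κ - δ ≤ x → max 0 (min x κ) ∈ Icc (κ - δ) κ := fun x hx =>
    ⟨le_max_of_le_right (le_min hx (by linarith)), (clamp_mem hκ.le x).2⟩
  have hdiff : ∀ x ∈ Icc (κ - δ) κ, DifferentiableAt ℝ g x := fun x hx =>
    (hC1.differentiableOn one_ne_zero).differentiableAt
      (Ioo_mem_nhds (by linarith [hx.1]) (by linarith [hx.2]))
  have h1 := (convex_Icc (κ - δ) κ).image_sub_le_mul_sub_of_deriv_le (f := g) (C := γ)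
    (fun x hx => (hdiff x hx).continuousAt.continuousWithinAt)
    (fun x hx => (hdiff x (interior_subset hx)).differentiableWithinAt)
    (fun x hx => by
      rw [interior_Icc] at hx
      have h2 := hbd (κ - x) ⟨by linarith [hx.2], by linarith [hx.1]⟩
      have h3 : birthDeriv g (κ - (κ - x)) = deriv g x := by
        rw [sub_sub_cancel]
        exact derivWithin_of_mem_nhds (Ici_mem_nhds (by linarith [hx.1]))
      rw [h3] at h2
      have h4 : (κ - x) ^ θ ≤ δ ^ θ :=
        Real.rpow_le_rpow (by linarith [hx.2]) (by linarith [hx.1]) hθ.le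
      have h5 := mul_le_mul_of_nonneg_left h4 hC.le
      have h6 := neg_abs_le (birthDeriv g κ - deriv g x)
      have h7 := abs_nonneg (birthDeriv g (κ - x) - birthDeriv g 0)
      refine le_trans ?_ (le_max_right 0 ((birthDeriv g κ + 1) / 2))
      linarith)
    _ (hmem u hu) _ (hmem (u + v) (by linarith)) (clamp_mono κ (by linarith))
  have h2 : max 0 (min (u + v) κ) - max 0 (min u κ) ≤ v := by
    have := (le_abs_self _).trans (abs_clamp_sub_clamp_le κ (u + v) u)
    rwa [add_sub_cancel_left, abs_of_nonneg hv] at this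
  have h3 := mul_le_mul_of_nonneg_left h2 hγ0
  rw [clamped, clamped]
  linarith

end Monostable

/-- Monotone fronts are wavefronts. -/
lemma MonoFront.isWavefront {L c h : ℝ} {φ : ℝ → ℝ} (hG : Reaction (clamped g κ) κ L)
    (hφ : MonoFront (clamped g κ) κ c h φ) : IsWavefront g κ h c φ := by
  have hd := hφ.hasDerivAt hG
  have hd2 := hφ.hasDerivAt_profileDeriv hG
  have hderiv : deriv φ = profileDeriv (clamped g κ) c h φ := funext fun t => (hd t).deriv
  have hPd : Differentiable ℝ (profileDeriv (clamped g κ) c h φ) :=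
    fun t => (hd2 t).differentiableAt
  refine ⟨?_, hφ.pos hG, fun t x => ?_, hφ.tendsto_atBot, hφ.tendsto_atTop⟩
  · rw [show (2 : WithTop ℕ∞) = 1 + 1 by norm_num, contDiff_succ_iff_deriv]
    refine ⟨fun t => (hd t).differentiableAt, by simp, ?_⟩
    rw [hderiv, contDiff_one_iff_deriv]
    refine ⟨hPd, ?_⟩
    rw [show deriv (profileDeriv (clamped g κ) c h φ) = _ from funext fun t => (hd2 t).deriv]
    exact ((continuous_const.mul hPd.continuous).add hφ.continuous).sub (hφ.continuous_forcing hG)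
  · have h1 : deriv (fun s => φ (x + c * s)) t = profileDeriv (clamped g κ) c h φ (x + c * t) * c := by
      have h2 : HasDerivAt (fun s : ℝ => x + c * s) c t := by
        simpa using ((hasDerivAt_id t).const_mul c).const_add x
      exact ((hd (x + c * t)).comp t h2).deriv
    have h3 : iteratedDeriv 2 (fun y => φ (y + c * t)) x
        = c * profileDeriv (clamped g κ) c h φ (x + c * t) + φ (x + c * t)
          - clamped g κ (φ (x + c * t - c * h)) := by
      have h4 : deriv (fun y => φ (y + c * t))
          = fun y => profileDeriv (clamped g κ) c h φ (y + c * t) :=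
        funext fun y => ((hd (y + c * t)).comp_add_const y (c * t)).deriv
      rw [iteratedDeriv_succ, iteratedDeriv_one, h4]
      exact ((hd2 (x + c * t)).comp_add_const x (c * t)).deriv
    have h5 : x + c * (t - h) = x + c * t - c * h := by ring
    simp only [h1, h3, h5, clamped_of_mem (hφ.nonneg _) (hφ.le _)]
    ring

/-- A wavefront yields a monotone front of the same speed. -/
lemma IsWavefront.exists_monoFront {L c h : ℝ} {φ : ℝ → ℝ} (hmono : MonotoneOn g (Ici 0))
    (hG : Reaction (clamped g κ) κ L) (hφ : IsWavefront g κ h c φ) :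
    ∃ φ', MonoFront (clamped g κ) κ c h φ' := by
  have hκ := hG.kappa_pos
  have hsm : ContDiff ℝ (1 + 1) φ := by
    have := hφ.smooth
    rwa [show (2 : WithTop ℕ∞) = 1 + 1 by norm_num] at this
  obtain ⟨hd, -, hd'⟩ := contDiff_succ_iff_deriv.1 hsm
  obtain ⟨hd2, -⟩ := contDiff_one_iff_deriv.1 hd'
  obtain ⟨t₁, ht₁⟩ := (hφ.tendsto_atBot.eventually_lt_const hκ).exists
  refine hG.exists_monoFront_of_supersolution hd.continuous (fun t => (hφ.pos t).le)
    (fun e he => hφ.tendsto_atTop.eventually_const_lt (by linarith)) ht₁ fun t _ => ?_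
  refine ⟨φ, deriv φ, deriv (deriv φ) t, rfl, Eventually.of_forall fun _ => le_rfl,
    Eventually.of_forall fun s => (hd s).hasDerivAt, (hd2 t).hasDerivAt, ?_⟩
  have heq := hφ.solves 0 t
  have h1 : deriv (fun s => φ (t + c * s)) 0 = deriv φ t * c := by
    have h2 : HasDerivAt (fun s : ℝ => t + c * s) c 0 := by
      simpa using ((hasDerivAt_id (0 : ℝ)).const_mul c).const_add t
    have h3 : HasDerivAt φ (deriv φ t) (t + c * 0) := by simpa using (hd t).hasDerivAt
    exact (h3.comp 0 h2).deriv
  simp only [h1, mul_zero, add_zero] at heq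
  rw [iteratedDeriv_succ, iteratedDeriv_one] at heq
  -- The wavefront may overshoot `κ`; clamping only lowers the reaction, so it remains a
  -- supersolution.
  have h4 : clamped g κ (φ (t - c * h)) ≤ g (φ (t - c * h)) :=
    hmono (mem_Ici.2 (le_max_left _ _)) (hφ.pos _).le (max_le (hφ.pos _).le (min_le_left _ _))
  rw [show t + c * (0 - h) = t - c * h by ring] at heq
  linarith

/-- If a speed at which `χ` takes negative values is not attained by monotone fronts, then there is
a strictly increasing pushed front with the fast decay at `-∞`. -/
theorem Monostable.exists_pushedFront (hg : Monostable g κ) (hmono : MonotoneOn g (Ici 0))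
    {c₁ h z₀ : ℝ} (hc₁ : 0 < c₁) (hh : 0 ≤ h) (hz₀ : 0 < z₀)
    (hneg : charFun (birthDeriv g 0) h c₁ z₀ < 0)
    (hnot : ¬ ∃ φ, MonoFront (clamped g κ) κ c₁ h φ) :
    ∃ c φ, IsPushedFront g κ h c φ ∧ StrictMono φ ∧ HasPushedAsymptotics g h c φ := by
  obtain ⟨L, hG⟩ := hg.exists_reaction hmono
  obtain ⟨c, hcc, ⟨φ, hφ⟩, hmin⟩ := hG.exists_minimal_speed hh hnot
  have hp := hg.one_lt_deriv_zero
  obtain ⟨δ₁, C, θ, hδ₁, hC, hθ, hzero⟩ := hg.near_zero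
  obtain ⟨δ₂, γ, hδ₂, hγ, hkappa⟩ := hg.near_kappa
  set p := birthDeriv g 0 with hpdef
  have hp0 : 0 ≤ p := by linarith
  have hc : 0 < c := hc₁.trans hcc
  obtain ⟨cs, hcs, hcs1⟩ := exists_isLinearSpeed_lt hp hc₁.le hz₀ hneg
  obtain ⟨z, hz, hzneg⟩ := hcs.exists_charFun_neg hp0 hh (hcs1.trans hcc)
  obtain ⟨l₁, l₂, hroots, hbetween, hderiv⟩ := exists_arePositiveRoots hp hc.le hz hzneg
  refine ⟨c, φ, ⟨hφ.isWavefront hG, ⟨⟨hc, φ, hφ.isWavefront hG⟩, ?_⟩, cs, hcs, hcs1.trans hcc⟩,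
    hφ.strictMono hG, l₁, l₂, hroots, ?_⟩
  · rintro c' ⟨-, φ', hφ'⟩
    exact hmin c' (hφ'.exists_monoFront hmono hG)
  obtain ⟨hl₁, hll, hiff⟩ := hroots
  refine hφ.exists_asymptotics hG (by positivity) hp0 hl₁ hll
    ((hiff l₂ (hl₁.trans hll)).2 (Or.inr rfl)) hderiv hδ₁ hC.le hθ hzero fun y hy1 hy2 => ?_
  by_contra hcon
  push Not at hcon
  have hy : charFun p h c y < 0 := hbetween y hy1 hy2
  have hy0 : 0 < y := hl₁.trans hy1
  -- A slope slightly above `g'(0)` dominates the reaction linearly near `0`, while `χ` stays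
  -- negative at `y`.
  set p' := p + -charFun p h c y / 2 with hp'
  have hχ' : charFun p' h c y < 0 := by
    have h1 : charFun p' h c y
        = charFun p h c y + -charFun p h c y / 2 * Real.exp (-(y * c * h)) := by
      rw [hp']; unfold charFun; ring
    have h2 : Real.exp (-(y * c * h)) ≤ 1 := Real.exp_le_one_iff.2 (by
      rw [neg_nonpos]; positivity)
    rw [h1]
    nlinarith
  have hlim : Tendsto (fun x : ℝ => C * x ^ θ) (𝓝 0) (𝓝 0) := by
    have := ((Real.continuousAt_rpow_const 0 θ (Or.inr hθ.le)).tendsto).const_mul C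
    rwa [Real.zero_rpow hθ.ne', mul_zero] at this
  have k0 : ∀ᶠ x in 𝓝[>] (0 : ℝ), 0 < x := self_mem_nhdsWithin
  obtain ⟨δ₃, hδ₃, hδ₃', hδ₃''⟩ := (k0.and (((hlim.eventually_lt_const
    (show 0 < -charFun p h c y / 2 by linarith)).and (eventually_lt_nhds hδ₁)).filter_mono
      nhdsWithin_le_nhds)).exists
  obtain ⟨c', hlt, hfront⟩ := hφ.exists_slower hG hc hh hy0 hχ' hδ₃ (fun u h0 h1 => by
      have h2 := (abs_le.1 (hzero u h0 (by linarith))).2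
      rcases h0.eq_or_lt with rfl | h0
      · rw [hG.map_zero, mul_zero]
      rw [Real.rpow_add h0, Real.rpow_one] at h2
      have h3 : C * u ^ θ ≤ C * δ₃ ^ θ :=
        mul_le_mul_of_nonneg_left (Real.rpow_le_rpow h0.le h1 hθ.le) hC.le
      have h4 : C * u ^ θ * u ≤ -charFun p h c y / 2 * u :=
        mul_le_mul_of_nonneg_right (by linarith) h0.le
      rw [hp', add_mul]
      linarith) hδ₂ hγ hkappa (fun X => frequently_atBot.2 fun T => by
      obtain ⟨t, ht1, ht2⟩ := hcon X T
      exact ⟨t, ht1, ht2⟩)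
  exact absurd (hmin _ hfront) (not_le.2 hlt)

/-- Persistence of pushed fronts under perturbations of the delay. -/
theorem Monostable.exists_delay_neighborhood (hg : Monostable g κ) (hmono : MonotoneOn g (Ici 0))
    {h₀ : ℝ} (hh₀ : 0 ≤ h₀) (hpush : ∃ c φ, IsPushedFront g κ h₀ c φ) :
    ∃ δ : ℝ, 0 < δ ∧ ∀ h ∈ Ioo (h₀ - δ) (h₀ + δ), 0 ≤ h →
      ∃ c φ, IsPushedFront g κ h c φ ∧ StrictMono φ ∧ HasPushedAsymptotics g h c φ := by
  obtain ⟨c, φ, -, hmin, cs, hcs, hcsc⟩ := hpush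
  obtain ⟨L, hG⟩ := hg.exists_reaction hmono
  have hp := hg.one_lt_deriv_zero
  have hcs0 := hcs.pos (by linarith) hh₀
  -- This speed will separate `c_#(h)` from `c_*(h)` for all `h` near `h₀`.
  obtain ⟨cm, hcm1, hcm2⟩ := exists_between hcsc
  obtain ⟨z, hz, hneg⟩ := hcs.exists_charFun_neg (by linarith) hh₀ hcm1
  -- Otherwise fronts of speed `cm` for delays tending to `h₀` would converge to a front of speed
  -- below `c_*(h₀)`.
  have h1 : ∀ᶠ h in 𝓝[Ici 0] h₀, ¬ ∃ φ, MonoFront (clamped g κ) κ cm h φ := by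
    by_contra hcon
    obtain ⟨h, hh, hex⟩ := exists_seq_forall_of_frequently (not_eventually.1 hcon)
    obtain ⟨φ', hφ'⟩ := hG.exists_monoFront_of_tendsto (c := fun _ => cm) tendsto_const_nhds
      (hh.mono_right nhdsWithin_le_nhds) fun n => not_not.1 (hex n)
    exact absurd (hmin.2 ⟨hcs0.trans hcm1, φ', hφ'.isWavefront hG⟩) (not_le.2 hcm2)
  have h2 : ∀ᶠ h in 𝓝[Ici 0] h₀, charFun (birthDeriv g 0) h cm z < 0 := by
    have : Continuous fun h : ℝ => charFun (birthDeriv g 0) h cm z := by unfold charFun; fun_prop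
    exact ((this.tendsto h₀).eventually_lt_const hneg).filter_mono nhdsWithin_le_nhds
  obtain ⟨δ, hδ, hδ'⟩ := Metric.eventually_nhds_iff.1 (eventually_nhdsWithin_iff.1 (h1.and h2))
  refine ⟨δ, hδ, fun h hh hh0 => ?_⟩
  obtain ⟨k1, k2⟩ := hδ' (y := h) (by
    rw [Real.dist_eq, abs_lt]; constructor <;> linarith [hh.1, hh.2]) hh0
  exact hg.exists_pushedFront hmono (hcs0.trans hcm1) hh0 hz k2 k1

end

/-! ### The cubic example. -/

section

/-- A cubic birth function on `[0, 1]`, constant on `[1, ∞)`. -/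
noncomputable def cubicBirth (u : ℝ) : ℝ := 1 - max (1 - u) 0 ^ 2 * ((30 + 29 * u) / 30)

/-- The derivative of `cubicBirth`. -/
noncomputable def cubicBirthDeriv (u : ℝ) : ℝ :=
  max (1 - u) 0 * (60 + 58 * u - 29 * max (1 - u) 0) / 30

lemma hasDerivAt_max_zero_sq (x : ℝ) : HasDerivAt (fun x : ℝ => max x 0 ^ 2) (2 * max x 0) x := by
  rcases lt_trichotomy x 0 with hx | rfl | hx
  · rw [max_eq_right hx.le, mul_zero]
    refine (hasDerivAt_const x (0 : ℝ)).congr_of_eventuallyEq ?_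
    filter_upwards [eventually_lt_nhds hx] with y hy
    simp [max_eq_right hy.le]
  · rw [max_self, mul_zero, hasDerivAt_iff_isLittleO]
    have h1 : (fun y : ℝ => y ^ 2) =o[𝓝 0] fun y => y := by
      simpa using isLittleO_pow_pow (𝕜 := ℝ) (show 1 < 2 by norm_num)
    refine (IsBigO.of_bound 1 (Eventually.of_forall fun y => ?_)).trans_isLittleO
      (h1.congr_right fun y => (sub_zero y).symm)
    rcases le_total y 0 with hy | hy <;> simp [hy, sq_nonneg]
  · rw [max_eq_left hx.le]
    have h1 : HasDerivAt (fun y : ℝ => y ^ 2) (2 * x) x := by simpa using hasDerivAt_pow 2 x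
    refine h1.congr_of_eventuallyEq ?_
    filter_upwards [eventually_gt_nhds hx] with y hy
    rw [max_eq_left hy.le]

lemma hasDerivAt_cubicBirth (u : ℝ) : HasDerivAt cubicBirth (cubicBirthDeriv u) u := by
  have h1 : HasDerivAt (fun u : ℝ => 1 - u) (-1) u := by
    simpa using (hasDerivAt_id u).const_sub 1
  have h2 : HasDerivAt (fun u : ℝ => (30 + 29 * u) / 30) (29 / 30) u := by
    simpa using (((hasDerivAt_id u).const_mul 29).const_add 30).div_const 30
  refine ((((hasDerivAt_max_zero_sq (1 - u)).comp u h1).mul h2).const_sub 1).congr_deriv ?_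
  simp only [cubicBirthDeriv, Function.comp_apply]
  ring

/-- This form shows the cubic reaction `u(1 - u)(1 + 29u)/30`. Its slope at `1` is `-1`, so the
birth function has slope `0` there and joins the constant in a `C¹` way. -/
lemma cubicBirth_of_le {u : ℝ} (hu : u ≤ 1) :
    cubicBirth u = u + u * (1 - u) * (1 + 29 * u) / 30 := by
  rw [cubicBirth, max_eq_left (by linarith)]; ring

lemma cubicBirth_of_ge {u : ℝ} (hu : 1 ≤ u) : cubicBirth u = 1 := by
  rw [cubicBirth, max_eq_right (by linarith)]; ring

lemma cubicBirthDeriv_of_le {u : ℝ} (hu : u ≤ 1) :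
    cubicBirthDeriv u = (1 - u) * (31 + 87 * u) / 30 := by
  rw [cubicBirthDeriv, max_eq_left (by linarith)]; ring

lemma birthDeriv_cubicBirth {u : ℝ} (hu : 0 ≤ u) :
    birthDeriv cubicBirth u = cubicBirthDeriv u :=
  (hasDerivAt_cubicBirth u).hasDerivWithinAt.derivWithin (uniqueDiffOn_Ici 0 u hu)

lemma continuous_cubicBirth : Continuous cubicBirth := by unfold cubicBirth; fun_prop

lemma contDiff_cubicBirth : ContDiff ℝ 1 cubicBirth := by
  rw [contDiff_one_iff_deriv]
  refine ⟨fun u => (hasDerivAt_cubicBirth u).differentiableAt, ?_⟩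
  rw [show deriv cubicBirth = cubicBirthDeriv from funext fun u => (hasDerivAt_cubicBirth u).deriv]
  unfold cubicBirthDeriv; fun_prop

lemma monotoneOn_cubicBirth : MonotoneOn cubicBirth (Ici 0) := by
  refine monotoneOn_of_deriv_nonneg (convex_Ici 0) continuous_cubicBirth.continuousOn
    (fun u _ => (hasDerivAt_cubicBirth u).differentiableAt.differentiableWithinAt) fun u hu => ?_
  rw [interior_Ici] at hu
  have hu0 : 0 < u := hu
  rw [(hasDerivAt_cubicBirth u).deriv]
  have h1 : max (1 - u) 0 ≤ 1 := max_le (by linarith) zero_le_one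
  have h2 : 0 ≤ max (1 - u) 0 := le_max_right _ _
  refine div_nonneg (mul_nonneg h2 (by linarith)) (by norm_num)

lemma monostable_cubicBirth : Monostable cubicBirth 1 where
  kappa_pos := one_pos
  mapsTo := fun u (hu : 0 ≤ u) => by
    have := monotoneOn_cubicBirth (mem_Ici.2 le_rfl) hu hu
    rw [cubicBirth_of_le zero_le_one] at this
    simpa using this
  continuousOn := continuous_cubicBirth.continuousOn
  fixed_iff := fun u hu => by
    rcases le_total u 1 with h1 | h1
    · rw [cubicBirth_of_le h1]
      constructor
      · intro h
        have h2 : u * (1 - u) * (1 + 29 * u) = 0 := by linarith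
        rcases mul_eq_zero.1 h2 with h3 | h3
        · rcases mul_eq_zero.1 h3 with h4 | h4
          · exact Or.inl h4
          · exact Or.inr (by linarith)
        · linarith
      · rintro (rfl | rfl) <;> norm_num
    · rw [cubicBirth_of_ge h1]
      constructor
      · intro h; exact Or.inr h.symm
      · rintro (rfl | rfl)
        · linarith
        · rfl
  lipschitz := by
    refine ⟨4, (convex_Icc (0 : ℝ) 1).lipschitzOnWith_of_nnnorm_hasDerivWithin_le
      (fun u _ => (hasDerivAt_cubicBirth u).hasDerivWithinAt) fun u hu => ?_⟩
    rw [← NNReal.coe_le_coe, coe_nnnorm, Real.norm_eq_abs, cubicBirthDeriv_of_le hu.2]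
    have h0 := hu.1
    have h1 := hu.2
    rw [abs_of_nonneg (div_nonneg (mul_nonneg (by linarith) (by linarith)) (by norm_num))]
    push_cast
    nlinarith
  one_lt_deriv_zero := by
    rw [birthDeriv_cubicBirth le_rfl, cubicBirthDeriv_of_le zero_le_one]; norm_num
  deriv_kappa_lt_one := by
    rw [birthDeriv_cubicBirth zero_le_one, cubicBirthDeriv_of_le le_rfl]; norm_num
  regular := by
    refine ⟨1 / 2, by norm_num, by norm_num, contDiff_cubicBirth.contDiffOn,
      contDiff_cubicBirth.contDiffOn, 10, 1, by norm_num, one_pos, le_rfl, fun u hu => ?_⟩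
    obtain ⟨h0, h1⟩ := hu
    rw [birthDeriv_cubicBirth h0.le, birthDeriv_cubicBirth le_rfl,
      birthDeriv_cubicBirth zero_le_one, birthDeriv_cubicBirth (by linarith),
      cubicBirthDeriv_of_le (by linarith), cubicBirthDeriv_of_le zero_le_one,
      cubicBirthDeriv_of_le le_rfl, cubicBirthDeriv_of_le (by linarith), Real.rpow_one]
    have e1 : |(1 - u) * (31 + 87 * u) / 30 - (1 - 0) * (31 + 87 * 0) / 30| ≤ 5 * u := by
      rw [abs_le]; constructor <;> nlinarith
    have e2 : |(1 - 1) * (31 + 87 * 1) / 30 - (1 - (1 - u)) * (31 + 87 * (1 - u)) / 30| ≤ 5 * u := by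
      rw [abs_le]; constructor <;> nlinarith
    linarith

/-- An energy estimate excludes monotone fronts of speed `2/5` for the undelayed equation. -/
lemma not_exists_monoFront_cubicBirth :
    ¬ ∃ φ, MonoFront (clamped cubicBirth 1) 1 (2 / 5) 0 φ := by
  rintro ⟨φ, hφ⟩
  obtain ⟨L, hG⟩ := monostable_cubicBirth.exists_reaction monotoneOn_cubicBirth
  set P := MonoFront.profileDeriv (clamped cubicBirth 1) (2 / 5) 0 φ with hP
  have hd : ∀ t, HasDerivAt φ (P t) t := hφ.hasDerivAt hG
  have hd2 : ∀ t, HasDerivAt P (2 / 5 * P t - φ t * (1 - φ t) * (1 + 29 * φ t) / 30) t := fun t => by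
    refine (hφ.hasDerivAt_profileDeriv hG t).congr_deriv ?_
    rw [mul_zero, sub_zero, clamped_of_mem (hφ.nonneg t) (hφ.le t), cubicBirth_of_le (hφ.le t)]
    ring
  have hP0 : ∀ t, 0 ≤ P t := hφ.profileDeriv_nonneg hG
  have hPlim : Tendsto P atBot (𝓝 0) := by
    have h1 := hφ.tendsto_atBot.const_mul (growthRate (2 / 5))
    rw [mul_zero] at h1
    exact squeeze_zero hP0 (hφ.profileDeriv_le hG) h1
  have nonpos : ∀ {D D' : ℝ → ℝ}, (∀ t, HasDerivAt D (D' t) t) → (∀ t, D' t ≤ 0) →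
      Tendsto D atBot (𝓝 0) → ∀ t, D t ≤ 0 := fun hD hD' hlim t =>
    (antitone_of_deriv_nonpos (fun s => (hD s).differentiableAt)
      fun s => by rw [(hD s).deriv]; exact hD' s).ge_of_tendsto hlim t
  -- Here `(φ' - cφ)' = φ'' - cφ'` is minus the reaction, hence nonpositive.
  have hslope : ∀ t, P t - 2 / 5 * φ t ≤ 0 := by
    refine nonpos (fun t => (hd2 t).sub ((hd t).const_mul (2 / 5))) (fun t => ?_) ?_
    · have : 0 ≤ φ t * (1 - φ t) * (1 + 29 * φ t) / 30 := by
        have h0 := hφ.nonneg t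
        have h1 := hφ.le t
        exact div_nonneg (mul_nonneg (mul_nonneg h0 (by linarith)) (by linarith)) (by norm_num)
      linarith
    · simpa using hPlim.sub (hφ.tendsto_atBot.const_mul (2 / 5))
  -- A primitive of the reaction minus `c² u² / 2` with `c = 2/5`. The energy dissipation `c φ'²` is
  -- at most `c² φ φ'`, the derivative of `c² φ² / 2`, so the corrected energy is nonincreasing.
  set Γ : ℝ → ℝ := fun u => (u ^ 2 / 2 + 28 * u ^ 3 / 3 - 29 * u ^ 4 / 4) / 30 - 2 / 25 * u ^ 2 with hΓ
  have hΓc : Continuous Γ := by fun_prop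
  have hΓd : ∀ u, HasDerivAt Γ (u * (1 - u) * (1 + 29 * u) / 30 - 4 / 25 * u) u := fun u => by
    have h2 := hasDerivAt_pow 2 u
    have h3 := hasDerivAt_pow 3 u
    have h4 := hasDerivAt_pow 4 u
    refine (((((h2.div_const 2).add ((h3.const_mul 28).div_const 3)).sub
      ((h4.const_mul 29).div_const 4)).div_const 30).sub (h2.const_mul (2 / 25))).congr_deriv ?_
    push_cast
    ring
  have henergy : ∀ t, P t ^ 2 / 2 + Γ (φ t) ≤ 0 := by
    refine nonpos (fun t => (((hd2 t).pow 2).div_const 2).add ((hΓd (φ t)).comp t (hd t)))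
      (fun t => ?_) ?_
    · have h1 := mul_nonpos_of_nonneg_of_nonpos (hP0 t) (hslope t)
      push_cast
      nlinarith
    · have h1 := ((hPlim.pow 2).div_const 2).add ((hΓc.tendsto 0).comp hφ.tendsto_atBot)
      simpa [hΓ] using h1
  have hlim := (hΓc.tendsto 1).comp hφ.tendsto_atTop
  have h1 : Γ 1 ≤ 0 := le_of_tendsto' hlim fun t => by
    have := henergy t
    have := sq_nonneg (P t)
    simp only [Function.comp_apply]
    linarith
  -- `Γ 1 = 31/360 - 2/25` is positive.
  norm_num [hΓ] at h1

lemma exists_pushedFront_cubicBirth : ∃ c φ, IsPushedFront cubicBirth 1 0 c φ := by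
  -- `z₀ = c₁ / 2` is the vertex of `z² - c₁ z + 1/30`, where the value is `-1/150`.
  obtain ⟨c, φ, h, -⟩ := monostable_cubicBirth.exists_pushedFront monotoneOn_cubicBirth
    (c₁ := 2 / 5) (h := 0) (z₀ := 1 / 5) (by norm_num) le_rfl (by norm_num) (by
      rw [birthDeriv_cubicBirth le_rfl, cubicBirthDeriv_of_le zero_le_one, charFun]
      norm_num) not_exists_monoFront_cubicBirth
  exact ⟨c, φ, h⟩

end

end DelayedFront

theorem proposition1 :
    (∀ (g : ℝ → ℝ) (κ : ℝ), DelayedFront.Monostable g κ → MonotoneOn g (Set.Ici 0) →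
      ∀ (h₀ : ℝ), 0 ≤ h₀ →
      (∃ (c : ℝ) (φ : ℝ → ℝ), DelayedFront.IsPushedFront g κ h₀ c φ) →
      ∃ δ : ℝ, 0 < δ ∧
        (∀ h ∈ Set.Ioo (h₀ - δ) (h₀ + δ), 0 ≤ h →
          ∃ (c : ℝ) (φ : ℝ → ℝ), DelayedFront.IsPushedFront g κ h c φ) ∧
        (∃ h ∈ Set.Ioo (h₀ - δ) (h₀ + δ), 0 < h ∧
          ∃ (c : ℝ) (φ : ℝ → ℝ), DelayedFront.IsPushedFront g κ h c φ ∧ StrictMono φ ∧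
            DelayedFront.HasPushedAsymptotics g h c φ)) ∧
    (∃ (g : ℝ → ℝ) (κ : ℝ), DelayedFront.Monostable g κ ∧ MonotoneOn g (Set.Ici 0) ∧
      ∃ h : ℝ, 0 < h ∧
        ∃ (c : ℝ) (φ : ℝ → ℝ), DelayedFront.IsPushedFront g κ h c φ ∧ StrictMono φ ∧
          DelayedFront.HasPushedAsymptotics g h c φ) := by
  refine ⟨fun g κ hg hmono h₀ hh₀ hpush => ?_, DelayedFront.cubicBirth, 1,
    DelayedFront.monostable_cubicBirth, DelayedFront.monotoneOn_cubicBirth, ?_⟩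
  · obtain ⟨δ, hδ, hex⟩ := hg.exists_delay_neighborhood hmono hh₀ hpush
    refine ⟨δ, hδ, fun h hh hh0 => ?_, h₀ + δ / 2, ⟨by linarith, by linarith⟩, by linarith,
      hex (h₀ + δ / 2) ⟨by linarith, by linarith⟩ (by linarith)⟩
    obtain ⟨c, φ, hφ, -⟩ := hex h hh hh0
    exact ⟨c, φ, hφ⟩
  · obtain ⟨δ, hδ, hex⟩ := DelayedFront.monostable_cubicBirth.exists_delay_neighborhood
      DelayedFront.monotoneOn_cubicBirth le_rfl DelayedFront.exists_pushedFront_cubicBirth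
    exact ⟨δ / 2, half_pos hδ, hex (δ / 2) ⟨by linarith, by linarith⟩ (half_pos hδ).le⟩
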